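/- **Notation.** Indices $i,j,k$ run over $1,2,3$, repeated indices are summed, $\varepsilon_{ijk}$ is the totally antisymmetric tensor. $G=\mathbb R^3\times\mathbb R^3$ has coordinates $(x^*,x)$ and the product $(v^*,v)(w^*,w)=(v^*+w^*+\tfrac12\det(v,w,\cdot),v+w)$; $\Gamma\subset G$ is the subgroup generated by $\mathbb Z^3\times 0$ and $0\times\mathbb Z^3$, and $X=\Gamma\backslash G$ is the double twisted torus. All vector spaces are complex. **Modes of super-loops.** $\mathscr L$ is the Lie superalgebra with even basis $\hbar, W^i, W^*_i$ (degree $0$), $x^i_n, x^*_{i,n}$ ($n\in\mathbb Z$, degree $n$) and odd basis $\psi^i_r,\psi^*_{i,r}$ ($r\in\frac12+\mathbb Z$, degree $r$), whose nonzero brackets are, up to super-antisymmetry, $$[\psi^*_{i,r},\psi^j_s]=\delta_i^j\delta_{r,-s}\hbar,\quad [x^*_{i,m},x^j_n]=\tfrac1n\delta_i^j\delta_{m,-n}\hbar\ (n\ne0),\quad [W^*_i,x^j_n]=[W^j,x^*_{i,n}]=\delta_i^j\delta_{n,0}\hbar,$$ $$[W^*_i,W^*_j]=-\varepsilon_{ijk}W^k,\quad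 [W^*_i,x^*_{j,n}]=-\tfrac12\varepsilon_{ijk}x^k_n,\quad [W^*_i,\psi^*_{j,r}]=-\tfrac12\varepsilon_{ijk}\psi^k_r,\quad [x^*_{i,m},\psi^*_{j,r}]=\tfrac1{2m}\varepsilon_{ijk}\psi^k_{m+r}\ (m\ne0),$$ $$[x^*_{i,m},x^*_{j,n}]=\tfrac12\varepsilon_{ijk}\tfrac{m+n}{mn}x^k_{m+n}+\tfrac{\delta_{m,-n}}{m^2}\varepsilon_{ijk}W^k\ (m,n\neq0),\quad [x^*_{i,n},x^*_{j,0}]=\tfrac1{2n}\varepsilon_{ijk}x^k_n\ (n\ne0).$$ $\mathscr L^b$ is its even part. For $U\subset G$ open (for instance the domain of a coordinate chart of $X$), the degree zero modes act on $C^\infty(U)$ by $W^i=\partial_{x^*_i}$, $W^*_i=\partial_{x^i}+\tfrac12\varepsilon_{ijk}x^j\partial_{x^*_k}$, $x^i_0=x^i$, $x^*_{i,0}=x^*_i$, $\hbar=1$; modes of positive degree act by $0$. Put $\mathscr H(U)=\mathrm{Ind}_{\mathscr L_{\ge0}}^{\mathscr L}C^\infty(U)$, $\mathscr H^b(U)=\mathrm{Ind}_{\mathscr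 L^b_{\ge0}}^{\mathscr L^b}C^\infty(U)$. **The global space.** The coordinates and $W^*_i$ are not single-valued on $X$; the global space is built from the single-valued currents. $\tilde{\mathfrak g}_{\rm super}$ has even basis $\mathbb 1,\alpha^i_n,\beta_{i,n}$, odd basis $\bar\alpha^i_r,\bar\beta_{i,r}$ and nonzero brackets $[\beta_{i,m},\beta_{j,n}]=\varepsilon_{ijk}\alpha^k_{m+n}$, $[\beta_{i,m},\bar\beta_{j,r}]=\varepsilon_{ijk}\bar\alpha^k_{m+r}$, $[\beta_{i,m},\alpha^j_n]=m\delta_i^j\delta_{m,-n}\mathbb 1$, $[\bar\beta_{i,r},\bar\alpha^j_s]=\delta_i^j\delta_{r,-s}\mathbb 1$. The zero modes $\alpha^i_0,\beta_{i,0}$ act on $C^\infty(X)$ by the left invariant vector fields $\partial_{x^*_i}$, $\partial_{x^i}-\frac12\varepsilon_{ijk}x^j\partial_{x^*_k}$, and $\mathbb 1=1$. $\mathscr H(X)$ and $\mathscr H^b(X)$ are induced from $C^\infty(X)$, as above, to $\tilde{\mathfrak g}_{\rm super}$ and to its even part. **Fermions.** $\mathscr H^f$ is the Fock space, with vacuum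 $|0\rangle^f$, of free fermions $\psi^i(z)=\sum_r\psi^i_rz^{-r-1/2}$, $\psi^*_i(z)=\sum_r\psi^*_{i,r}z^{-r-1/2}$ with $[\psi^*_{i,r},\psi^j_s]=\delta_i^j\delta_{r,-s}$, modes of positive degree annihilating $|0\rangle^f$. $|0\rangle^b$ is the constant function $1$. **Theorem.** On $\mathscr H^f$ one has $\psi^*_i(z)\psi^j(w)\sim\delta_i^j/(z-w)$, the other OPEs of the generating fields being trivial. (1) For every open $U\subset G$ there is a unique linear isomorphism $\Phi:\mathscr H^b(U)\otimes\mathscr H^f\to\mathscr H(U)$ with $\Phi(f\otimes|0\rangle^f)=f$ for $f\in C^\infty(U)$, such that $\psi^i_r,\psi^*_{i,r}$ act through the second factor, and the modes $\hbar,W^i,x^i_n,x^*_{i,0}$, $x^*_{i,m}$ ($m\ne0$), $W^*_i$ of $\mathscr L^b$ acting on the first factor correspond to the operators $\hbar,W^i,x^i_n,x^*_{i,0}$, $$\tilde x^*_{i,m}=x^*_{i,m}+\tfrac1{4m}\varepsilon_{ijk}\sum_r\psi^j_r\psi^k_{m-r},\qquad \tilde W^*_i=W^*_i-\tfrac14\varepsilon_{ijk}\sum_r\psi^j_r\psi^k_{-r}$$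 on $\mathscr H(U)$. (2) Likewise there is a unique linear isomorphism $\Phi:\mathscr H^b(X)\otimes\mathscr H^f\to\mathscr H(X)$ with $\Phi(f\otimes|0\rangle^f)=f$ for $f\in C^\infty(X)$, such that $\bar\alpha^i_r,\bar\beta_{i,r}$ correspond to $\psi^i_r,\psi^*_{i,r}$ on the second factor, and the modes $\mathbb 1,\alpha^i_n,\beta_{i,n}$ on the first factor correspond to $\mathbb 1,\alpha^i_n$, $\beta_{i,n}+\frac12\varepsilon_{ijk}\sum_r\bar\alpha^j_r\bar\alpha^k_{n-r}$. In both cases: (a) $\Phi$ respects parity and degree. For any Hilbert space completions of $\mathscr H^b$ and $\mathscr H^f$ (Hilbert spaces containing them as dense subspaces), $\Phi$ makes the Hilbert tensor product of these completions a Hilbert space completion of $\mathscr H$. In case (2), call a sesquilinear form contravariant if it extends the $L^2$ pairing on $C^\infty(X)$ (resp. the standard pairing on $\mathbb C|0\rangle^f$) and the adjoints of $\alpha^i_n,\beta_{i,n},\bar\alpha^i_r,\bar\beta_{i,r},\mathbb 1$ are $-\alpha^i_{-n},-\beta_{i,-n},\bar\alpha^i_{-r},\bar\beta_{i,-r},\mathbb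 1$ (resp. those of $\psi^i_r,\psi^*_{i,r}$ are $\psi^i_{-r},\psi^*_{i,-r}$); then, given contravariant forms on $\mathscr H^b(X)$ and $\mathscr H^f$, there is exactly one on $\mathscr H(X)$, and $\Phi$ carries the product form to it. (b) Each smooth function acts on $\mathscr H$ by a unique multiplication operator: it extends multiplication of functions, commutes with $x^i_n$ in case (1) (with $\alpha^i_n$, $n\neq0$, in case (2)) and with the odd modes, and satisfies $[x^*_{i,n},g]=\frac1{2n}\varepsilon_{ijk}x^k_n\,\partial_{x^*_j}g$ in case (1), $[\beta_{i,n},g]=-\frac1{2n}\varepsilon_{ijk}\alpha^k_n\,\partial_{x^*_j}g$ in case (2), for $n\ne0$. Let the state-field correspondence assign to a function $f$ the normally ordered Taylor expansion, at the zero modes, of $f(x(z),x^*(z))$, where $x^i(z)=W^i\log z+\sum_nx^i_nz^{-n}$ and $x^*_i(z)=W^*_i\log z+\sum_n x^*_{i,n}z^{-n}+\frac{\log z}2\varepsilon_{ijk}W^jx^k(z)$ in the decoupled modes (over $X$: along left invariant vector fields, with the modes expressed through the currents); to $|0\rangle^b\otimes|0\rangle^f$, as a fermionic state, the identity; and to $a_{-k-1}v$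 the normally ordered product of $\partial^ka(z)/k!$ with the field of $v$, for $a$ one of the decoupled currents $\alpha^i=\partial x^i,\ \beta_i=\partial x^*_i-\frac12\varepsilon_{ijk}x^j\partial x^k$, respectively one of the fermions, $a(z)=\sum a_nz^{-n-1}$. Then the vectors that have a bosonic field are exactly those of $\mathscr H^b\otimes|0\rangle^f$, the homogeneous vectors that have a fermionic field are exactly those of $|0\rangle^b\otimes\mathscr H^f$, each such field $A(z)$ of a vector $v$ satisfies $A(z)(|0\rangle^b\otimes|0\rangle^f)=v+O(z)$ without logarithms, and every field of a vector in $\mathscr H^b\otimes|0\rangle^f$ has trivial OPE (all coefficients commute) with every field of a vector in $|0\rangle^b\otimes\mathscr H^f$. -/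

import Mathlib

open scoped TensorProduct ContDiff

noncomputable section

namespace SuperLoop

/-! ### Lie superalgebras with a chosen basis, enveloping algebras, induced modules -/

/-- A Lie superalgebra over `ℂ` given by a homogeneous basis `ι` of modes: parity, degree and the
table of super-brackets. All degrees are doubled, so that they are integers. -/
structure ModeAlgebra (ι : Type) where
  odd : ι → Bool
  deg : ι → ℤ
  bracket : ι → ι → (ι →₀ ℂ)

/-- The sign `(-1)^{pq}`. -/
def koszul (p q : Bool) : ℂ := if p && q then -1 else 1

section General

variable {ι : Type} (S : ModeAlgebra ι)

/-- The relations `a b - (-1)^{|a||b|} b a = [a, b]` between basis elements. -/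
inductive EnvRel : FreeAlgebra ℂ ι → FreeAlgebra ℂ ι → Prop
  | comm (a b : ι) : EnvRel
      (FreeAlgebra.ι ℂ a * FreeAlgebra.ι ℂ b
        - koszul (S.odd a) (S.odd b) • (FreeAlgebra.ι ℂ b * FreeAlgebra.ι ℂ a))
      (Finsupp.linearCombination ℂ (FreeAlgebra.ι ℂ : ι → FreeAlgebra ℂ ι) (S.bracket a b))

/-- The universal enveloping algebra. -/
def Env : Type := RingQuot (EnvRel S)

instance : Ring (Env S) := inferInstanceAs (Ring (RingQuot (EnvRel S)))

instance : Algebra ℂ (Env S) := inferInstanceAs (Algebra ℂ (RingQuot (EnvRel S)))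

/-- The generator of the enveloping algebra attached to a basis element. -/
def gen (a : ι) : Env S := RingQuot.mkAlgHom ℂ (EnvRel S) (FreeAlgebra.ι ℂ a)

variable {C : Type} [AddCommGroup C] [Module ℂ C] (ρ : ι → C →ₗ[ℂ] C)

/-- The action on `C` of the modes of degree `≥ 0`: modes of degree zero act through `ρ`, those of
positive degree act by zero. -/
def extendedAction (y : ι) : C →ₗ[ℂ] C := if S.deg y = 0 then ρ y else 0

/-- The relations `u y ⊗ c = u ⊗ y c`, for `y` of degree `≥ 0`. -/
def indRel : Submodule (Env S) (Env S ⊗[ℂ] C) :=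
  Submodule.span (Env S) {t | ∃ (u : Env S) (y : ι) (c : C), 0 ≤ S.deg y ∧
    t = (u * gen S y) ⊗ₜ[ℂ] c - u ⊗ₜ[ℂ] (extendedAction S ρ y c)}

/-- The module induced from the part of degree `≥ 0`. -/
abbrev Ind : Type := (Env S ⊗[ℂ] C) ⧸ indRel S ρ

/-- The inclusion of `C` in the induced module. -/
def vac : C →ₗ[ℂ] Ind S ρ where
  toFun c := (indRel S ρ).mkQ ((1 : Env S) ⊗ₜ[ℂ] c)
  map_add' a b := by rw [TensorProduct.tmul_add, map_add]
  map_smul' r a := by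
    rw [TensorProduct.tmul_smul]; rfl

/-- The operator by which a mode acts on the induced module. -/
def act (y : ι) : Ind S ρ →ₗ[ℂ] Ind S ρ where
  toFun v := gen S y • v
  map_add' a b := smul_add _ a b
  map_smul' r a := smul_comm _ r a

/-- A product of modes applied to an element of `C`. -/
def word (l : List ι) (c : C) : Ind S ρ := l.foldr (fun y v => act S ρ y v) (vac S ρ c)

/-- The even (`p = false`) and the odd (`p = true`) part of the induced module. -/
def parityPart (p : Bool) : Submodule ℂ (Ind S ρ) :=
  Submodule.span ℂ {v | ∃ (l : List ι) (c : C),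
    l.foldr (fun y b => xor (S.odd y) b) false = p ∧ v = word S ρ l c}

/-- The homogeneous parts of the induced module (`C` has degree zero; degrees are doubled). -/
def degPart (d : ℤ) : Submodule ℂ (Ind S ρ) :=
  Submodule.span ℂ {v | ∃ (l : List ι) (c : C), (l.map S.deg).sum = d ∧ v = word S ρ l c}

/-- `h` is the sesquilinear form on the induced module that extends `pair` on `C` and for which the
adjoint of the mode `y` is `sgn y` times the mode `dag y`. -/
def IsContravariant (pair : C → C → ℂ) (dag : ι → ι) (sgn : ι → ℝ)
    (h : Ind S ρ →ₗ⋆[ℂ] Ind S ρ →ₗ[ℂ] ℂ) : Prop :=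
  (∀ c d, h (vac S ρ c) (vac S ρ d) = pair c d) ∧
  ∀ y v w, h (act S ρ y v) w = (sgn y : ℂ) * h v (act S ρ (dag y) w)

end General

/-! ### Adding three pairs of fermions -/

/-- The totally antisymmetric tensor with `ε₀₁₂ = 1`. -/
def eps (i j k : Fin 3) : ℝ :=
  (((j : ℕ) : ℝ) - ((i : ℕ) : ℝ)) * (((k : ℕ) : ℝ) - ((i : ℕ) : ℝ)) *
    (((k : ℕ) : ℝ) - ((j : ℕ) : ℝ)) / 2

/-- Fermionic modes. `psi i n` is `ψ^i_{n+1/2}` and `psis i n` is `ψ^*_{i,n+1/2}`, so that in both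
cases `n` is the mode at `z^{-n-1}`. -/
inductive FGen
  | psi (i : Fin 3) (n : ℤ)
  | psis (i : Fin 3) (n : ℤ)

/-- The extension of an even mode algebra by odd modes `ψ^i_r`, `ψ^*_{i,r}` whose only nonzero
brackets are `[ψ^*_{i,r}, ψ^j_s] = δ_i^j δ_{r,-s} z`, with `z` the central element, and
`[b, ψ] = mix b ψ` for `b` even. -/
def withFermions {ι : Type} (B : ModeAlgebra ι) (z : ι) (mix : ι → FGen → (FGen →₀ ℂ)) :
    ModeAlgebra (ι ⊕ FGen) where
  odd := Sum.elim B.odd (fun _ => true)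
  deg
    | .inl b => B.deg b
    | .inr (.psi _ n) => 2 * n + 1
    | .inr (.psis _ n) => 2 * n + 1
  bracket
    | .inl a, .inl b => (B.bracket a b).mapDomain Sum.inl
    | .inl a, .inr f => (mix a f).mapDomain Sum.inr
    | .inr f, .inl a => -(mix a f).mapDomain Sum.inr
    | .inr (.psis i m), .inr (.psi j n) =>
        if i = j ∧ m + n = -1 then Finsupp.single (.inl z) 1 else 0
    | .inr (.psi j n), .inr (.psis i m) =>
        if i = j ∧ m + n = -1 then Finsupp.single (.inl z) 1 else 0
    | .inr (.psi _ _), .inr (.psi _ _) => 0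
    | .inr (.psis _ _), .inr (.psis _ _) => 0

/-- The action of the degree zero modes on `C` when fermions (which have no mode of degree zero)
are added. -/
def withFermionsAction {ι C : Type} [AddCommGroup C] [Module ℂ C] (ρ : ι → C →ₗ[ℂ] C) :
    ι ⊕ FGen → C →ₗ[ℂ] C := Sum.elim ρ (fun _ => 0)

/-- The one-dimensional mode algebra spanned by a central element of degree zero. -/
def centralLine : ModeAlgebra Unit where
  odd _ := false
  deg _ := 0
  bracket _ _ := 0

/-- The mode algebra of three free fermion pairs. -/
abbrev fermions : ModeAlgebra (Unit ⊕ FGen) := withFermions centralLine () (fun _ _ => 0)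

/-- The central element acts on the vacuum line as the identity. -/
abbrev fermionsAction : Unit ⊕ FGen → ℂ →ₗ[ℂ] ℂ := withFermionsAction (fun _ => LinearMap.id)

/-- The Fock space of three free fermion pairs. -/
abbrev Fock : Type := Ind fermions fermionsAction

/-- The fermionic vacuum. -/
def fockVac : Fock := vac fermions fermionsAction 1

section Extension

variable {ι : Type} (B : ModeAlgebra ι) (z : ι) (mix : ι → FGen → (FGen →₀ ℂ))
  {C : Type} [AddCommGroup C] [Module ℂ C] (ρ : ι → C →ₗ[ℂ] C)

/-- The induced module of an extension by fermions. -/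
abbrev SuperInd : Type := Ind (withFermions B z mix) (withFermionsAction ρ)

/-- Even modes on the induced module. -/
abbrev bAct (y : ι) : SuperInd B z mix ρ →ₗ[ℂ] SuperInd B z mix ρ :=
  act (withFermions B z mix) (withFermionsAction ρ) (.inl y)

/-- Odd modes on the induced module. -/
abbrev fAct (f : FGen) : SuperInd B z mix ρ →ₗ[ℂ] SuperInd B z mix ρ :=
  act (withFermions B z mix) (withFermionsAction ρ) (.inr f)

/-- The inclusion of `C`. -/
abbrev sVac : C →ₗ[ℂ] SuperInd B z mix ρ := vac (withFermions B z mix) (withFermionsAction ρ)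

/-- The bilinear mode `∑_{j,k} ε_{ijk} ∑_r ψ^j_r ψ^k_{m-r}`, `r ∈ 1/2 + ℤ`. On a given vector only
finitely many summands do not vanish. -/
def quad (i : Fin 3) (m : ℤ) (v : SuperInd B z mix ρ) : SuperInd B z mix ρ :=
  ∑ j, ∑ k, (eps i j k : ℂ) •
    ∑ᶠ n : ℤ, fAct B z mix ρ (.psi j n) (fAct B z mix ρ (.psi k (m - n - 1)) v)

/-- `Φ` identifies `Ind^B C ⊗ Fock` with the induced module of the extension so that
`c ⊗ |0⟩` corresponds to `c`, the odd modes act on the second factor, and each even mode `y` of the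
first factor acts as `y` corrected by the operator `shift y`. -/
def IsFactorization (shift : ι → SuperInd B z mix ρ → SuperInd B z mix ρ)
    (Φ : (Ind B ρ ⊗[ℂ] Fock) ≃ₗ[ℂ] SuperInd B z mix ρ) : Prop :=
  (∀ c, Φ (vac B ρ c ⊗ₜ fockVac) = sVac B z mix ρ c) ∧
  (∀ y h b, Φ (act B ρ y h ⊗ₜ b) = bAct B z mix ρ y (Φ (h ⊗ₜ b)) + shift y (Φ (h ⊗ₜ b))) ∧
  (∀ f h b, Φ (h ⊗ₜ act fermions fermionsAction (.inr f) b) = fAct B z mix ρ f (Φ (h ⊗ₜ b)))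

/-- `Φ` respects parity (the first factor is even) and degree. -/
def PreservesGradings (Φ : (Ind B ρ ⊗[ℂ] Fock) ≃ₗ[ℂ] SuperInd B z mix ρ) : Prop :=
  (∀ p : Bool, Submodule.span ℂ {v | ∃ h, ∃ b ∈ parityPart fermions fermionsAction p,
      v = Φ (h ⊗ₜ b)} = parityPart (withFermions B z mix) (withFermionsAction ρ) p) ∧
  (∀ d : ℤ, Submodule.span ℂ {v | ∃ d₁ d₂ : ℤ, d₁ + d₂ = d ∧ ∃ h ∈ degPart B ρ d₁,
      ∃ b ∈ degPart fermions fermionsAction d₂, v = Φ (h ⊗ₜ b)} =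
        degPart (withFermions B z mix) (withFermionsAction ρ) d)

end Extension

/-- For all Hilbert space completions of the factors `A` and `F`, the Hilbert tensor product of the
completions is, through `Φ`, a Hilbert space completion of `H`. -/
def CompletesToHilbertTensor {A F H : Type} [AddCommGroup A] [Module ℂ A] [AddCommGroup F]
    [Module ℂ F] [AddCommGroup H] [Module ℂ H] (Φ : (A ⊗[ℂ] F) ≃ₗ[ℂ] H) : Prop :=
  ∀ (K L : Type) [NormedAddCommGroup K] [InnerProductSpace ℂ K] [CompleteSpace K]
    [NormedAddCommGroup L] [InnerProductSpace ℂ L] [CompleteSpace L]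
    (jA : A →ₗ[ℂ] K) (jF : F →ₗ[ℂ] L),
    Function.Injective jA → DenseRange jA → Function.Injective jF → DenseRange jF →
    ∃! j : H →ₗ[ℂ] UniformSpace.Completion (K ⊗[ℂ] L),
      (∀ a b, j (Φ (a ⊗ₜ b)) = ((jA a ⊗ₜ[ℂ] jF b : K ⊗[ℂ] L) :
        UniformSpace.Completion (K ⊗[ℂ] L))) ∧
      Function.Injective j ∧ DenseRange j

/-! ### Fields and operator product expansions -/

section Fields

variable {H : Type} [AddCommGroup H] [Module ℂ H]

/-- A field whose coefficients may involve `log z`: `A p q` is the coefficient of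
`z^p (log z)^q`. -/
abbrev LogField (H : Type) : Type := ℤ → ℕ → H → H

/-- The OPE `a(z) b(w) ∼ ∑_{j<N} c_j(w) / (z-w)^{j+1}` of fields `a(z) = ∑ a_n z^{-n-1}` etc., in
terms of modes; `σ` is the sign of the super-commutator. -/
def HasOPE (σ : ℂ) (a b : ℤ → H → H) (N : ℕ) (c : ℕ → ℤ → H → H) : Prop :=
  ∀ (m n : ℤ) (v : H), a m (b n v) - σ • b n (a m v) =
    ∑ j ∈ Finset.range N, ((Ring.choose m j : ℤ) : ℂ) • c j (m + n - j) v

/-- The constant field `r · id`, in terms of modes. -/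
def constField (r : ℂ) (n : ℤ) (v : H) : H := if n = -1 then r • v else 0

/-- The OPE between an even field and another field is trivial: there is no singular part, i.e.
all coefficients commute. -/
def TrivialOPE (A B : LogField H) : Prop :=
  ∀ p q p' q' v, A p q (B p' q' v) = B p' q' (A p q v)

/-- The identity field. -/
def idField : LogField H := fun p q v => if p = 0 ∧ q = 0 then v else 0

/-- The normally ordered product `:(∂^k a(z)/k!) A(z):` with `a(z) = ∑ a_n z^{-n-1}`; `σ` is the
sign that arises from passing `a` through `A`. -/
def nprod (σ : ℂ) (a : ℤ → H → H) (k : ℕ) (A : LogField H) : LogField H := fun p q v =>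
  ∑ᶠ n : ℤ, ((Ring.choose (-n - 1) k : ℤ) : ℂ) •
    (if n < 0 then a n (A (p + n + 1 + k) q v) else σ • A (p + n + 1 + k) q (a n v))

/-- The state-field correspondence generated by the currents `cur` (all of parity `o`) from given
even pairs `base`: the field of `a_{-k-1} v` is the normally ordered product of `∂^k a(z)/k!` with
the field of `v`. `StateField cur o base p v A` says that `A` is the field of the state `v`
of parity `p`. -/
inductive StateField {κ : Type} (cur : κ → ℤ → H → H) (o : Bool) (base : H → LogField H → Prop) :
    Bool → H → LogField H → Prop
  | base (v : H) (A : LogField H) : base v A → StateField cur o base false v A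
  | current (x : κ) (k : ℕ) (p : Bool) (v : H) (A : LogField H) : StateField cur o base p v A →
      StateField cur o base (xor o p) (cur x (-(k : ℤ) - 1) v) (nprod (koszul o p) (cur x) k A)
  | add (p : Bool) (v w : H) (A B : LogField H) : StateField cur o base p v A →
      StateField cur o base p w B → StateField cur o base p (v + w) (A + B)
  | smul (p : Bool) (r : ℂ) (v : H) (A : LogField H) : StateField cur o base p v A →
      StateField cur o base p (r • v) (r • A)

/-- `A(z)|0⟩` is regular at `z = 0`, without logarithms, with value `v`. -/
def Creates (vacuum v : H) (A : LogField H) : Prop :=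
  A 0 0 vacuum = v ∧ ∀ p q, (p < 0 ∨ 0 < q) → A p q vacuum = 0

end Fields

/-! ### Fields of functions of the coordinates

The terms of the expansions of the coordinates `x^i(z)`, `x^*_i(z)` around their zero modes:
`x^i_n z^{-n}`, `W^i log z`, `y_{i,n} z^{-n}`, `D_i log z` and
`ε_{ijk} W^j x^k_n z^{-n} (log z) / 2`, with `n ≠ 0`. -/

/-- A term of the expansion. -/
inductive Term
  | x (i : Fin 3) (n : {n : ℤ // n ≠ 0})
  | xlog (i : Fin 3)
  | xs (i : Fin 3) (n : {n : ℤ // n ≠ 0})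
  | xslog (i : Fin 3)
  | mixed (i j k : Fin 3) (n : {n : ℤ // n ≠ 0})

/-- The exponent of `z`. -/
def Term.zexp : Term → ℤ
  | .x _ n | .xs _ n | .mixed _ _ _ n => -n.1
  | _ => 0

/-- The exponent of `log z`. -/
def Term.lexp : Term → ℕ
  | .xlog _ | .xslog _ | .mixed _ _ _ _ => 1
  | _ => 0

/-- The numerical coefficient. -/
def Term.coeff : Term → ℂ
  | .mixed i j k _ => (eps i j k : ℂ) / 2
  | _ => 1

/-- The operators on the state space `H` and on the functions `C` that enter the fields of
functions: the modes `x^i_n`, `W^i`, `y_{i,n}`, `D_i`, the derivations of `C` in the directions of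
`x^i` and `x^*_i`, and the multiplication operators on `H`. -/
structure ExpansionOps (H C : Type) where
  x : Fin 3 → ℤ → H → H
  w : Fin 3 → H → H
  y : Fin 3 → ℤ → H → H
  d : Fin 3 → H → H
  px : Fin 3 → C → C
  ps : Fin 3 → C → C
  mul : C → H → H

section FunctionFields

variable {H C : Type} [AddCommGroup H] [Module ℂ H] [AddCommGroup C] [Module ℂ C]
  (O : ExpansionOps H C)

/-- The derivation of `C` that a term multiplies in a Taylor expansion. -/
def Term.partial : Term → C → C
  | .x i _ | .xlog i => O.px i
  | .xs i _ | .xslog i | .mixed i _ _ _ => O.ps i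

/-- The part of the term that stands on the left in normal ordering: modes of negative degree. -/
def Term.left : Term → H → H
  | .x i n => fun v => if n.1 < 0 then O.x i n v else v
  | .xs i n => fun v => if n.1 < 0 then O.y i n v else v
  | .mixed _ _ k n => fun v => if n.1 < 0 then O.x k n v else v
  | _ => fun v => v

/-- The part of the term that stands on the right in normal ordering: modes of degree zero and of
positive degree. -/
def Term.right : Term → H → H
  | .x i n => fun v => if n.1 < 0 then v else O.x i n v
  | .xlog i => O.w i
  | .xs i n => fun v => if n.1 < 0 then v else O.y i n v
  | .xslog i => O.d i
  | .mixed _ j k n => fun v => if n.1 < 0 then O.w j v else O.w j (O.x k n v)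

/-- The iterated derivative along a sequence of terms, averaged over all orders. -/
def symPartial (l : List Term) (f : C) : C :=
  (1 / (l.length.factorial : ℂ)) •
    (l.permutations.map fun l' => l'.foldr (fun t g => t.partial O g) f).sum

/-- The field `:f(x(z), x^*(z)):` of a function `f`: the Taylor expansion at the zero modes,
normally ordered. The coefficient of `z^p (log z)^q` is the sum over all finite sequences of terms
with total exponents `p` and `q`; on a given vector only finitely many summands do not vanish. -/
def functionField (f : C) : LogField H :=
  fun p q v => ∑ᶠ l : {l : List Term // (l.map Term.zexp).sum = p ∧ (l.map Term.lexp).sum = q},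
    ((l.1.map Term.coeff).prod / (l.1.length.factorial : ℂ)) •
      l.1.foldr (fun t w => t.left O w)
        (O.mul (symPartial O l.1 f) (l.1.foldr (fun t w => t.right O w) v))

end FunctionFields

/-! ### The double twisted torus -/

/-- `V^* × V` with coordinates `(x^*, x)`. -/
abbrev E : Type := (Fin 3 → ℝ) × (Fin 3 → ℝ)

/-- `det(v, w, ·)`. -/
def det3 (v w : Fin 3 → ℝ) : Fin 3 → ℝ := fun k => ∑ i, ∑ j, eps i j k * v i * w j

/-- The nilpotent Lie group with underlying manifold `V^* × V`. -/
structure G where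
  pt : E

theorem det3_add_left (u v w : Fin 3 → ℝ) : det3 (u + v) w = det3 u w + det3 v w := by
  funext k; simp [det3, Fin.sum_univ_three]; ring

theorem det3_add_right (u v w : Fin 3 → ℝ) : det3 u (v + w) = det3 u v + det3 u w := by
  funext k; simp [det3, Fin.sum_univ_three]; ring

theorem det3_neg_self (v : Fin 3 → ℝ) : det3 (-v) v = 0 := by
  funext k; fin_cases k <;> simp [det3, eps, Fin.sum_univ_three] <;> ring

/-- `(v^*, v) · (w^*, w) = (v^* + w^* + det(v, w, ·)/2, v + w)`. -/
def gmul (g h : E) : E := (g.1 + h.1 + (1 / 2 : ℝ) • det3 g.2 h.2, g.2 + h.2)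

instance : Mul G := ⟨fun g h => ⟨gmul g.pt h.pt⟩⟩
instance : One G := ⟨⟨(0, 0)⟩⟩
instance : Inv G := ⟨fun g => ⟨(-g.pt.1, -g.pt.2)⟩⟩

instance : Group G :=
  Group.ofLeftAxioms
    (by
      rintro ⟨a⟩ ⟨b⟩ ⟨c⟩
      change G.mk (gmul (gmul a b) c) = G.mk (gmul a (gmul b c))
      refine congrArg G.mk (Prod.ext ?_ ?_)
      · simp only [gmul, det3_add_left, det3_add_right, smul_add]; abel
      · simp only [gmul]; abel)
    (by
      rintro ⟨a⟩
      change G.mk (gmul (0, 0) a) = G.mk a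
      refine congrArg G.mk (Prod.ext ?_ ?_)
      · funext k
        simp [gmul, det3]
      · simp [gmul])
    (by
      rintro ⟨a⟩
      change G.mk (gmul (-a.1, -a.2) a) = G.mk (0, 0)
      refine congrArg G.mk (Prod.ext ?_ ?_)
      · simp [gmul, det3_neg_self]
      · simp [gmul])

/-- The lattice generated by `Λ` and its dual. The double twisted torus is `X = Γ \ G`. -/
def Γ : Subgroup G :=
  Subgroup.closure ({g | ∃ i, g = ⟨(Pi.single i 1, 0)⟩} ∪ {g | ∃ i, g = ⟨(0, Pi.single i 1)⟩})

/-- The vector field `∂/∂x^*_i`. -/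
def dualField (i : Fin 3) (_ : E) : E := (Pi.single i 1, 0)

/-- The vector field `∂/∂x^i`. -/
def coordField (i : Fin 3) (_ : E) : E := (0, Pi.single i 1)

/-- The vector field `∂/∂x^i + t ∑ ε_{ijk} x^j ∂/∂x^*_k`. For `t = -1/2` it is left invariant, for
`t = 1/2` it is right invariant. -/
def twistedField (t : ℝ) (i : Fin 3) (p : E) : E :=
  (fun k => t * ∑ j, eps i j k * p.2 j, Pi.single i 1)

theorem contDiff_dualField (i : Fin 3) : ContDiff ℝ ∞ (dualField i) := contDiff_const

theorem contDiff_coordField (i : Fin 3) : ContDiff ℝ ∞ (coordField i) := contDiff_const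

theorem contDiff_twistedField (t : ℝ) (i : Fin 3) : ContDiff ℝ ∞ (twistedField t i) := by
  unfold twistedField
  fun_prop

/-! ### Smooth functions on an open subset of `G` -/

/-- Smooth complex functions on an open subset `U` of `G`, extended by zero. Open subsets
of `G` on which the projection to `X` is injective are the domains of the coordinates `x^*, x`
on `X`. -/
def Smooth (U : TopologicalSpace.Opens E) : Submodule ℂ (E → ℂ) where
  carrier := {f | ContDiffOn ℝ ∞ f U ∧ ∀ p ∉ U, f p = 0}
  add_mem' := fun {a b} ha hb => ⟨ha.1.add hb.1, fun p hp => by simp [ha.2 p hp, hb.2 p hp]⟩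
  zero_mem' := ⟨contDiffOn_const, fun _ _ => rfl⟩
  smul_mem' := fun c f hf => ⟨contDiffOn_const.smul hf.1, fun p hp => by simp [hf.2 p hp]⟩

theorem Smooth.diffAt {U : TopologicalSpace.Opens E} (f : Smooth U) {p : E} (hp : p ∈ U) :
    DifferentiableAt ℝ f.1 p :=
  (f.2.1.differentiableOn (by simp)).differentiableAt (U.isOpen.mem_nhds hp)

/-- Multiplication of functions on `U` by a smooth function on `G`. -/
def mulFn (U : TopologicalSpace.Opens E) (a : E → ℂ) (ha : ContDiff ℝ ∞ a) :
    Smooth U →ₗ[ℂ] Smooth U where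
  toFun f := ⟨fun p => a p * f.1 p, ha.contDiffOn.mul f.2.1, fun p hp => by simp [f.2.2 p hp]⟩
  map_add' f g := by ext p; simp [mul_add]
  map_smul' c f := by ext p; simp [mul_left_comm]

/-- The product of two smooth functions on `U`. -/
def Smooth.mul {U : TopologicalSpace.Opens E} (f g : Smooth U) : Smooth U :=
  ⟨fun p => f.1 p * g.1 p, f.2.1.mul g.2.1, fun p hp => by simp [f.2.2 p hp]⟩

/-- The constant function `1` on `U`. -/
def Smooth.one (U : TopologicalSpace.Opens E) : Smooth U :=
  ⟨(U : Set E).indicator (fun _ => 1),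
    (contDiffOn_const (c := (1 : ℂ))).congr (fun _ hp => Set.indicator_of_mem hp _),
    fun _ hp => Set.indicator_of_notMem hp _⟩

/-- The derivative of functions on `U` along a smooth vector field. -/
def derivFn (U : TopologicalSpace.Opens E) (Z : E → E) (hZ : ContDiff ℝ ∞ Z) :
    Smooth U →ₗ[ℂ] Smooth U where
  toFun f := ⟨(U : Set E).indicator (fun p => fderiv ℝ f.1 p (Z p)),
    ((f.2.1.fderiv_of_isOpen U.isOpen (m := ∞) (by simp)).clm_apply hZ.contDiffOn).congr
      (fun _ hp => Set.indicator_of_mem hp _),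
    fun _ hp => Set.indicator_of_notMem hp _⟩
  map_add' f g := by
    ext p
    by_cases hp : p ∈ (U : Set E)
    · have := fderiv_add (Smooth.diffAt f hp) (Smooth.diffAt g hp)
      simp only [Submodule.coe_add, Pi.add_apply, Set.indicator_of_mem hp]
      rw [this]; rfl
    · simp [Set.indicator_of_notMem hp]
  map_smul' c f := by
    ext p
    by_cases hp : p ∈ (U : Set E)
    · have := fderiv_const_smul (Smooth.diffAt f hp) c
      simp only [Submodule.coe_smul, Pi.smul_apply, Set.indicator_of_mem hp, RingHom.id_apply]
      rw [this]; rfl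
    · simp [Set.indicator_of_notMem hp]

/-! ### The Lie superalgebra of modes of super-loops -/

/-- The even modes `W^i`, `W^*_i`, `x^i_n`, `x^*_{i,n}`, `ħ`. -/
inductive LGen
  | W (i : Fin 3)
  | Ws (i : Fin 3)
  | x (i : Fin 3) (n : ℤ)
  | xs (i : Fin 3) (n : ℤ)
  | hbar

/-- The Lie algebra of modes of loops. -/
def loopB : ModeAlgebra LGen where
  odd _ := false
  deg
    | .x _ n => 2 * n
    | .xs _ n => 2 * n
    | _ => 0
  bracket
    | .W i, .xs j n => if i = j ∧ n = 0 then Finsupp.single .hbar 1 else 0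
    | .xs j n, .W i => if i = j ∧ n = 0 then -Finsupp.single .hbar 1 else 0
    | .Ws i, .x j n => if i = j ∧ n = 0 then Finsupp.single .hbar 1 else 0
    | .x j n, .Ws i => if i = j ∧ n = 0 then -Finsupp.single .hbar 1 else 0
    | .Ws i, .Ws j => ∑ k, Finsupp.single (.W k) (-(eps i j k : ℂ))
    | .Ws i, .xs j n => ∑ k, Finsupp.single (.x k n) (-(eps i j k : ℂ) / 2)
    | .xs j n, .Ws i => ∑ k, Finsupp.single (.x k n) ((eps i j k : ℂ) / 2)
    | .xs i m, .x j n => if i = j ∧ m + n = 0 ∧ n ≠ 0 then Finsupp.single .hbar (1 / (n : ℂ)) else 0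
    | .x j n, .xs i m =>
        if i = j ∧ m + n = 0 ∧ n ≠ 0 then -Finsupp.single .hbar (1 / (n : ℂ)) else 0
    | .xs i m, .xs j n =>
        if m = 0 ∧ n = 0 then 0
        else if n = 0 then ∑ k, Finsupp.single (.x k m) ((eps i j k : ℂ) / (2 * m))
        else if m = 0 then ∑ k, Finsupp.single (.x k n) ((eps i j k : ℂ) / (2 * n))
        else ∑ k, (Finsupp.single (.x k (m + n)) ((eps i j k : ℂ) / 2 * ((m + n) / (m * n)))
          + if m + n = 0 then Finsupp.single (.W k) ((eps i j k : ℂ) / m ^ 2) else 0)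
    | _, _ => 0

/-- The brackets between the even and the odd modes of super-loops:
`[W^*_i, ψ^*_{j,r}] = -ε_{ijk} ψ^k_r / 2` and `[x^*_{i,m}, ψ^*_{j,r}] = ε_{ijk} ψ^k_{m+r} / (2m)`
for `m ≠ 0`. -/
def loopMix : LGen → FGen → (FGen →₀ ℂ)
  | .Ws i, .psis j n => ∑ k, Finsupp.single (.psi k n) (-(eps i j k : ℂ) / 2)
  | .xs i m, .psis j n =>
      if m = 0 then 0 else ∑ k, Finsupp.single (.psi k (m + n)) ((eps i j k : ℂ) / (2 * m))
  | _, _ => 0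

/-- The zero modes on functions on `U`: `W^i = ∂/∂x^*_i`,
`W^*_i = ∂/∂x^i + ε_{ijk} x^j ∂/∂x^*_k / 2`, multiplication by the coordinates, and `ħ = 1`. -/
def loopAction (U : TopologicalSpace.Opens E) : LGen → Smooth U →ₗ[ℂ] Smooth U
  | .W i => derivFn U (dualField i) (contDiff_dualField i)
  | .Ws i => derivFn U (twistedField (1 / 2) i) (contDiff_twistedField _ i)
  | .x i _ => mulFn U (fun p => (p.2 i : ℂ)) (Complex.ofRealCLM.contDiff.comp (by fun_prop))
  | .xs i _ => mulFn U (fun p => (p.1 i : ℂ)) (Complex.ofRealCLM.contDiff.comp (by fun_prop))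
  | .hbar => LinearMap.id

section Loop

variable (U : TopologicalSpace.Opens E)

/-- The bosonic space over `U`. -/
abbrev Hb : Type := Ind loopB (loopAction U)

/-- The super space over `U`. -/
abbrev Hs : Type := SuperInd loopB .hbar loopMix (loopAction U)

/-- Even modes on the super space. -/
abbrev lb (y : LGen) : Hs U →ₗ[ℂ] Hs U := bAct loopB .hbar loopMix (loopAction U) y

/-- Odd modes on the super space. -/
abbrev lf (f : FGen) : Hs U →ₗ[ℂ] Hs U := fAct loopB .hbar loopMix (loopAction U) f

/-- The state of a function. -/
abbrev lvac : Smooth U →ₗ[ℂ] Hs U := sVac loopB .hbar loopMix (loopAction U)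

/-- The corrections `x̃^*_{i,m} - x^*_{i,m}` (`m ≠ 0`) and `W̃^*_i - W^*_i`; the other even modes
are not changed. -/
def loopShift : LGen → Hs U → Hs U
  | .xs i m => fun v => if m = 0 then 0 else
      (1 / (4 * (m : ℂ))) • quad loopB .hbar loopMix (loopAction U) i m v
  | .Ws i => fun v => -((1 / 4 : ℂ) • quad loopB .hbar loopMix (loopAction U) i 0 v)
  | _ => fun _ => 0

/-- The decoupled even modes. -/
def lt (y : LGen) (v : Hs U) : Hs U := lb U y v + loopShift U y v

/-- `M g` is multiplication by `g(x_0, x^*_0)`: it extends multiplication of functions, commutes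
with the modes `x^i_n`, `ψ^i_r`, `ψ^*_{i,r}`, and
`[x^*_{i,n}, g] = ∑ ε_{ijk} x^k_n (∂g/∂x^*_j) / (2n)` for `n ≠ 0`, as
`[x^*_{i,n}, x^*_{j,0}] = ∑ ε_{ijk} x^k_n / (2n)` requires. -/
def IsMultiplication (M : Smooth U →ₗ[ℂ] (Hs U →ₗ[ℂ] Hs U)) : Prop :=
  (∀ g c, M g (lvac U c) = lvac U (Smooth.mul g c)) ∧
  (∀ g i n v, M g (lb U (.x i n) v) = lb U (.x i n) (M g v)) ∧
  (∀ g f v, M g (lf U f v) = lf U f (M g v)) ∧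
  (∀ g i n v, n ≠ 0 → lb U (.xs i n) (M g v) - M g (lb U (.xs i n) v) =
    ∑ j, ∑ k, ((eps i j k : ℂ) / (2 * n)) •
      lb U (.x k n) (M (derivFn U (dualField j) (contDiff_dualField j) g) v))

/-- The currents. -/
inductive Cur
  | alpha (i : Fin 3)
  | beta (i : Fin 3)

/-- The modes of `α^i(z) = ∂x^i(z)` and of
`β_i(z) = ∂x^*_i(z) - ε_{ijk} x^j(z) ∂x^k(z) / 2`, in terms of the decoupled modes:
`α^i_0 = W^i`, `α^i_n = -n x^i_n`, and
`β_{i,n} = δ_{n,0} W^*_i - n x^*_{i,n} + ε_{ijk} W^j x^k_n + ε_{ijk} ∑_m m x^j_{n-m} x^k_m / 2`. -/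
def loopCurrent : Cur → ℤ → Hs U → Hs U
  | .alpha i, n => fun v => if n = 0 then lt U (.W i) v else (-(n : ℂ)) • lt U (.x i n) v
  | .beta i, n => fun v =>
      (if n = 0 then lt U (.Ws i) v else (-(n : ℂ)) • lt U (.xs i n) v)
        + (∑ j, ∑ k, (eps i j k : ℂ) • lt U (.W j) (lt U (.x k n) v))
        + ∑ j, ∑ k, ((eps i j k : ℂ) / 2) •
            ∑ᶠ m : ℤ, (m : ℂ) • lt U (.x j (n - m)) (lt U (.x k m) v)

/-- The operators for fields of functions on `U`. The coordinates are
`x^i(z) = W^i log z + ∑ x^i_n z^{-n}` and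
`x^*_i(z) = W^*_i log z + ∑ x^*_{i,n} z^{-n} + (log z / 2) ε_{ijk} W^j x^k(z)`, so `y_{i,n}` is
`x^*_{i,n}` and `D_i` is `W^*_i + ε_{ijk} W^j x^k_0 / 2` (`ε_{ijk} W^j W^k` vanishes), all in terms
of the decoupled modes. -/
def loopOps (M : Smooth U →ₗ[ℂ] (Hs U →ₗ[ℂ] Hs U)) : ExpansionOps (Hs U) (Smooth U) where
  x i n := lt U (.x i n)
  w i := lt U (.W i)
  y i n := lt U (.xs i n)
  d i v := lt U (.Ws i) v + ∑ j, ∑ k, ((eps i j k : ℂ) / 2) • lt U (.W j) (lt U (.x k 0) v)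
  px i := derivFn U (coordField i) (contDiff_coordField i)
  ps i := derivFn U (dualField i) (contDiff_dualField i)
  mul g := M g

/-- The vacuum. -/
def loopVacuum : Hs U := lvac U (Smooth.one U)

/-- The bosonic state-field correspondence: functions `f` go to `:f(x(z), x^*(z)):`, and creation
modes of the currents to normally ordered products. -/
def BosonicField (M : Smooth U →ₗ[ℂ] (Hs U →ₗ[ℂ] Hs U)) : Hs U → LogField (Hs U) → Prop :=
  StateField (loopCurrent U) false
    (fun v A => ∃ f, v = lvac U f ∧ A = functionField (loopOps U M) f) false

/-- The modes of the fields `ψ^i(z)` (`b = false`) and `ψ^*_i(z)` (`b = true`). -/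
def fermionMode : Fin 3 × Bool → ℤ → FGen
  | (i, false), n => .psi i n
  | (i, true), n => .psis i n

/-- The fermionic state-field correspondence. -/
def FermionicField : Bool → Hs U → LogField (Hs U) → Prop :=
  StateField (fun a n v => lf U (fermionMode a n) v) true
    (fun v A => v = loopVacuum U ∧ A = idField)

end Loop

/-! ### The global space over `X` and the affine currents -/

theorem fderiv_translate {f : E → ℂ} (hf : ContDiff ℝ ∞ f) (g : E)
    (hg : ∀ p, f (gmul g p) = f p) (p e : E) :
    fderiv ℝ f (gmul g p) (e.1 + (1 / 2 : ℝ) • det3 g.2 e.2, e.2) = fderiv ℝ f p e := by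
  have hd : Differentiable ℝ f := hf.differentiable (by simp)
  have hline : ∀ t : ℝ, gmul g (p + t • e) =
      gmul g p + t • ((e.1 + (1 / 2 : ℝ) • det3 g.2 e.2, e.2) : E) := by
    intro t
    refine Prod.ext ?_ ?_
    · funext k
      simp [gmul, det3, Fin.sum_univ_three]; ring
    · funext k
      simp [gmul]; ring
  have h1 : HasDerivAt (fun t : ℝ => f (p + t • e)) (fderiv ℝ f p e) 0 := by
    have := (hd p).hasFDerivAt.hasLineDerivAt e
    simpa [HasLineDerivAt] using this
  have h2 := (hd (gmul g p)).hasFDerivAt.hasLineDerivAt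
    ((e.1 + (1 / 2 : ℝ) • det3 g.2 e.2, e.2) : E)
  have h3 : HasDerivAt (fun t : ℝ => f (p + t • e))
      (fderiv ℝ f (gmul g p) (e.1 + (1 / 2 : ℝ) • det3 g.2 e.2, e.2)) 0 := by
    have h4 := h2
    unfold HasLineDerivAt at h4
    refine h4.congr_of_eventuallyEq (Filter.Eventually.of_forall fun t => ?_)
    simp only
    rw [← hline t, hg]
  exact h3.unique h1

/-- Smooth complex functions on `X = Γ \ G`: the `Γ`-invariant smooth functions on `G`. -/
def SmoothX : Submodule ℂ (E → ℂ) where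
  carrier := {f | ContDiff ℝ ∞ f ∧ ∀ g ∈ Γ, ∀ p, f (gmul g.pt p) = f p}
  add_mem' := fun {a b} ha hb => ⟨ha.1.add hb.1, fun g hg p => by simp [ha.2 g hg, hb.2 g hg]⟩
  zero_mem' := ⟨contDiff_const, fun _ _ _ => rfl⟩
  smul_mem' := fun c f hf => ⟨contDiff_const.smul hf.1, fun g hg p => by simp [hf.2 g hg]⟩

/-- The constant function `1` on `X`. -/
def SmoothX.one : SmoothX := ⟨fun _ => 1, contDiff_const, fun _ _ _ => rfl⟩

/-- The product of two smooth functions on `X`. -/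
def SmoothX.mul (f g : SmoothX) : SmoothX :=
  ⟨fun p => f.1 p * g.1 p, f.2.1.mul g.2.1, fun γ hγ p => by
    simp only [f.2.2 γ hγ, g.2.2 γ hγ]⟩

/-- The derivative of functions on `X` along a left invariant vector field. -/
def derivX (Z : E → E) (hZ : ContDiff ℝ ∞ Z)
    (hinv : ∀ g p : E, Z (gmul g p) = ((Z p).1 + (1 / 2 : ℝ) • det3 g.2 (Z p).2, (Z p).2)) :
    SmoothX →ₗ[ℂ] SmoothX where
  toFun f := ⟨fun p => fderiv ℝ f.1 p (Z p),
    (f.2.1.fderiv_right (m := ∞) (by simp)).clm_apply hZ,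
    fun g hg p => by
      change fderiv ℝ f.1 (gmul g.pt p) (Z (gmul g.pt p)) = fderiv ℝ f.1 p (Z p)
      rw [hinv]; exact fderiv_translate f.2.1 g.pt (f.2.2 g hg) p (Z p)⟩
  map_add' f g := by
    ext p
    have := fderiv_add (f.2.1.differentiable (by simp) p) (g.2.1.differentiable (by simp) p)
    simp only [Submodule.coe_add, Pi.add_apply]
    rw [this]; rfl
  map_smul' c f := by
    ext p
    have := fderiv_const_smul (f.2.1.differentiable (by simp) p) c
    simp only [Submodule.coe_smul, Pi.smul_apply, RingHom.id_apply]
    rw [this]; rfl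

theorem dualField_inv (i : Fin 3) (g p : E) : dualField i (gmul g p) =
    ((dualField i p).1 + (1 / 2 : ℝ) • det3 g.2 (dualField i p).2, (dualField i p).2) := by
  refine Prod.ext ?_ rfl
  funext k
  simp [dualField, det3]

theorem twistedField_inv (i : Fin 3) (g p : E) : twistedField (-1 / 2) i (gmul g p) =
    ((twistedField (-1 / 2) i p).1 + (1 / 2 : ℝ) • det3 g.2 (twistedField (-1 / 2) i p).2,
      (twistedField (-1 / 2) i p).2) := by
  refine Prod.ext ?_ rfl
  funext k
  fin_cases i <;> fin_cases k <;>
    simp [twistedField, det3, gmul, eps, Fin.sum_univ_three] <;> ring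

/-- The modes `α^i_n`, `β_{i,n}` and the central element of the affine Lie algebra of `𝔤`. -/
inductive AGen
  | alpha (i : Fin 3) (n : ℤ)
  | beta (i : Fin 3) (n : ℤ)
  | one

/-- The affine Lie algebra of `𝔤`. -/
def affineB : ModeAlgebra AGen where
  odd _ := false
  deg
    | .alpha _ n => 2 * n
    | .beta _ n => 2 * n
    | .one => 0
  bracket
    | .beta i m, .beta j n => ∑ k, Finsupp.single (.alpha k (m + n)) (eps i j k : ℂ)
    | .beta i m, .alpha j n => if i = j ∧ m + n = 0 then Finsupp.single .one (m : ℂ) else 0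
    | .alpha j n, .beta i m => if i = j ∧ m + n = 0 then -Finsupp.single .one (m : ℂ) else 0
    | _, _ => 0

/-- The brackets `[β_{i,m}, β̄_{j,r}] = ε_{ijk} ᾱ^k_{m+r}` of the super-extension; the odd modes
`ᾱ^i_r`, `β̄_{i,r}` are `psi`, `psis`. -/
def affineMix : AGen → FGen → (FGen →₀ ℂ)
  | .beta i m, .psis j n => ∑ k, Finsupp.single (.psi k (m + n)) (eps i j k : ℂ)
  | _, _ => 0

/-- The zero modes on functions on `X`: the left invariant vector fields. -/
def affineAction : AGen → SmoothX →ₗ[ℂ] SmoothX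
  | .alpha i _ => derivX (dualField i) (contDiff_dualField i) (dualField_inv i)
  | .beta i _ => derivX (twistedField (-1 / 2) i) (contDiff_twistedField _ i) (twistedField_inv i)
  | .one => LinearMap.id

/-- The bosonic space over `X`. -/
abbrev HbX : Type := Ind affineB affineAction

/-- The super space over `X`. -/
abbrev HsX : Type := SuperInd affineB .one affineMix affineAction

/-- The correction of `β_{i,m}` that decouples it from the odd modes. -/
def affineShift : AGen → HsX → HsX
  | .beta i m => fun v => (1 / 2 : ℂ) • quad affineB .one affineMix affineAction i m v
  | _ => fun _ => 0

/-- The decoupled even modes. -/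
def affineTilde (y : AGen) (v : HsX) : HsX :=
  bAct affineB .one affineMix affineAction y v + affineShift y v

/-- The currents `α^i(z)` and the decoupled currents `β_i(z)`. -/
def affineCurrent : Cur → ℤ → HsX → HsX
  | .alpha i, n => affineTilde (.alpha i n)
  | .beta i, n => affineTilde (.beta i n)

/-- The vacuum. -/
def affineVacuum : HsX := sVac affineB .one affineMix affineAction SmoothX.one

/-- `M g` is multiplication by the function `g` of the zero modes: it extends multiplication of
functions, commutes with `α^i_n` for `n ≠ 0` and with the odd modes, and
`[β_{i,n}, g] = -∑ ε_{ijk} α^k_n (∂g/∂x^*_j) / (2n)` for `n ≠ 0`. -/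
def IsMultiplicationX (M : SmoothX →ₗ[ℂ] (HsX →ₗ[ℂ] HsX)) : Prop :=
  (∀ g c, M g (sVac affineB .one affineMix affineAction c) =
    sVac affineB .one affineMix affineAction (SmoothX.mul g c)) ∧
  (∀ g i n v, n ≠ 0 → M g (bAct affineB .one affineMix affineAction (.alpha i n) v) =
    bAct affineB .one affineMix affineAction (.alpha i n) (M g v)) ∧
  (∀ g f v, M g (fAct affineB .one affineMix affineAction f v) =
    fAct affineB .one affineMix affineAction f (M g v)) ∧
  (∀ g i n v, n ≠ 0 → bAct affineB .one affineMix affineAction (.beta i n) (M g v)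
      - M g (bAct affineB .one affineMix affineAction (.beta i n) v) =
    ∑ j, ∑ k, (-(eps i j k : ℂ) / (2 * n)) •
      bAct affineB .one affineMix affineAction (.alpha k n)
        (M (derivX (dualField j) (contDiff_dualField j) (dualField_inv j) g) v))

/-- The mode `x^i_n = -α^i_n / n`, for `n ≠ 0`. -/
def affineX (i : Fin 3) (n : ℤ) (v : HsX) : HsX := (-(1 / (n : ℂ))) • affineTilde (.alpha i n) v

/-- The operators for fields of functions on `X`. In terms of the group law, the loop is
`(x^*_0, x_0) · (y, ξ)` with `ξ^i(z) = x^i(z) - x^i_0` and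
`y_i(z) = x^*_i(z) - x^*_{i,0} - ε_{ijk} x^j_0 ξ^k(z) / 2`, and Taylor expansion is along left
invariant vector fields. The modes of `y_i(z)` are expressed by the decoupled currents through
`β_{i,n} = -n y_{i,n} + ε_{ijk} α^j_0 x^k_n + ε_{ijk} ∑_{m ≠ 0, n} m x^j_{n-m} x^k_m / 2` for
`n ≠ 0`, and `β_{i,0} = D_i + ε_{ijk} ∑_{m ≠ 0} m x^j_{-m} x^k_m / 2`. -/
def affineOps (M : SmoothX →ₗ[ℂ] (HsX →ₗ[ℂ] HsX)) : ExpansionOps HsX SmoothX where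
  x := affineX
  w i := affineTilde (.alpha i 0)
  y i n v := (1 / (n : ℂ)) • (-affineTilde (.beta i n) v
    + (∑ j, ∑ k, (eps i j k : ℂ) • affineTilde (.alpha j 0) (affineX k n v))
    + ∑ j, ∑ k, ((eps i j k : ℂ) / 2) •
        ∑ᶠ m : {m : ℤ // m ≠ 0 ∧ m ≠ n}, (m.1 : ℂ) • affineX j (n - m.1) (affineX k m.1 v))
  d i v := affineTilde (.beta i 0) v - ∑ j, ∑ k, ((eps i j k : ℂ) / 2) •
    ∑ᶠ m : {m : ℤ // m ≠ 0}, (m.1 : ℂ) • affineX j (-m.1) (affineX k m.1 v)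
  px i := derivX (twistedField (-1 / 2) i) (contDiff_twistedField _ i) (twistedField_inv i)
  ps i := derivX (dualField i) (contDiff_dualField i) (dualField_inv i)
  mul g := M g

/-- The bosonic state-field correspondence: functions `f` on `X` go to `:f(x(z), x^*(z)):`, and
creation modes of the currents to normally ordered products. -/
def AffineBosonicField (M : SmoothX →ₗ[ℂ] (HsX →ₗ[ℂ] HsX)) : HsX → LogField HsX → Prop :=
  StateField affineCurrent false
    (fun v A => ∃ f, v = sVac affineB .one affineMix affineAction f ∧
      A = functionField (affineOps M) f) false

/-- The fermionic state-field correspondence. -/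
def AffineFermionicField : Bool → HsX → LogField HsX → Prop :=
  StateField (fun a n v => fAct affineB .one affineMix affineAction (fermionMode a n) v) true
    (fun v A => v = affineVacuum ∧ A = idField)

/-- The inner product of `L²(X)`: integration over the fundamental domain `[0,1)^6` of `Γ`. -/
def innerX (f g : SmoothX) : ℂ :=
  ∫ p in {p : E | ∀ i, p.1 i ∈ Set.Ico (0 : ℝ) 1 ∧ p.2 i ∈ Set.Ico (0 : ℝ) 1},
    (starRingEnd ℂ) (f.1 p) * g.1 p

/-- Up to sign, the adjoint of an even mode of degree `n` is the mode of degree `-n`. -/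
def affineDag : AGen → AGen
  | .alpha i n => .alpha i (-n)
  | .beta i n => .beta i (-n)
  | .one => .one

/-- The sign of the adjoint: zero modes of `α`, `β` are real vector fields, hence
anti-selfadjoint. -/
def affineSign : AGen → ℝ
  | .one => 1
  | _ => -1

/-- The adjoint of an odd mode of degree `r` is the mode of degree `-r`. -/
def fermionDag : FGen → FGen
  | .psi i n => .psi i (-n - 1)
  | .psis i n => .psis i (-n - 1)

/-- Contravariant forms on the bosonic space over `X`. -/
def ContravariantB (h : HbX →ₗ⋆[ℂ] HbX →ₗ[ℂ] ℂ) : Prop :=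
  IsContravariant affineB affineAction innerX affineDag affineSign h

/-- Contravariant forms on the fermionic Fock space. -/
def ContravariantF (h : Fock →ₗ⋆[ℂ] Fock →ₗ[ℂ] ℂ) : Prop :=
  IsContravariant fermions fermionsAction (fun a b => (starRingEnd ℂ) a * b)
    (Sum.map id fermionDag) (fun _ => 1) h

/-- Contravariant forms on the super space over `X`. -/
def ContravariantS (h : HsX →ₗ⋆[ℂ] HsX →ₗ[ℂ] ℂ) : Prop :=
  IsContravariant (withFermions affineB .one affineMix) (withFermionsAction affineAction) innerX
    (Sum.map affineDag fermionDag) (Sum.elim affineSign (fun _ => 1)) h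

end SuperLoop

end

open SuperLoop

open scoped TensorProduct ContDiff

noncomputable section

namespace SuperLoop

/-! The even modes `y` commute with the `ψ^k` and satisfy `[y, ψ^*_j] = 2 s_y ε_{ijk} ψ^k` (degrees
suppressed) for a scalar `s_y`. The bilinear `Q_i = ε_{ijk} ∑_r ψ^j_r ψ^k_{m-r}` satisfies `[ψ^*_j,
Q_i] = 2 ε_{ijk} ψ^k`, so `y + s_y Q` commutes with all fermions. The correction does not disturb
the even brackets: the `Q` commute with each other and with every `y`, and the modes occurring in a
bracket of even modes all have `s = 0`. Where the degree is nonnegative `Q` kills functions, so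
corrected and original modes agree there.

Thus the super space carries commuting actions of the even algebra and of the fermions, and the
universal property of induced modules, applied to each tensor factor, gives `Φ`. Conversely, on the
tensor product the fermions commute with the even modes; subtracting `s_y Q` restores the prescribed
brackets, and the universal property of the super space gives the inverse. No basis of an enveloping
algebra is needed. `IsDecoupling` collects what the argument uses; the loop algebra, the affine
algebra and the fermions alone are its three instances. The carriers are `psis_bilin`,
`isModeRep_corrected`, `isModeRep_super` and `exists_factorization`.

Parity and degree are respected because `Q` is even and has the degree of the mode it corrects. The
product form is contravariant because the adjoint of `Q` of degree `m` is minus `Q` of degree `-m`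
(`ContravariantF.bilin`), which matches the anti-selfadjointness of the currents. Uniqueness holds
because creation modes map into the orthogonal complement of the functions.

A multiplication operator is built for all functions at once: a vector `v` should yield the map `g ↦
M g v` from functions to states. The wanted commutators dictate how the modes act on such maps, so
the task is to check the bracket relations there (`MulData.isModeRep`) and to use the universal
property once more.

Fields are controlled by the degree filtration, which has nothing in positive degree: this makes all
sums locally finite. Creation and triviality of the OPE then follow by induction along the
state-field correspondence, since bosonic fields are made of operators that commute with the
fermions. That every vector of a factor has a field means stability of the set of such vectors under
creation modes. For fermions this is anticommutation; for the loop currents, `x^*_n` is recovered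
from `β_n` after showing stability under all `W` and `x_m`. -/

/-- Shortcut for instance search. -/
abbrev indAddCommGroup {ι : Type} (S : ModeAlgebra ι) {C : Type} [AddCommGroup C] [Module ℂ C]
    (ρ : ι → C →ₗ[ℂ] C) : AddCommGroup (Ind S ρ) := inferInstance

/-- Shortcut for instance search. -/
abbrev indAddCommMonoid {ι : Type} (S : ModeAlgebra ι) {C : Type} [AddCommGroup C] [Module ℂ C]
    (ρ : ι → C →ₗ[ℂ] C) : AddCommMonoid (Ind S ρ) := inferInstance

/-- Shortcut for instance search. -/
abbrev indModule {ι : Type} (S : ModeAlgebra ι) {C : Type} [AddCommGroup C] [Module ℂ C]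
    (ρ : ι → C →ₗ[ℂ] C) : Module ℂ (Ind S ρ) := inferInstance

attribute [local instance] indAddCommGroup indAddCommMonoid indModule

/-! ### Enveloping algebras and the universal property of induced modules -/

section Induced

variable {ι : Type} (S : ModeAlgebra ι)

theorem gen_mul_gen (a b : ι) :
    gen S a * gen S b - koszul (S.odd a) (S.odd b) • (gen S b * gen S a) =
      Finsupp.linearCombination ℂ (gen S) (S.bracket a b) := by
  have h := RingQuot.mkAlgHom_rel ℂ (EnvRel.comm (S := S) a b)
  simp only [map_sub, map_mul, map_smul] at h
  refine h.trans ?_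
  rw [Finsupp.linearCombination_apply, Finsupp.linearCombination_apply, map_finsuppSum]
  simp only [map_smul]
  rfl

theorem env_induction {A : Subalgebra ℂ (Env S)} (h : ∀ a, gen S a ∈ A) (u : Env S) : u ∈ A := by
  obtain ⟨x, rfl⟩ := RingQuot.mkAlgHom_surjective ℂ (EnvRel S) u
  induction x using FreeAlgebra.induction with
  | grade0 r => exact (AlgHom.commutes (RingQuot.mkAlgHom ℂ (EnvRel S)) r) ▸ A.algebraMap_mem r
  | grade1 a => exact h a
  | mul a b ha hb => rw [map_mul]; exact A.mul_mem ha hb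
  | add a b ha hb => rw [map_add]; exact A.add_mem ha hb

variable {C : Type} [AddCommGroup C] [Module ℂ C] (ρ : ι → C →ₗ[ℂ] C)

/-- The defining relation of the enveloping algebra, read as an identity of operators. All
commutators on induced modules are computed from it. -/
theorem act_act (a b : ι) (v : Ind S ρ) :
    act S ρ a (act S ρ b v) = koszul (S.odd a) (S.odd b) • act S ρ b (act S ρ a v) +
      Finsupp.linearCombination ℂ (act S ρ) (S.bracket a b) v := by
  have h := congrArg (fun u : Env S => u • v) (gen_mul_gen S a b)
  simp only [sub_smul, mul_smul, smul_assoc] at h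
  rw [← sub_eq_iff_eq_add']
  refine h.trans ?_
  rw [Finsupp.linearCombination_apply, Finsupp.linearCombination_apply, Finsupp.sum, Finsupp.sum,
    Finset.sum_smul, LinearMap.sum_apply]
  simp only [smul_assoc]
  rfl

theorem act_vac {y : ι} (hy : 0 ≤ S.deg y) (c : C) :
    act S ρ y (vac S ρ c) = vac S ρ (extendedAction S ρ y c) := by
  have h : ((1 * gen S y) ⊗ₜ[ℂ] c - 1 ⊗ₜ[ℂ] extendedAction S ρ y c : Env S ⊗[ℂ] C) ∈ indRel S ρ :=
    Submodule.subset_span ⟨1, y, c, hy, rfl⟩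
  have h' := (Submodule.Quotient.mk_eq_zero _).2 h
  rw [Submodule.Quotient.mk_sub, sub_eq_zero] at h'
  refine Eq.trans ?_ h'
  change gen S y • (Submodule.Quotient.mk ((1 : Env S) ⊗ₜ[ℂ] c) : Ind S ρ) = _
  rw [← Submodule.Quotient.mk_smul, TensorProduct.smul_tmul', smul_eq_mul, one_mul, mul_one]

theorem act_vac_zero {y : ι} (hy : S.deg y = 0) (c : C) :
    act S ρ y (vac S ρ c) = vac S ρ (ρ y c) := by
  rw [act_vac S ρ hy.ge, extendedAction, if_pos hy]

theorem act_vac_pos {y : ι} (hy : 0 < S.deg y) (c : C) : act S ρ y (vac S ρ c) = 0 := by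
  rw [act_vac S ρ hy.le, extendedAction, if_neg hy.ne', LinearMap.zero_apply, map_zero]

variable {S ρ} in
/-- A subspace that contains `C` and is stable under the modes is everything. -/
theorem ind_induction (P : Submodule ℂ (Ind S ρ)) (hv : ∀ c, vac S ρ c ∈ P)
    (ha : ∀ y, ∀ v ∈ P, act S ρ y v ∈ P) (v : Ind S ρ) : v ∈ P := by
  -- The elements of the enveloping algebra that preserve `P` form a subalgebra. It contains the
  -- generators, hence everything, and the module is spanned by the vectors `u • vac c`.
  let A : Subalgebra ℂ (Env S) :=
    { carrier := {u | ∀ v ∈ P, u • v ∈ P}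
      mul_mem' := fun {a b} h1 h2 v hv => by rw [mul_smul]; exact h1 _ (h2 _ hv)
      add_mem' := fun {a b} h1 h2 v hv => by rw [add_smul]; exact P.add_mem (h1 _ hv) (h2 _ hv)
      algebraMap_mem' := fun r v hv => by rw [algebraMap_smul]; exact P.smul_mem r hv }
  obtain ⟨t, rfl⟩ := (indRel S ρ).mkQ_surjective v
  induction t using TensorProduct.induction_on with
  | zero => rw [map_zero]; exact P.zero_mem
  | add a b h1 h2 => rw [map_add]; exact P.add_mem h1 h2
  | tmul u c =>
    have hu : u ∈ A := env_induction S (A := A) (fun a v hv => ha a v hv) u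
    have := hu _ (hv c)
    have e : u • vac S ρ c = (indRel S ρ).mkQ (u ⊗ₜ[ℂ] c) := by
      change u • (indRel S ρ).mkQ ((1 : Env S) ⊗ₜ[ℂ] c) = _
      rw [← map_smul, TensorProduct.smul_tmul', smul_eq_mul, mul_one]
    rwa [e] at this

variable {S ρ} in
/-- Linear maps out of an induced module that intertwine the modes are determined by their
restriction to `C`. -/
theorem ind_hom_ext {N : Type} [AddCommGroup N] [Module ℂ N] {f g : Ind S ρ →ₗ[ℂ] N}
    (T : ι → N →ₗ[ℂ] N) (hv : ∀ c, f (vac S ρ c) = g (vac S ρ c))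
    (hf : ∀ y v, f (act S ρ y v) = T y (f v)) (hg : ∀ y v, g (act S ρ y v) = T y (g v)) :
    f = g := by
  refine LinearMap.ext fun v => ?_
  refine ind_induction (LinearMap.eqLocus f g) hv (fun y v hv => ?_) v
  have hv : f v = g v := hv
  change f _ = g _
  rw [hf, hg, hv]

section Lift

variable {N : Type} [AddCommGroup N] [Module ℂ N]

/-- Operators on `N` that satisfy the bracket relations. -/
def IsModeRep (T : ι → N →ₗ[ℂ] N) : Prop :=
  ∀ a b v, T a (T b v) = koszul (S.odd a) (S.odd b) • T b (T a v) +
    Finsupp.linearCombination ℂ T (S.bracket a b) v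

variable {S}

/-- The representation of the enveloping algebra given by operators with the right brackets. -/
def IsModeRep.envHom {T : ι → N →ₗ[ℂ] N} (hT : IsModeRep S T) :
    Env S →ₐ[ℂ] Module.End ℂ N :=
  RingQuot.liftAlgHom ℂ ⟨FreeAlgebra.lift ℂ T, fun {x y} h => by
    obtain ⟨a, b⟩ := h
    simp only [map_sub, map_mul, map_smul, FreeAlgebra.lift_ι_apply]
    refine LinearMap.ext fun v => ?_
    have h2 := hT a b v
    rw [← sub_eq_iff_eq_add'] at h2
    refine h2.trans ?_
    rw [Finsupp.linearCombination_apply, Finsupp.linearCombination_apply, map_finsuppSum]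
    simp only [map_smul, FreeAlgebra.lift_ι_apply]⟩

theorem IsModeRep.envHom_gen {T : ι → N →ₗ[ℂ] N} (hT : IsModeRep S T) (a : ι) :
    hT.envHom (gen S a) = T a := by
  unfold IsModeRep.envHom gen
  erw [RingQuot.liftAlgHom_mkAlgHom_apply]
  simp

variable {ρ} in
/-- The universal property of induced modules. -/
theorem exists_ind_lift {T : ι → N →ₗ[ℂ] N} (hT : IsModeRep S T) (φ : C →ₗ[ℂ] N)
    (hφ : ∀ y c, 0 ≤ S.deg y → T y (φ c) = φ (extendedAction S ρ y c)) :
    ∃ L : Ind S ρ →ₗ[ℂ] N, (∀ c, L (vac S ρ c) = φ c) ∧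
      ∀ y v, L (act S ρ y v) = T y (L v) := by
  let t : Env S ⊗[ℂ] C →ₗ[ℂ] N :=
    TensorProduct.lift ((LinearMap.lcomp ℂ N φ) ∘ₗ hT.envHom.toLinearMap)
  have ht : ∀ u c, t (u ⊗ₜ c) = hT.envHom u (φ c) := fun u c => rfl
  have hsm : ∀ (u : Env S) x, t (u • x) = hT.envHom u (t x) := by
    intro u x
    induction x using TensorProduct.induction_on with
    | zero => simp
    | add a b h1 h2 => rw [smul_add, map_add, map_add, map_add, h1, h2]
    | tmul w c =>
      rw [TensorProduct.smul_tmul', ht, ht, smul_eq_mul, map_mul]; rfl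
  -- The relations are generated over `Env S`, so the kernel of `t` has to be seen as an `Env
  -- S`-submodule, although `t` is only `ℂ`-linear.
  let K : Submodule (Env S) (Env S ⊗[ℂ] C) :=
    { carrier := {x | t x = 0}
      add_mem' := fun {a b} ha hb => by
        change t (a + b) = 0; rw [map_add, show t a = 0 from ha, show t b = 0 from hb, add_zero]
      zero_mem' := map_zero t
      smul_mem' := fun u x hx => by
        change t (u • x) = 0; rw [hsm, show t x = 0 from hx, map_zero] }
  have hK : indRel S ρ ≤ K := by
    refine Submodule.span_le.2 ?_
    rintro _ ⟨u, y, c, hy, rfl⟩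
    change t _ = 0
    rw [map_sub, ht, ht, map_mul, ← hφ y c hy, ← hT.envHom_gen y]
    exact sub_self _
  -- `N` carries no `Env S`-module structure, so the map descends to the quotient by the same
  -- submodule with scalars restricted to `ℂ`.
  let L : Ind S ρ →ₗ[ℂ] N :=
    (((indRel S ρ).restrictScalars ℂ).liftQ t hK).comp
      (Submodule.Quotient.restrictScalarsEquiv ℂ (indRel S ρ)).symm.toLinearMap
  have hL : ∀ x, L ((indRel S ρ).mkQ x) = t x := fun x => rfl
  refine ⟨L, fun c => ?_, fun y v => ?_⟩
  · change L ((indRel S ρ).mkQ _) = _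
    rw [hL, ht, map_one]; rfl
  · obtain ⟨x, rfl⟩ := (indRel S ρ).mkQ_surjective v
    change L (gen S y • (indRel S ρ).mkQ x) = _
    rw [← map_smul, hL, hL, hsm, hT.envHom_gen]

end Lift

/-! ### The degree filtration -/

/-- The bracket is compatible with degrees. -/
def IsHomogeneous : Prop :=
  ∀ a b c, c ∈ (S.bracket a b).support → S.deg c = S.deg a + S.deg b

/-- The span of the products of creation modes of total degree at least `d`. -/
def filt (d : ℤ) : Submodule ℂ (Ind S ρ) :=
  Submodule.span ℂ {v | ∃ (l : List ι) (c : C),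
    (∀ y ∈ l, S.deg y < 0) ∧ d ≤ (l.map S.deg).sum ∧ v = word S ρ l c}

theorem filt_mono {d e : ℤ} (h : e ≤ d) : filt S ρ d ≤ filt S ρ e := by
  refine Submodule.span_mono ?_
  rintro _ ⟨l, c, h1, h2, rfl⟩
  exact ⟨l, c, h1, h.trans h2, rfl⟩

theorem vac_mem_filt (c : C) : vac S ρ c ∈ filt S ρ 0 :=
  Submodule.subset_span ⟨[], c, by simp, by simp, rfl⟩

/-- A product of creation modes has total degree at most zero, so for `d > 0` the spanning set is
empty. This is the source of every finiteness statement below. -/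
theorem filt_pos {d : ℤ} (hd : 0 < d) {v : Ind S ρ} (hv : v ∈ filt S ρ d) : v = 0 := by
  have : filt S ρ d ≤ ⊥ := by
    refine Submodule.span_le.2 ?_
    rintro _ ⟨l, c, h1, h2, rfl⟩
    have : (l.map S.deg).sum ≤ 0 := by
      clear h2
      induction l with
      | nil => simp
      | cons a l ih =>
        have := ih fun y hy => h1 y (List.mem_cons_of_mem _ hy)
        have := h1 a List.mem_cons_self
        simp only [List.map_cons, List.sum_cons]; omega
    omega
  exact (Submodule.mem_bot ℂ).1 (this hv)

theorem act_mem_filt_of_neg {y : ι} (hy : S.deg y < 0) {d : ℤ} {v : Ind S ρ}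
    (hv : v ∈ filt S ρ d) : act S ρ y v ∈ filt S ρ (d + S.deg y) := by
  have : filt S ρ d ≤ (filt S ρ (d + S.deg y)).comap (act S ρ y) := by
    refine Submodule.span_le.2 ?_
    rintro _ ⟨l, c, h1, h2, rfl⟩
    refine Submodule.subset_span ⟨y :: l, c, ?_, ?_, rfl⟩
    · simpa using ⟨hy, h1⟩
    · simp only [List.map_cons, List.sum_cons]; omega
  exact this hv

variable {S}

/-- By induction on the length of a creation word, `y` is moved to the right. The commutator with
the first letter is a combination of single modes, of the right degree by homogeneity, applied to a
shorter word; on `C` the mode creates, acts through `ρ`, or vanishes. -/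
theorem act_mem_filt (hS : IsHomogeneous S) (y : ι) {d : ℤ} {v : Ind S ρ}
    (hv : v ∈ filt S ρ d) : act S ρ y v ∈ filt S ρ (d + S.deg y) := by
  have key : ∀ (l : List ι) (c : C), (∀ y ∈ l, S.deg y < 0) → ∀ y,
      act S ρ y (word S ρ l c) ∈ filt S ρ ((l.map S.deg).sum + S.deg y) := by
    intro l c
    induction l with
    | nil =>
      intro _ y
      rcases lt_trichotomy (S.deg y) 0 with hy | hy | hy
      · change act S ρ y (vac S ρ c) ∈ _
        simpa using act_mem_filt_of_neg S ρ hy (vac_mem_filt S ρ c)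
      · change act S ρ y (vac S ρ c) ∈ _
        rw [act_vac_zero S ρ hy]; simpa [hy] using vac_mem_filt S ρ (ρ y c)
      · change act S ρ y (vac S ρ c) ∈ _
        rw [act_vac_pos S ρ hy]; exact Submodule.zero_mem _
    | cons a l ih =>
      intro hl y
      have ha := hl a List.mem_cons_self
      have ih := ih fun y hy => hl y (List.mem_cons_of_mem _ hy)
      change act S ρ y (act S ρ a (word S ρ l c)) ∈ _
      rw [act_act]
      refine Submodule.add_mem _ (Submodule.smul_mem _ _ ?_) ?_
      · refine filt_mono S ρ ?_ (act_mem_filt_of_neg S ρ ha (ih y))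
        simp only [List.map_cons, List.sum_cons]; omega
      · rw [Finsupp.linearCombination_apply, Finsupp.sum, LinearMap.sum_apply]
        refine Submodule.sum_mem _ fun b hb => Submodule.smul_mem _ _ ?_
        refine filt_mono S ρ ?_ (ih b)
        rw [hS _ _ _ hb]
        simp only [List.map_cons, List.sum_cons]; omega
  have : filt S ρ d ≤ (filt S ρ (d + S.deg y)).comap (act S ρ y) := by
    refine Submodule.span_le.2 ?_
    rintro _ ⟨l, c, h1, h2, rfl⟩
    exact filt_mono S ρ (by omega) (key l c h1 y)
  exact this hv

variable {ρ}

theorem exists_mem_filt (hS : IsHomogeneous S) (v : Ind S ρ) : ∃ d, v ∈ filt S ρ d := by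
  let P : Submodule ℂ (Ind S ρ) :=
    { carrier := {v | ∃ d, v ∈ filt S ρ d}
      add_mem' := by
        rintro a b ⟨d, h⟩ ⟨e, h'⟩
        exact ⟨min d e, Submodule.add_mem _ (filt_mono S ρ (min_le_left _ _) h)
          (filt_mono S ρ (min_le_right _ _) h')⟩
      zero_mem' := ⟨0, Submodule.zero_mem _⟩
      smul_mem' := by
        rintro r a ⟨d, h⟩
        exact ⟨d, Submodule.smul_mem _ _ h⟩ }
  refine ind_induction P (fun c => ⟨0, vac_mem_filt S ρ c⟩) ?_ v
  rintro y v ⟨d, h⟩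
  exact ⟨_, act_mem_filt ρ hS y h⟩

/-- A subspace that contains `C` and is stable under creation modes is everything. -/
theorem ind_neg_induction (hS : IsHomogeneous S) (P : Submodule ℂ (Ind S ρ))
    (hv : ∀ c, vac S ρ c ∈ P) (ha : ∀ y, S.deg y < 0 → ∀ v ∈ P, act S ρ y v ∈ P)
    (v : Ind S ρ) : v ∈ P := by
  obtain ⟨d, h⟩ := exists_mem_filt hS v
  refine (Submodule.span_le.2 ?_ : filt S ρ d ≤ P) h
  rintro _ ⟨l, c, h1, -, rfl⟩
  induction l with
  | nil => exact hv c
  | cons a l ih =>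
    exact ha a (h1 a List.mem_cons_self) _ (ih fun y hy => h1 y (List.mem_cons_of_mem _ hy))

/-- Local finiteness: a mode of degree larger than `-d` moves a vector of `filt d` into positive
degree. -/
theorem exists_act_eq_zero (hS : IsHomogeneous S) (v : Ind S ρ) :
    ∃ d, ∀ y, d < S.deg y → act S ρ y v = 0 := by
  obtain ⟨d, h⟩ := exists_mem_filt hS v
  exact ⟨-d, fun y hy => filt_pos S ρ (by omega) (act_mem_filt ρ hS y h)⟩

end Induced

/-! ### Bilinears in free fermions -/

theorem eps_swap_right (i j k : Fin 3) : eps i k j = -eps i j k := by unfold eps; ring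

theorem eps_swap_left (i j k : Fin 3) : eps j i k = -eps i j k := by unfold eps; ring

/-- Three pairs of free fermions acting on a vector space. -/
structure FermionRep (N : Type) [AddCommGroup N] [Module ℂ N] where
  psi : Fin 3 → ℤ → N →ₗ[ℂ] N
  psis : Fin 3 → ℤ → N →ₗ[ℂ] N
  psi_psi : ∀ i j m n v, psi i m (psi j n v) = -psi j n (psi i m v)
  psis_psis : ∀ i j m n v, psis i m (psis j n v) = -psis j n (psis i m v)
  psis_psi : ∀ i j m n v, psis i m (psi j n v) =
    -psi j n (psis i m v) + if i = j ∧ m + n = -1 then v else 0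
  locally_finite : ∀ v, ∃ n₀ : ℤ, ∀ i n, n₀ ≤ n → psi i n v = 0

namespace FermionRep

variable {N N' : Type} [AddCommGroup N] [Module ℂ N] [AddCommGroup N'] [Module ℂ N']
  (R : FermionRep N) (R' : FermionRep N')

/-- Since the two factors anticommute, either may be applied first. One kills `v` for large `n`, the
other for very negative `n`. -/
theorem finite_support (j k : Fin 3) (m : ℤ) (v : N) :
    (Function.support fun n : ℤ => R.psi j n (R.psi k (m - n - 1) v)).Finite := by
  obtain ⟨n₀, h⟩ := R.locally_finite v
  refine (Set.finite_Icc (m - 1 - n₀) n₀).subset fun n hn => ?_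
  by_contra hc
  refine hn ?_
  rcases le_or_gt n₀ n with h1 | h1
  · change R.psi j n _ = 0
    rw [R.psi_psi, h j n h1, map_zero, neg_zero]
  · have : n₀ ≤ m - n - 1 := by
      simp only [Set.mem_Icc, not_and, not_le] at hc
      by_contra h2
      have := hc (by omega)
      omega
    change R.psi j n _ = 0
    rw [h k _ this, map_zero]

/-- The operator `∑_{j,k} ε_{ijk} ∑_r ψ^j_r ψ^k_{m-r}`. -/
def bilin (i : Fin 3) (m : ℤ) : N →ₗ[ℂ] N where
  toFun v := ∑ j, ∑ k, (eps i j k : ℂ) • ∑ᶠ n : ℤ, R.psi j n (R.psi k (m - n - 1) v)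
  map_add' v w := by
    simp only [map_add, ← Finset.sum_add_distrib, ← smul_add]
    refine Finset.sum_congr rfl fun j _ => Finset.sum_congr rfl fun k _ => ?_
    rw [finsum_add_distrib (R.finite_support j k m v) (R.finite_support j k m w)]
  map_smul' r v := by
    simp only [map_smul, RingHom.id_apply, Finset.smul_sum, ← smul_finsum]
    exact Finset.sum_congr rfl fun j _ => Finset.sum_congr rfl fun k _ => smul_comm _ _ _

theorem bilin_apply (i : Fin 3) (m : ℤ) (v : N) : R.bilin i m v =
    ∑ j, ∑ k, (eps i j k : ℂ) • ∑ᶠ n : ℤ, R.psi j n (R.psi k (m - n - 1) v) := rfl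

theorem bilin_mem {P : Submodule ℂ N} (i : Fin 3) (m : ℤ) {v : N}
    (h : ∀ j k n, R.psi j n (R.psi k (m - n - 1) v) ∈ P) : R.bilin i m v ∈ P := by
  rw [bilin_apply]
  exact Submodule.sum_mem _ fun j _ => Submodule.sum_mem _ fun k _ => Submodule.smul_mem _ _
    (finsum_induction (· ∈ P) P.zero_mem (fun _ _ => P.add_mem) fun n => h j k n)

variable {R R'} in
/-- Bilinears are natural for maps that commute or anticommute with the fermions. -/
theorem map_bilin {f : N →ₗ[ℂ] N'} {σ : ℂ} (hσ : σ * σ = 1)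
    (h : ∀ j n v, f (R.psi j n v) = σ • R'.psi j n (f v)) (i : Fin 3) (m : ℤ) (v : N) :
    f (R.bilin i m v) = R'.bilin i m (f v) := by
  simp only [bilin_apply, map_sum, map_smul]
  refine Finset.sum_congr rfl fun j _ => Finset.sum_congr rfl fun k _ => ?_
  congr 1
  rw [map_finsum f (R.finite_support j k m v)]
  refine finsum_congr fun n => ?_
  rw [h, h, map_smul, smul_smul, hσ, one_smul]

theorem commute_bilin {f : N →ₗ[ℂ] N} (h : ∀ j n v, f (R.psi j n v) = R.psi j n (f v))
    (i : Fin 3) (m : ℤ) (v : N) : f (R.bilin i m v) = R.bilin i m (f v) :=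
  map_bilin (σ := 1) (one_mul 1) (fun j n v => by rw [one_smul, h]) i m v

/-- Passing two anticommuting factors costs the sign `(-1)^2`. -/
theorem psi_bilin (l : Fin 3) (s : ℤ) (i : Fin 3) (m : ℤ) (v : N) :
    R.psi l s (R.bilin i m v) = R.bilin i m (R.psi l s v) :=
  map_bilin (σ := -1) (by norm_num) (fun j n v => by rw [neg_one_smul, R.psi_psi]) i m v

theorem bilin_bilin (i i' : Fin 3) (m m' : ℤ) (v : N) :
    R.bilin i m (R.bilin i' m' v) = R.bilin i' m' (R.bilin i m v) :=
  R.commute_bilin (fun j n v => (R.psi_bilin j n i m v).symm) i' m' v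

/-- The decoupling identity. `ψ^*` contracts with either factor of the bilinear; the two
contributions differ in sign and in the order of the indices, so antisymmetry of `ε` makes them add.
The resulting `2` explains the coefficients `1/4` and `1/2` in the corrections. -/
theorem psis_bilin (l : Fin 3) (s : ℤ) (i : Fin 3) (m : ℤ) (v : N) :
    R.psis l s (R.bilin i m v) = R.bilin i m (R.psis l s v) +
      ∑ k, (2 * (eps i l k : ℂ)) • R.psi k (m + s) v := by
  have key : ∀ j k, R.psis l s (∑ᶠ n : ℤ, R.psi j n (R.psi k (m - n - 1) v)) =
      (∑ᶠ n : ℤ, R.psi j n (R.psi k (m - n - 1) (R.psis l s v))) +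
        ((if l = j then R.psi k (m + s) v else 0) - if l = k then R.psi j (m + s) v else 0) := by
    intro j k
    rw [map_finsum _ (R.finite_support j k m v)]
    -- The contraction with the first factor happens at `n = -1 - s` only, and that with the second
    -- at `n = m + s` only; in both cases the remaining fermion has index `m + s`.
    have e : ∀ n : ℤ, R.psis l s (R.psi j n (R.psi k (m - n - 1) v)) =
        R.psi j n (R.psi k (m - n - 1) (R.psis l s v)) +
          ((if n = -1 - s then (if l = j then R.psi k (m + s) v else 0) else 0) -
            if n = m + s then (if l = k then R.psi j (m + s) v else 0) else 0) := by
      intro n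
      rw [R.psis_psi, R.psis_psi, map_add, map_neg, neg_add, neg_neg, add_assoc]
      congr 1
      refine (neg_add_eq_sub _ _).trans (congrArg₂ (· - ·) ?_ ?_)
      · by_cases hn : n = -1 - s
        · subst hn
          by_cases hl : l = j
          · rw [if_pos ⟨hl, by ring⟩, if_pos rfl, if_pos hl]; congr 2; ring
          · rw [if_neg (fun h => hl h.1), if_pos rfl, if_neg hl]
        · rw [if_neg (fun h => hn (by omega)), if_neg hn]
      · by_cases hn : n = m + s
        · subst hn
          by_cases hl : l = k
          · rw [if_pos ⟨hl, by ring⟩, if_pos rfl, if_pos hl]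
          · rw [if_neg (fun h => hl h.1), if_pos rfl, if_neg hl, map_zero]
        · rw [if_neg (fun h => hn (by omega)), if_neg hn, map_zero]
    have hs : ∀ (a : ℤ) (w : N), (Function.support fun n : ℤ => if n = a then w else 0).Finite :=
      fun a w => (Set.finite_singleton a).subset fun n hn => by
        by_contra h; exact hn (if_neg h)
    have hv : ∀ (a : ℤ) (w : N), ∑ᶠ n : ℤ, (if n = a then w else 0) = w := fun a w => by
      rw [finsum_eq_single _ a fun n hn => if_neg hn, if_pos rfl]
    rw [finsum_congr e, finsum_add_distrib (R.finite_support j k m _),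
      finsum_sub_distrib (hs _ _) (hs _ _), hv, hv]
    exact ((hs _ _).union (hs _ _)).subset (Function.support_sub _ _)
  simp only [bilin_apply, map_sum, map_smul, key, smul_add, Finset.sum_add_distrib, smul_sub,
    Finset.sum_sub_distrib]
  congr 1
  have h1 : ∑ j, ∑ k, (eps i j k : ℂ) • (if l = j then R.psi k (m + s) v else 0) =
      ∑ k, (eps i l k : ℂ) • R.psi k (m + s) v := by
    rw [Finset.sum_comm]
    refine Finset.sum_congr rfl fun k _ => ?_
    rw [Finset.sum_eq_single l (fun j _ hj => by rw [if_neg hj.symm, smul_zero])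
      (fun h => absurd (Finset.mem_univ _) h), if_pos rfl]
  have h2 : ∑ j, ∑ k, (eps i j k : ℂ) • (if l = k then R.psi j (m + s) v else 0) =
      -∑ k, (eps i l k : ℂ) • R.psi k (m + s) v := by
    rw [← Finset.sum_neg_distrib]
    refine Finset.sum_congr rfl fun j _ => ?_
    rw [Finset.sum_eq_single l (fun k _ hk => by rw [if_neg hk.symm, smul_zero])
      (fun h => absurd (Finset.mem_univ _) h), if_pos rfl, eps_swap_right i l j,
      Complex.ofReal_neg, neg_smul]
  rw [h1, h2, sub_neg_eq_add, ← Finset.sum_add_distrib]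
  exact Finset.sum_congr rfl fun k _ => by rw [two_mul, add_smul]

/-- The indices `n` and `m - n - 1` add up to `m - 1 ≥ -1`, so they cannot both be negative, and the
annihilating factor can be applied first. In particular the bilinear of degree zero needs no normal
ordering. -/
theorem bilin_eq_zero {v : N} (hv : ∀ j n, 0 ≤ n → R.psi j n v = 0) (i : Fin 3) {m : ℤ}
    (hm : 0 ≤ m) : R.bilin i m v = 0 := by
  refine (Submodule.mem_bot ℂ).1 (R.bilin_mem i m fun j k n => (Submodule.mem_bot ℂ).2 ?_)
  rcases le_or_gt 0 n with h | h
  · rw [R.psi_psi, hv j n h, map_zero, neg_zero]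
  · rw [hv k _ (by omega), map_zero]

/-- Fermions acting on the second factor of a tensor product. -/
def tensor (A : Type) [AddCommGroup A] [Module ℂ A] : FermionRep (A ⊗[ℂ] N) where
  psi i n := (R.psi i n).lTensor A
  psis i n := (R.psis i n).lTensor A
  psi_psi i j m n v := by
    have : (R.psi i m).lTensor A ∘ₗ (R.psi j n).lTensor A =
        -((R.psi j n).lTensor A ∘ₗ (R.psi i m).lTensor A) :=
      TensorProduct.ext' fun a b => by simp [R.psi_psi i j, TensorProduct.tmul_neg]
    exact LinearMap.congr_fun this v
  psis_psis i j m n v := by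
    have : (R.psis i m).lTensor A ∘ₗ (R.psis j n).lTensor A =
        -((R.psis j n).lTensor A ∘ₗ (R.psis i m).lTensor A) :=
      TensorProduct.ext' fun a b => by simp [R.psis_psis i j, TensorProduct.tmul_neg]
    exact LinearMap.congr_fun this v
  psis_psi i j m n v := by
    have : (R.psis i m).lTensor A ∘ₗ (R.psi j n).lTensor A =
        -((R.psi j n).lTensor A ∘ₗ (R.psis i m).lTensor A) +
          (if i = j ∧ m + n = -1 then LinearMap.id else 0) :=
      TensorProduct.ext' fun a b => by
        simp only [LinearMap.comp_apply, LinearMap.lTensor_tmul, LinearMap.add_apply,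
          LinearMap.neg_apply, R.psis_psi i j, TensorProduct.tmul_add, TensorProduct.tmul_neg]
        congr 1
        split_ifs <;> simp
    refine (LinearMap.congr_fun this v).trans ?_
    rw [LinearMap.add_apply]
    congr 1
    split_ifs <;> rfl
  locally_finite v := by
    induction v using TensorProduct.induction_on with
    | zero => exact ⟨0, fun i n _ => map_zero _⟩
    | tmul a b =>
      obtain ⟨n₀, h⟩ := R.locally_finite b
      exact ⟨n₀, fun i n hn => by rw [LinearMap.lTensor_tmul, h i n hn, TensorProduct.tmul_zero]⟩
    | add x y hx hy =>
      obtain ⟨n₀, h⟩ := hx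
      obtain ⟨n₁, h'⟩ := hy
      exact ⟨max n₀ n₁, fun i n hn => by
        rw [map_add, h i n ((le_max_left _ _).trans hn), h' i n ((le_max_right _ _).trans hn),
          add_zero]⟩

theorem tensor_bilin (A : Type) [AddCommGroup A] [Module ℂ A] (i : Fin 3) (m : ℤ) (a : A)
    (b : N) : (R.tensor A).bilin i m (a ⊗ₜ b) = a ⊗ₜ R.bilin i m b :=
  (map_bilin (R := R) (R' := R.tensor A) (f := TensorProduct.mk ℂ A N a) (σ := 1) (one_mul 1)
    (fun j n v => by rw [one_smul]; rfl) i m b).symm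

end FermionRep

/-! ### Decoupling the fermions -/

/-- The odd modes act on the even ones only by `[y, ψ^*_j(w)] ∝ ε_{ijk} ψ^k(w)`, `i = dir y`, and
the modes with a nonzero factor `s y` do not occur in brackets. -/
structure IsDecoupling {ι : Type} (B : ModeAlgebra ι) (z : ι) (mix : ι → FGen → (FGen →₀ ℂ))
    (s : ι → ℂ) (dir : ι → Fin 3) (d : ι → ℤ) : Prop where
  even : ∀ a, B.odd a = false
  homogeneous : IsHomogeneous B
  deg_z : B.deg z = 0
  s_z : s z = 0
  bracket_z : ∀ a, B.bracket z a = 0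
  mix_psi : ∀ y i n, mix y (.psi i n) = 0
  mix_psis : ∀ y j n, mix y (.psis j n) =
    ∑ k, Finsupp.single (.psi k (d y + n)) (2 * s y * (eps (dir y) j k : ℂ))
  deg_eq : ∀ y, s y ≠ 0 → B.deg y = 2 * d y
  s_bracket : ∀ a b c, c ∈ (B.bracket a b).support → s c = 0

/-- The operator of an odd mode. -/
def FermionRep.op {N : Type} [AddCommGroup N] [Module ℂ N] (R : FermionRep N) :
    FGen → N →ₗ[ℂ] N
  | .psi i n => R.psi i n
  | .psis i n => R.psis i n

/-- The Fock space is itself a super-induced module, over a line with nothing to decouple. Hence the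
general results below also apply to it. -/
theorem isDecoupling_fermions :
    IsDecoupling centralLine () (fun _ _ => 0) (fun _ => 0) (fun _ => 0) (fun _ => 0) where
  even _ := rfl
  homogeneous a b c h := by simp [centralLine] at h
  deg_z := rfl
  s_z := rfl
  bracket_z _ := rfl
  mix_psi _ _ _ := rfl
  mix_psis _ _ _ := by simp
  deg_eq _ h := absurd rfl h
  s_bracket _ _ _ _ := rfl

namespace IsDecoupling

variable {ι : Type} {B : ModeAlgebra ι} {z : ι} {mix : ι → FGen → (FGen →₀ ℂ)}
  {s : ι → ℂ} {dir : ι → Fin 3} {d : ι → ℤ}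

theorem mix_z (D : IsDecoupling B z mix s dir d) (f : FGen) : mix z f = 0 := by
  cases f with
  | psi i n => exact D.mix_psi z i n
  | psis i n => rw [D.mix_psis, D.s_z]; simp

theorem homogeneous_super (D : IsDecoupling B z mix s dir d) : IsHomogeneous (withFermions B z mix) := by
  have hmix : ∀ (a : ι) (f : FGen) (c : ι ⊕ FGen),
      c ∈ ((mix a f).mapDomain (Sum.inr : FGen → ι ⊕ FGen)).support →
      (withFermions B z mix).deg c = B.deg a + (withFermions B z mix).deg (.inr f) := by
    intro a f c hc
    classical
    obtain ⟨g, hg, rfl⟩ := Finset.mem_image.1 (Finsupp.mapDomain_support hc)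
    cases f with
    | psi i n => rw [D.mix_psi] at hg; simp at hg
    | psis i n =>
      rw [D.mix_psis] at hg
      by_cases hs : s a = 0
      · simp [hs] at hg
      · obtain ⟨k, -, hk⟩ := Finset.mem_biUnion.1 (Finsupp.support_finsetSum hg)
        have := Finset.mem_singleton.1 (Finsupp.support_single_subset hk)
        subst this
        change 2 * (d a + n) + 1 = B.deg a + (2 * n + 1)
        rw [D.deg_eq a hs]; ring
  have hz : ∀ (i j : Fin 3) (m n : ℤ) (c : ι ⊕ FGen),
      c ∈ (if i = j ∧ m + n = -1 then Finsupp.single (Sum.inl z : ι ⊕ FGen) (1 : ℂ) else 0).support →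
      (withFermions B z mix).deg c = (2 * m + 1) + (2 * n + 1) := by
    intro i j m n c hc
    split_ifs at hc with h
    · have := Finset.mem_singleton.1 (Finsupp.support_single_subset hc)
      subst this
      change B.deg z = _
      rw [D.deg_z]; omega
    · simp at hc
  intro a b c hc
  rcases a with a | a <;> rcases b with b | b
  · classical
    obtain ⟨g, hg, rfl⟩ := Finset.mem_image.1 (Finsupp.mapDomain_support hc)
    exact D.homogeneous a b g hg
  · exact hmix a b c hc
  · have hc : c ∈ (-(mix b a).mapDomain (Sum.inr : FGen → ι ⊕ FGen)).support := hc
    rw [Finsupp.support_neg] at hc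
    rw [hmix b a c hc]; exact add_comm _ _
  · rcases a with ⟨i, m⟩ | ⟨i, m⟩ <;> rcases b with ⟨j, n⟩ | ⟨j, n⟩
    · have hc : c ∈ (0 : (ι ⊕ FGen) →₀ ℂ).support := hc
      simp at hc
    · rw [hz j i n m c hc]; exact add_comm _ _
    · exact hz i j m n c hc
    · have hc : c ∈ (0 : (ι ⊕ FGen) →₀ ℂ).support := hc
      simp at hc

section Reps

variable {N : Type} [AddCommGroup N] [Module ℂ N] (R : FermionRep N) (Y : ι → N →ₗ[ℂ] N)

/-- The bracket of `Y` with the fermions is `t` times the one prescribed by `mix`. -/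
def _root_.SuperLoop.MixesBy (s : ι → ℂ) (dir : ι → Fin 3) (d : ι → ℤ) (t : ℂ) : Prop :=
  (∀ y i n v, Y y (R.psi i n v) = R.psi i n (Y y v)) ∧
  ∀ y j n v, Y y (R.psis j n v) = R.psis j n (Y y v) +
    ∑ k, (t * (2 * s y * (eps (dir y) j k : ℂ))) • R.psi k (d y + n) v

/-- The operators `Y` corrected by bilinears in the fermions. -/
def _root_.SuperLoop.corrected (s : ι → ℂ) (dir : ι → Fin 3) (d : ι → ℤ) (r : ℂ) (y : ι) :
    N →ₗ[ℂ] N := Y y + (r * s y) • R.bilin (dir y) (d y)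

theorem _root_.SuperLoop.corrected_apply (r : ℂ) (y : ι) (v : N) :
    corrected R Y s dir d r y v = Y y v + (r * s y) • R.bilin (dir y) (d y) v := rfl

variable {R Y} in
-- By `psis_bilin`, adding `r` times the correction lowers the strength `t` of the coupling by `r`.
-- It is used with `t = r = 1` to decouple and with `t = 0`, `r = -1` to couple again.
theorem _root_.SuperLoop.MixesBy.corrected {t : ℂ} (h : MixesBy R Y s dir d t) (r : ℂ) :
    MixesBy R (corrected R Y s dir d r) s dir d (t - r) := by
  constructor
  · intro y i n v
    rw [corrected_apply, corrected_apply, h.1, ← R.psi_bilin, map_add, map_smul]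
  · intro y j n v
    rw [corrected_apply, corrected_apply, h.2, map_add, map_smul, R.psis_bilin, smul_add,
      Finset.smul_sum]
    simp only [smul_smul, sub_mul, sub_smul, Finset.sum_sub_distrib]
    have : ∑ k, (r * s y * (2 * (eps (dir y) j k : ℂ))) • R.psi k (d y + n) v =
        ∑ k, (r * (2 * s y * (eps (dir y) j k : ℂ))) • R.psi k (d y + n) v :=
      Finset.sum_congr rfl fun k _ => by congr 1; ring
    rw [this]; abel

variable {R Y} in
-- All cross terms cancel: bilinears commute with each other and with `Y`, which commutes with the
-- `ψ`. The right hand sides do not change because the modes in a bracket have `s = 0`.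
theorem isModeRep_corrected (D : IsDecoupling B z mix s dir d) {t : ℂ} (h : MixesBy R Y s dir d t) (hY : IsModeRep B Y) (r : ℂ) :
    IsModeRep B (corrected R Y s dir d r) := by
  intro a b v
  have hab := hY a b v
  rw [D.even a, D.even b] at hab ⊢
  have k1 : koszul false false = 1 := rfl
  rw [k1, one_smul] at hab ⊢
  have e : Finsupp.linearCombination ℂ (corrected R Y s dir d r) (B.bracket a b) =
      Finsupp.linearCombination ℂ Y (B.bracket a b) := by
    rw [Finsupp.linearCombination_apply, Finsupp.linearCombination_apply]
    refine Finset.sum_congr rfl fun c hc => ?_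
    simp only [corrected, D.s_bracket a b c hc, mul_zero, zero_smul, add_zero]
  rw [e]
  simp only [corrected_apply, map_add, map_smul]
  rw [hab, R.commute_bilin (h.1 a), R.commute_bilin (h.1 b), R.bilin_bilin (dir a) (dir b)]
  simp only [smul_add, smul_smul, mul_comm (r * s b)]
  abel

variable {R Y} in
-- Even modes and fermions together represent the super extension exactly when the coupling has
-- strength `1` and the central element acts as the identity, as the contraction of `ψ^*` with `ψ`
-- requires.
theorem isModeRep_super (D : IsDecoupling B z mix s dir d) (h : MixesBy R Y s dir d 1) (hY : IsModeRep B Y)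
    (hz : Y z = LinearMap.id) : IsModeRep (withFermions B z mix) (Sum.elim Y R.op) := by
  have k1 : ∀ b, koszul false b = 1 := fun b => by simp [koszul]
  have k2 : ∀ b, koszul b false = 1 := fun b => by simp [koszul]
  have k3 : koszul true true = -1 := by simp [koszul]
  have hmix : ∀ y f v, Y y (R.op f v) = R.op f (Y y v) +
      Finsupp.linearCombination ℂ R.op (mix y f) v := by
    intro y f v
    cases f with
    | psi i n => rw [D.mix_psi, map_zero, LinearMap.zero_apply, add_zero]; exact h.1 y i n v
    | psis j n =>
      refine (h.2 y j n v).trans ?_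
      rw [D.mix_psis, map_sum, LinearMap.sum_apply]
      simp only [Finsupp.linearCombination_single, LinearMap.smul_apply, one_mul]
      rfl
  intro a b v
  rcases a with a | a <;> rcases b with b | b
  · have := hY a b v
    refine this.trans ?_
    congr 1
    change _ = Finsupp.linearCombination ℂ (Sum.elim Y R.op) ((B.bracket a b).mapDomain Sum.inl) v
    rw [Finsupp.linearCombination_mapDomain]; rfl
  · change Y a (R.op b v) = koszul (B.odd a) true • R.op b (Y a v) +
      Finsupp.linearCombination ℂ (Sum.elim Y R.op) ((mix a b).mapDomain Sum.inr) v
    rw [D.even, k1, one_smul, Finsupp.linearCombination_mapDomain]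
    exact hmix a b v
  · change R.op a (Y b v) = koszul true (B.odd b) • Y b (R.op a v) +
      Finsupp.linearCombination ℂ (Sum.elim Y R.op) (-(mix b a).mapDomain Sum.inr) v
    rw [D.even, k2, one_smul, map_neg, Finsupp.linearCombination_mapDomain, hmix b a v]
    change _ = _ + -Finsupp.linearCombination ℂ R.op (mix b a) v
    abel
  · have hs : ∀ (i j : Fin 3) (m n : ℤ), Finsupp.linearCombination ℂ (Sum.elim Y R.op)
        (if i = j ∧ m + n = -1 then Finsupp.single (Sum.inl z : ι ⊕ FGen) (1 : ℂ) else 0) v =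
        if i = j ∧ m + n = -1 then v else 0 := by
      intro i j m n
      split_ifs
      · simp [hz]
      · simp
    change R.op a (R.op b v) = koszul true true • R.op b (R.op a v) + _
    rw [k3, neg_one_smul]
    rcases a with ⟨i, m⟩ | ⟨i, m⟩ <;> rcases b with ⟨j, n⟩ | ⟨j, n⟩
    · change R.psi i m (R.psi j n v) = -R.psi j n (R.psi i m v) +
        Finsupp.linearCombination ℂ (Sum.elim Y R.op) 0 v
      rw [map_zero, LinearMap.zero_apply, add_zero, R.psi_psi]
    · change R.psi i m (R.psis j n v) = -R.psis j n (R.psi i m v) +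
        Finsupp.linearCombination ℂ (Sum.elim Y R.op)
        (if j = i ∧ n + m = -1 then Finsupp.single (Sum.inl z : ι ⊕ FGen) (1 : ℂ) else 0) v
      rw [hs, R.psis_psi]; abel
    · change R.psis i m (R.psi j n v) = -R.psi j n (R.psis i m v) +
        Finsupp.linearCombination ℂ (Sum.elim Y R.op)
        (if i = j ∧ m + n = -1 then Finsupp.single (Sum.inl z : ι ⊕ FGen) (1 : ℂ) else 0) v
      rw [hs, R.psis_psi]
    · change R.psis i m (R.psis j n v) = -R.psis j n (R.psis i m v) +
        Finsupp.linearCombination ℂ (Sum.elim Y R.op) 0 v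
      rw [map_zero, LinearMap.zero_apply, add_zero, R.psis_psis]

end Reps

variable {C : Type} [AddCommGroup C] [Module ℂ C] {ρ : ι → C →ₗ[ℂ] C}

theorem act_central (D : IsDecoupling B z mix s dir d)
    (hρ : ρ z = LinearMap.id) : act B ρ z = LinearMap.id := by
  refine ind_hom_ext (act B ρ) (fun c => ?_) (fun y v => ?_) (fun y v => rfl)
  · rw [act_vac_zero B ρ D.deg_z, hρ]; rfl
  · rw [act_act, D.bracket_z, D.even]; simp [koszul]

theorem bAct_central (D : IsDecoupling B z mix s dir d)
    (hρ : ρ z = LinearMap.id) : bAct B z mix ρ z = LinearMap.id := by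
  refine ind_hom_ext (act (withFermions B z mix) (withFermionsAction ρ)) (fun c => ?_)
    (fun y v => ?_) (fun y v => rfl)
  · rw [bAct, act_vac_zero _ _ (show (withFermions B z mix).deg (.inl z) = 0 from D.deg_z)]
    change vac _ _ (ρ z c) = _
    rw [hρ]; rfl
  · have h0 : (withFermions B z mix).bracket (.inl z) y = 0 := by
      rcases y with y | y
      · change (B.bracket z y).mapDomain Sum.inl = 0
        rw [D.bracket_z]; exact Finsupp.mapDomain_zero
      · change (mix z y).mapDomain Sum.inr = 0
        rw [D.mix_z]; exact Finsupp.mapDomain_zero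
    rw [bAct, act_act, h0, show (withFermions B z mix).odd (.inl z) = false from D.even z]
    simp [koszul]

theorem _root_.SuperLoop.fAct_psi_psi (i j : Fin 3) (m n : ℤ) (v : SuperInd B z mix ρ) :
    fAct B z mix ρ (.psi i m) (fAct B z mix ρ (.psi j n) v) =
      -fAct B z mix ρ (.psi j n) (fAct B z mix ρ (.psi i m) v) := by
  have h := act_act (withFermions B z mix) (withFermionsAction ρ) (.inr (.psi i m))
    (.inr (.psi j n)) v
  have k : koszul true true = -1 := by simp [koszul]
  change _ = koszul true true • _ + Finsupp.linearCombination ℂ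
    (act (withFermions B z mix) (withFermionsAction ρ)) 0 v at h
  rwa [k, map_zero, LinearMap.zero_apply, add_zero, neg_one_smul] at h

theorem _root_.SuperLoop.fAct_psis_psis (i j : Fin 3) (m n : ℤ) (v : SuperInd B z mix ρ) :
    fAct B z mix ρ (.psis i m) (fAct B z mix ρ (.psis j n) v) =
      -fAct B z mix ρ (.psis j n) (fAct B z mix ρ (.psis i m) v) := by
  have h := act_act (withFermions B z mix) (withFermionsAction ρ) (.inr (.psis i m))
    (.inr (.psis j n)) v
  have k : koszul true true = -1 := by simp [koszul]
  change _ = koszul true true • _ + Finsupp.linearCombination ℂ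
    (act (withFermions B z mix) (withFermionsAction ρ)) 0 v at h
  rwa [k, map_zero, LinearMap.zero_apply, add_zero, neg_one_smul] at h

theorem fAct_psis_psi (D : IsDecoupling B z mix s dir d)
    (hρ : ρ z = LinearMap.id) (i j : Fin 3) (m n : ℤ)
    (v : SuperInd B z mix ρ) :
    fAct B z mix ρ (.psis i m) (fAct B z mix ρ (.psi j n) v) =
      -fAct B z mix ρ (.psi j n) (fAct B z mix ρ (.psis i m) v) +
        if i = j ∧ m + n = -1 then v else 0 := by
  have h := act_act (withFermions B z mix) (withFermionsAction ρ) (.inr (.psis i m))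
    (.inr (.psi j n)) v
  have k : koszul true true = -1 := by simp [koszul]
  change _ = koszul true true • _ + Finsupp.linearCombination ℂ
    (act (withFermions B z mix) (withFermionsAction ρ))
    (if i = j ∧ m + n = -1 then Finsupp.single (Sum.inl z : ι ⊕ FGen) (1 : ℂ) else 0) v at h
  rw [k, neg_one_smul] at h
  refine h.trans ?_
  congr 1
  split_ifs
  · rw [Finsupp.linearCombination_single, one_smul]
    exact LinearMap.congr_fun (D.bAct_central hρ) v
  · rw [map_zero, LinearMap.zero_apply]

/-- The fermions on the induced module. -/
def superRep (D : IsDecoupling B z mix s dir d)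
    (hρ : ρ z = LinearMap.id) : FermionRep (SuperInd B z mix ρ) where
  psi i n := fAct B z mix ρ (.psi i n)
  psis i n := fAct B z mix ρ (.psis i n)
  psi_psi := fAct_psi_psi
  psis_psis := fAct_psis_psis
  psis_psi := D.fAct_psis_psi hρ
  locally_finite v := by
    obtain ⟨e, h⟩ := exists_act_eq_zero D.homogeneous_super v
    refine ⟨|e|, fun i n hn => h _ ?_⟩
    change e < 2 * n + 1
    have := le_abs_self e
    have := abs_nonneg e
    omega

theorem superRep_op (D : IsDecoupling B z mix s dir d) (hρ : ρ z = LinearMap.id) (f : FGen) :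
    (D.superRep hρ).op f = fAct B z mix ρ f := by cases f <;> rfl

/-- The doubled degree `2n + 1` is odd, so a fermionic mode of nonnegative degree has positive
degree. -/
theorem _root_.SuperLoop.fAct_vac (f : FGen) (hf : 0 ≤ (withFermions B z mix).deg (.inr f)) (c : C) :
    fAct B z mix ρ f (sVac B z mix ρ c) = 0 := by
  refine act_vac_pos _ _ (lt_of_le_of_ne hf fun h => ?_) c
  cases f with
  | psi i n => change 0 = 2 * n + 1 at h; omega
  | psis i n => change 0 = 2 * n + 1 at h; omega

theorem _root_.SuperLoop.bAct_vac {y : ι} (hy : 0 ≤ B.deg y) (c : C) :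
    bAct B z mix ρ y (sVac B z mix ρ c) = sVac B z mix ρ (extendedAction B ρ y c) :=
  act_vac (withFermions B z mix) (withFermionsAction ρ) (y := .inl y) hy c

theorem mixesBy_bAct (D : IsDecoupling B z mix s dir d) (hρ : ρ z = LinearMap.id) :
    MixesBy (D.superRep hρ) (bAct B z mix ρ) s dir d 1 := by
  have key : ∀ y f v, bAct B z mix ρ y (fAct B z mix ρ f v) = fAct B z mix ρ f (bAct B z mix ρ y v)
      + Finsupp.linearCombination ℂ (fAct B z mix ρ) (mix y f) v := by
    intro y f v
    have h := act_act (withFermions B z mix) (withFermionsAction ρ) (.inl y) (.inr f) v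
    change _ = koszul (B.odd y) true • _ + Finsupp.linearCombination ℂ
      (act (withFermions B z mix) (withFermionsAction ρ))
      ((mix y f).mapDomain Sum.inr) v at h
    rw [D.even, show koszul false true = 1 by simp [koszul], one_smul,
      Finsupp.linearCombination_mapDomain] at h
    exact h
  constructor
  · intro y i n v
    refine (key y (.psi i n) v).trans ?_
    rw [D.mix_psi, map_zero, LinearMap.zero_apply, add_zero]; rfl
  · intro y j n v
    refine (key y (.psis j n) v).trans ?_
    rw [D.mix_psis, map_sum, LinearMap.sum_apply]
    simp only [Finsupp.linearCombination_single, LinearMap.smul_apply, one_mul]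
    rfl

theorem _root_.SuperLoop.isModeRep_bAct : IsModeRep B (bAct B z mix ρ) := by
  intro a b v
  refine (act_act (withFermions B z mix) (withFermionsAction ρ) (.inl a) (.inl b) v).trans ?_
  congr 1
  change Finsupp.linearCombination ℂ (act (withFermions B z mix) (withFermionsAction ρ))
    ((B.bracket a b).mapDomain Sum.inl) v = _
  rw [Finsupp.linearCombination_mapDomain]; rfl

/-- The decoupled even modes. -/
def tilde (D : IsDecoupling B z mix s dir d)
    (hρ : ρ z = LinearMap.id) : ι → SuperInd B z mix ρ →ₗ[ℂ] SuperInd B z mix ρ :=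
  corrected (D.superRep hρ) (bAct B z mix ρ) s dir d 1

theorem tilde_apply (D : IsDecoupling B z mix s dir d)
    (hρ : ρ z = LinearMap.id) (y : ι) (v : SuperInd B z mix ρ) :
    D.tilde hρ y v = bAct B z mix ρ y v + s y • quad B z mix ρ (dir y) (d y) v := by
  rw [tilde, corrected_apply, one_mul]; rfl

theorem isModeRep_tilde (D : IsDecoupling B z mix s dir d)
    (hρ : ρ z = LinearMap.id) : IsModeRep B (D.tilde hρ) :=
  D.isModeRep_corrected (D.mixesBy_bAct hρ) isModeRep_bAct 1

/-- The coupling has strength `1 - 1 = 0` after the correction. -/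
theorem tilde_fAct (D : IsDecoupling B z mix s dir d)
    (hρ : ρ z = LinearMap.id) (y : ι) (f : FGen) (v : SuperInd B z mix ρ) :
    D.tilde hρ y (fAct B z mix ρ f v) = fAct B z mix ρ f (D.tilde hρ y v) := by
  have h := (D.mixesBy_bAct hρ).corrected 1
  cases f with
  | psi i n => exact h.1 y i n v
  | psis j n =>
    refine (h.2 y j n v).trans ?_
    simp only [sub_self, zero_mul, zero_smul, Finset.sum_const_zero, add_zero]
    rfl

/-- A correction of nonnegative degree annihilates `C`, so decoupled modes satisfy the same
conditions on `C` as the original ones. This makes the universal property of the first factor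
applicable. -/
theorem tilde_vac (D : IsDecoupling B z mix s dir d)
    (hρ : ρ z = LinearMap.id) {y : ι} (hy : 0 ≤ B.deg y) (c : C) :
    D.tilde hρ y (sVac B z mix ρ c) = sVac B z mix ρ (extendedAction B ρ y c) := by
  rw [tilde, corrected_apply, bAct_vac hy]
  by_cases hs : s y = 0
  · rw [hs, mul_zero, zero_smul, add_zero]
  · rw [FermionRep.bilin_eq_zero, smul_zero, add_zero]
    · intro j n hn
      refine fAct_vac (.psi j n) ?_ c
      change 0 ≤ 2 * n + 1
      omega
    · have := D.deg_eq y hs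
      omega

end IsDecoupling

/-- The fermions on the Fock space. -/
def fockRep : FermionRep Fock := isDecoupling_fermions.superRep rfl

theorem fockRep_op (f : FGen) : fockRep.op f = act fermions fermionsAction (.inr f) :=
  isDecoupling_fermions.superRep_op rfl f

theorem act_unit (b : Fock) : act fermions fermionsAction (.inl ()) b = b :=
  LinearMap.congr_fun (isDecoupling_fermions.bAct_central (ρ := fun _ => LinearMap.id) rfl) b

/-- Representations on spaces of maps `A → N` allow the universal property to produce bilinear maps,
as needed for tensor products. -/
theorem IsModeRep.postcomp {ι : Type} {S : ModeAlgebra ι} {N A : Type} [AddCommGroup N]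
    [Module ℂ N] [AddCommGroup A] [Module ℂ A] {T : ι → N →ₗ[ℂ] N} (hT : IsModeRep S T) :
    IsModeRep S (fun a => LinearMap.compRight ℂ (M := A) (T a)) := by
  intro a b F
  refine LinearMap.ext fun c => ?_
  refine (hT a b (F c)).trans ?_
  rw [LinearMap.add_apply]
  congr 1
  rw [Finsupp.linearCombination_apply, Finsupp.linearCombination_apply, Finsupp.sum, Finsupp.sum,
    LinearMap.sum_apply, LinearMap.sum_apply, LinearMap.sum_apply]
  rfl

theorem fock_deg_nonneg_vac (f : FGen) (hf : 0 ≤ fermions.deg (.inr f)) :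
    act fermions fermionsAction (.inr f) fockVac = 0 :=
  fAct_vac (B := centralLine) f hf 1

/-! ### The factorization map and its inverse -/

namespace IsDecoupling

variable {ι : Type} {B : ModeAlgebra ι} {z : ι} {mix : ι → FGen → (FGen →₀ ℂ)}
  {s : ι → ℂ} {dir : ι → Fin 3} {d : ι → ℤ}
  {C : Type} [AddCommGroup C] [Module ℂ C] {ρ : ι → C →ₗ[ℂ] C}

theorem isModeRep_fAct (D : IsDecoupling B z mix s dir d) (hρ : ρ z = LinearMap.id) :
    IsModeRep fermions (Sum.elim (fun _ => LinearMap.id) (fAct B z mix ρ)) := by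
  have h := isDecoupling_fermions.isModeRep_super (R := D.superRep hρ)
    (Y := fun _ => LinearMap.id) ⟨fun _ _ _ _ => rfl, fun _ _ _ _ => by simp⟩
    (fun a b v => by simp [koszul, centralLine]) rfl
  rwa [show (D.superRep hρ).op = fAct B z mix ρ from funext (D.superRep_op hρ)] at h

/-- The fermions applied to `C`. -/
theorem exists_fock_map (D : IsDecoupling B z mix s dir d) (hρ : ρ z = LinearMap.id) :
    ∃ F : Fock →ₗ[ℂ] C →ₗ[ℂ] SuperInd B z mix ρ, (∀ c, F fockVac c = sVac B z mix ρ c) ∧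
      ∀ f b c, F (act fermions fermionsAction (.inr f) b) c = fAct B z mix ρ f (F b c) := by
  obtain ⟨F, h1, h2⟩ := exists_ind_lift (ρ := fermionsAction)
    (D.isModeRep_fAct hρ).postcomp (LinearMap.toSpanSingleton ℂ _ (sVac B z mix ρ)) (by
      intro y r hy
      refine LinearMap.ext fun c => ?_
      rcases y with y | f
      · rfl
      · change fAct B z mix ρ f (r • sVac B z mix ρ c) = _
        rw [map_smul, fAct_vac f (by cases f <;> exact hy), smul_zero]
        have : extendedAction fermions fermionsAction (.inr f) = 0 := by
          unfold extendedAction; split_ifs <;> rfl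
        rw [this]; simp)
  refine ⟨F, fun c => ?_, fun f b c => ?_⟩
  · rw [fockVac, h1]; simp
  · rw [h2]; rfl

/-- The universal property is used twice: for the Fock space, with values in maps from `C`, and then
for `Ind B ρ`, with values in maps from the Fock space, where the even modes act by their decoupled
versions. -/
theorem exists_tensor_map (D : IsDecoupling B z mix s dir d) (hρ : ρ z = LinearMap.id) :
    ∃ Φ : Ind B ρ ⊗[ℂ] Fock →ₗ[ℂ] SuperInd B z mix ρ,
      (∀ c, Φ (vac B ρ c ⊗ₜ fockVac) = sVac B z mix ρ c) ∧
      (∀ y h b, Φ (act B ρ y h ⊗ₜ b) = D.tilde hρ y (Φ (h ⊗ₜ b))) ∧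
      (∀ f h b, Φ (h ⊗ₜ act fermions fermionsAction (.inr f) b) =
        fAct B z mix ρ f (Φ (h ⊗ₜ b))) := by
  obtain ⟨F, hF, hF'⟩ := D.exists_fock_map hρ
  obtain ⟨G, hG, hG'⟩ := exists_ind_lift (ρ := ρ) (D.isModeRep_tilde hρ).postcomp F.flip (by
    intro y c hy
    refine LinearMap.ext fun b => ?_
    change D.tilde hρ y (F b c) = F b (extendedAction B ρ y c)
    -- Both sides intertwine the fermions in `b`, because decoupled modes commute with them; hence
    -- only the vacuum has to be compared.
    refine ind_induction (S := fermions) (ρ := fermionsAction) (LinearMap.eqLocus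
      (D.tilde hρ y ∘ₗ F.flip c) (F.flip (extendedAction B ρ y c))) (fun r => ?_)
      (fun a b hb => ?_) b
    · change D.tilde hρ y (F _ c) = F _ _
      rw [show vac fermions fermionsAction r = r • fockVac by
        rw [fockVac, ← map_smul, smul_eq_mul, mul_one]]
      simp only [map_smul, LinearMap.smul_apply, hF, D.tilde_vac hρ hy]
    · have hb : D.tilde hρ y (F b c) = F b (extendedAction B ρ y c) := hb
      change D.tilde hρ y (F _ c) = F _ _
      rcases a with ⟨⟩ | f
      · rw [act_unit, hb]
      · rw [hF', hF', D.tilde_fAct, hb])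
  refine ⟨TensorProduct.lift G, fun c => ?_, fun y h b => ?_, fun f h b => ?_⟩
  · rw [TensorProduct.lift.tmul, hG]; exact hF c
  · rw [TensorProduct.lift.tmul, TensorProduct.lift.tmul, hG']; rfl
  · rw [TensorProduct.lift.tmul, TensorProduct.lift.tmul]
    refine ind_induction (LinearMap.eqLocus (G.flip (act fermions fermionsAction (.inr f) b))
      (fAct B z mix ρ f ∘ₗ G.flip b)) (fun c => ?_) (fun y h hh => ?_) h
    · change G _ _ = fAct B z mix ρ f (G _ _)
      rw [hG]; exact hF' f b c
    · have hh : G h (act fermions fermionsAction (.inr f) b) = fAct B z mix ρ f (G h b) := hh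
      change G _ _ = fAct B z mix ρ f (G _ _)
      rw [hG']
      change D.tilde hρ y (G h _) = fAct B z mix ρ f (D.tilde hρ y (G h b))
      rw [hh, D.tilde_fAct]

/-- The modes of the factorized space. -/
theorem exists_tensor_inv (D : IsDecoupling B z mix s dir d) (hρ : ρ z = LinearMap.id) :
    ∃ Ψ : SuperInd B z mix ρ →ₗ[ℂ] Ind B ρ ⊗[ℂ] Fock,
      (∀ c, Ψ (sVac B z mix ρ c) = vac B ρ c ⊗ₜ fockVac) ∧
      (∀ y v, Ψ (D.tilde hρ y v) = (act B ρ y).rTensor Fock (Ψ v)) ∧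
      (∀ f v, Ψ (fAct B z mix ρ f v) = (fockRep.tensor (Ind B ρ)).op f (Ψ v)) := by
  let R := fockRep.tensor (Ind B ρ)
  let Y : ι → Ind B ρ ⊗[ℂ] Fock →ₗ[ℂ] Ind B ρ ⊗[ℂ] Fock := fun y => (act B ρ y).rTensor Fock
  have hcomm : ∀ (f : Fock →ₗ[ℂ] Fock) y v, Y y (f.lTensor (Ind B ρ) v) =
      f.lTensor (Ind B ρ) (Y y v) := fun f y v => by
    have : (act B ρ y).rTensor Fock ∘ₗ f.lTensor (Ind B ρ) =
        f.lTensor (Ind B ρ) ∘ₗ (act B ρ y).rTensor Fock :=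
      TensorProduct.ext' fun a b => rfl
    exact LinearMap.congr_fun this v
  -- The two factors of the tensor product do not interact, so the coupling has strength `0`; the
  -- correction with `r = -1` then raises it to `1`.
  have hmix : MixesBy R Y s dir d 0 := by
    refine ⟨fun y i n v => hcomm _ y v, fun y j n v => ?_⟩
    simp only [zero_mul, zero_smul, Finset.sum_const_zero, add_zero]
    exact hcomm _ y v
  have hY : IsModeRep B Y := by
    intro a b v
    induction v using TensorProduct.induction_on with
    | zero => simp
    | add x y hx hy => simp only [map_add, smul_add, hx, hy]; abel
    | tmul h w =>
      change (act B ρ a (act B ρ b h)) ⊗ₜ[ℂ] w = koszul _ _ • (act B ρ b (act B ρ a h)) ⊗ₜ[ℂ] w + _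
      rw [act_act, TensorProduct.add_tmul, TensorProduct.smul_tmul']
      congr 1
      rw [Finsupp.linearCombination_apply, Finsupp.linearCombination_apply, Finsupp.sum,
        Finsupp.sum, LinearMap.sum_apply, LinearMap.sum_apply, TensorProduct.sum_tmul]
      rfl
  have hz : corrected R Y s dir d (-1) z = LinearMap.id := by
    rw [corrected, D.s_z, mul_zero, zero_smul, add_zero]
    change (act B ρ z).rTensor Fock = _
    rw [D.act_central hρ, LinearMap.rTensor_id]
  have hc := hmix.corrected (-1)
  rw [show (0 : ℂ) - -1 = 1 by norm_num] at hc
  obtain ⟨Ψ, h1, h2⟩ := exists_ind_lift (ρ := withFermionsAction ρ)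
    (D.isModeRep_super hc (D.isModeRep_corrected hmix hY (-1)) hz)
    ((TensorProduct.mk ℂ (Ind B ρ) Fock).flip fockVac ∘ₗ vac B ρ) (by
      intro y c hy
      rcases y with y | f
      · change corrected R Y s dir d (-1) y (vac B ρ c ⊗ₜ fockVac) =
          vac B ρ (extendedAction B ρ y c) ⊗ₜ fockVac
        rw [corrected_apply, fockRep.tensor_bilin]
        change act B ρ y (vac B ρ c) ⊗ₜ fockVac + _ = _
        rw [act_vac B ρ hy]
        by_cases hs : s y = 0
        · rw [hs, mul_zero, zero_smul, add_zero]
        · rw [FermionRep.bilin_eq_zero, TensorProduct.tmul_zero, smul_zero, add_zero]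
          · intro j n hn
            refine fock_deg_nonneg_vac (.psi j n) ?_
            change 0 ≤ 2 * n + 1
            omega
          · have := D.deg_eq y hs
            change 0 ≤ B.deg y at hy
            omega
      · have : extendedAction (withFermions B z mix) (withFermionsAction ρ) (.inr f) = 0 := by
          unfold extendedAction; split_ifs <;> rfl
        rw [this, LinearMap.zero_apply, map_zero]
        change R.op f (vac B ρ c ⊗ₜ fockVac) = 0
        have hv := fock_deg_nonneg_vac f (by cases f <;> exact hy)
        rw [← fockRep_op] at hv
        cases f with
        | psi i n =>
          change vac B ρ c ⊗ₜ fockRep.psi i n fockVac = 0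
          rw [show fockRep.psi i n fockVac = 0 from hv, TensorProduct.tmul_zero]
        | psis i n =>
          change vac B ρ c ⊗ₜ fockRep.psis i n fockVac = 0
          rw [show fockRep.psis i n fockVac = 0 from hv, TensorProduct.tmul_zero])
  have hf : ∀ f v, Ψ (fAct B z mix ρ f v) = R.op f (Ψ v) := fun f v => h2 (.inr f) v
  refine ⟨Ψ, h1, fun y v => ?_, hf⟩
  -- As `Ψ` intertwines the fermions, it intertwines their bilinears. The correction in the
  -- decoupled mode then cancels the opposite one in the target.
  have hq : Ψ ((D.superRep hρ).bilin (dir y) (d y) v) = R.bilin (dir y) (d y) (Ψ v) :=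
    FermionRep.map_bilin (σ := 1) (one_mul 1)
      (fun j n v => by rw [one_smul]; exact hf (.psi j n) v) _ _ v
  have hb : Ψ (bAct B z mix ρ y v) = corrected R Y s dir d (-1) y (Ψ v) := h2 (.inl y) v
  rw [tilde, corrected_apply, map_add, map_smul, hq, hb, corrected_apply, add_assoc, ← add_smul]
  rw [show -1 * s y + 1 * s y = 0 by ring, zero_smul, add_zero]

variable {shift : ι → SuperInd B z mix ρ → SuperInd B z mix ρ}

/-- `Ψ ∘ Φ` intertwines all modes of both factors and fixes `c ⊗ |0⟩`, so it is the identity.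
Surjectivity of `Φ` is checked directly: its range contains `C` and is stable under all modes. -/
theorem exists_factorization (D : IsDecoupling B z mix s dir d) (hρ : ρ z = LinearMap.id)
    (hshift : ∀ y v, shift y v = s y • quad B z mix ρ (dir y) (d y) v) :
    ∃ Φ, IsFactorization B z mix ρ shift Φ := by
  obtain ⟨Φ, h1, h2, h3⟩ := D.exists_tensor_map hρ
  obtain ⟨Ψ, k1, k2, k3⟩ := D.exists_tensor_inv hρ
  have hop : ∀ f x, Φ ((fockRep.tensor (Ind B ρ)).op f x) = fAct B z mix ρ f (Φ x) := by
    intro f x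
    induction x using TensorProduct.induction_on with
    | zero => simp
    | add x y hx hy => simp only [map_add, hx, hy]
    | tmul h b => rw [← h3, ← fockRep_op]; cases f <;> rfl
  have hΨΦ : Ψ ∘ₗ Φ = LinearMap.id := by
    refine TensorProduct.ext' fun h b => ?_
    change Ψ (Φ (h ⊗ₜ b)) = h ⊗ₜ b
    refine ind_induction (LinearMap.eqLocus
      (Ψ ∘ₗ Φ ∘ₗ (TensorProduct.mk ℂ (Ind B ρ) Fock).flip b)
      ((TensorProduct.mk ℂ (Ind B ρ) Fock).flip b)) (fun c => ?_) (fun y h hh => ?_) h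
    · change Ψ (Φ (vac B ρ c ⊗ₜ b)) = vac B ρ c ⊗ₜ b
      refine ind_induction (S := fermions) (ρ := fermionsAction) (LinearMap.eqLocus
        (Ψ ∘ₗ Φ ∘ₗ (TensorProduct.mk ℂ (Ind B ρ) Fock) (vac B ρ c))
        ((TensorProduct.mk ℂ (Ind B ρ) Fock) (vac B ρ c))) (fun r => ?_) (fun y b hb => ?_) b
      · change Ψ (Φ (vac B ρ c ⊗ₜ _)) = vac B ρ c ⊗ₜ _
        rw [show vac fermions fermionsAction r = r • fockVac by
          rw [fockVac, ← map_smul, smul_eq_mul, mul_one]]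
        simp only [TensorProduct.tmul_smul, map_smul, h1, k1]
      · have hb : Ψ (Φ (vac B ρ c ⊗ₜ b)) = vac B ρ c ⊗ₜ b := hb
        change Ψ (Φ (vac B ρ c ⊗ₜ _)) = vac B ρ c ⊗ₜ _
        rcases y with ⟨⟩ | f
        · rw [act_unit, hb]
        · rw [h3, k3, hb, ← fockRep_op]; cases f <;> rfl
    · have hh : Ψ (Φ (h ⊗ₜ b)) = h ⊗ₜ b := hh
      change Ψ (Φ (act B ρ y h ⊗ₜ b)) = act B ρ y h ⊗ₜ b
      rw [h2, k2, hh]; rfl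
  have htilde : ∀ y x, Φ ((act B ρ y).rTensor Fock x) = D.tilde hρ y (Φ x) := by
    intro y x
    induction x using TensorProduct.induction_on with
    | zero => simp
    | add x y hx hy => simp only [map_add, hx, hy]
    | tmul h b => rw [← h2]; rfl
  have hsurj : Function.Surjective Φ := by
    intro v
    refine ind_induction (LinearMap.range Φ) (fun c => ⟨_, h1 c⟩) ?_ v
    rintro (y | f) _ ⟨x, rfl⟩
    -- The original mode is the decoupled mode minus its bilinear, and both have a counterpart on
    -- the tensor product.
    · refine ⟨(act B ρ y).rTensor Fock x - s y • (fockRep.tensor (Ind B ρ)).bilin (dir y) (d y) x,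
        ?_⟩
      rw [map_sub, htilde, map_smul, FermionRep.map_bilin (R' := D.superRep hρ) (σ := 1) (one_mul 1)
        (fun j n v => by rw [one_smul]; exact hop (.psi j n) v), tilde, corrected_apply, one_mul,
        add_sub_cancel_right]
    · exact ⟨_, hop f x⟩
  have hinj : Function.Injective Φ :=
    Function.LeftInverse.injective (g := Ψ) fun x => LinearMap.congr_fun hΨΦ x
  refine ⟨LinearEquiv.ofBijective Φ ⟨hinj, hsurj⟩, h1, fun y h b => ?_, h3⟩
  refine (h2 y h b).trans ?_
  rw [hshift, D.tilde_apply]; rfl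

end IsDecoupling

theorem vac_eq_smul_fockVac (r : ℂ) : vac fermions fermionsAction r = r • fockVac := by
  rw [fockVac, ← map_smul, smul_eq_mul, mul_one]

/-- A subspace of the Fock space that contains the vacuum and is stable under the fermions is
everything. -/
theorem fock_induction (P : Submodule ℂ Fock) (hv : fockVac ∈ P)
    (hf : ∀ f, ∀ b ∈ P, act fermions fermionsAction (.inr f) b ∈ P) (b : Fock) : b ∈ P := by
  refine ind_induction P (fun r => ?_) (fun y b hb => ?_) b
  · rw [vac_eq_smul_fockVac]; exact P.smul_mem r hv
  · rcases y with ⟨⟩ | f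
    · rwa [act_unit]
    · exact hf f b hb

/-! ### Uniqueness of the factorization, parity and degree -/

section Gradings

variable {ι : Type} (S : ModeAlgebra ι) {C : Type} [AddCommGroup C] [Module ℂ C]
  (ρ : ι → C →ₗ[ℂ] C)

theorem act_mem_parityPart (y : ι) {p : Bool} {v : Ind S ρ} (hv : v ∈ parityPart S ρ p) :
    act S ρ y v ∈ parityPart S ρ (xor (S.odd y) p) := by
  refine (Submodule.span_le.2 ?_ :
    parityPart S ρ p ≤ (parityPart S ρ (xor (S.odd y) p)).comap (act S ρ y)) hv
  rintro _ ⟨l, c, rfl, rfl⟩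
  exact Submodule.subset_span ⟨y :: l, c, rfl, rfl⟩

theorem act_mem_degPart (y : ι) {e : ℤ} {v : Ind S ρ} (hv : v ∈ degPart S ρ e) :
    act S ρ y v ∈ degPart S ρ (S.deg y + e) := by
  refine (Submodule.span_le.2 ?_ :
    degPart S ρ e ≤ (degPart S ρ (S.deg y + e)).comap (act S ρ y)) hv
  rintro _ ⟨l, c, rfl, rfl⟩
  exact Submodule.subset_span ⟨y :: l, c, by simp, rfl⟩

theorem vac_mem_parityPart (c : C) : vac S ρ c ∈ parityPart S ρ false :=
  Submodule.subset_span ⟨[], c, rfl, rfl⟩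

theorem vac_mem_degPart (c : C) : vac S ρ c ∈ degPart S ρ 0 :=
  Submodule.subset_span ⟨[], c, rfl, rfl⟩

end Gradings

section Factorization

variable {ι : Type} {B : ModeAlgebra ι} {z : ι} {mix : ι → FGen → (FGen →₀ ℂ)}
  {s : ι → ℂ} {dir : ι → Fin 3} {d : ι → ℤ}
  {C : Type} [AddCommGroup C] [Module ℂ C] {ρ : ι → C →ₗ[ℂ] C}
  {shift : ι → SuperInd B z mix ρ → SuperInd B z mix ρ}
  {Φ : (Ind B ρ ⊗[ℂ] Fock) ≃ₗ[ℂ] SuperInd B z mix ρ}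

/-- The conditions fix the map on `c ⊗ |0⟩` and propagate along the modes, first in the Fock factor
over `C`, then in the first factor. -/
theorem IsFactorization.unique {Φ' : (Ind B ρ ⊗[ℂ] Fock) ≃ₗ[ℂ] SuperInd B z mix ρ}
    (h' : IsFactorization B z mix ρ shift Φ') (h : IsFactorization B z mix ρ shift Φ) :
    Φ' = Φ := by
  refine LinearEquiv.toLinearMap_injective (TensorProduct.ext' fun a b => ?_)
  refine ind_induction (LinearMap.eqLocus
    (Φ'.toLinearMap ∘ₗ (TensorProduct.mk ℂ (Ind B ρ) Fock).flip b)
    (Φ.toLinearMap ∘ₗ (TensorProduct.mk ℂ (Ind B ρ) Fock).flip b)) (fun c => ?_)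
    (fun y a ha => ?_) a
  · refine fock_induction (LinearMap.eqLocus
      (Φ'.toLinearMap ∘ₗ (TensorProduct.mk ℂ (Ind B ρ) Fock) (vac B ρ c))
      (Φ.toLinearMap ∘ₗ (TensorProduct.mk ℂ (Ind B ρ) Fock) (vac B ρ c))) ?_ (fun f b hb => ?_) b
    · exact (h'.1 c).trans (h.1 c).symm
    · have hb : Φ' (vac B ρ c ⊗ₜ b) = Φ (vac B ρ c ⊗ₜ b) := hb
      change Φ' (vac B ρ c ⊗ₜ _) = Φ (vac B ρ c ⊗ₜ _)
      rw [h'.2.2, h.2.2, hb]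
  · have ha : Φ' (a ⊗ₜ b) = Φ (a ⊗ₜ b) := ha
    change Φ' (act B ρ y a ⊗ₜ b) = Φ (act B ρ y a ⊗ₜ b)
    rw [h'.2.1, h.2.1, ha]

theorem fAct_mem_parityPart (f : FGen) {p : Bool} {v : SuperInd B z mix ρ}
    (hv : v ∈ parityPart (withFermions B z mix) (withFermionsAction ρ) p) :
    fAct B z mix ρ f v ∈ parityPart (withFermions B z mix) (withFermionsAction ρ) (xor true p) :=
  act_mem_parityPart (withFermions B z mix) (withFermionsAction ρ) (.inr f) hv

theorem IsDecoupling.bAct_mem_parityPart (D : IsDecoupling B z mix s dir d) (y : ι) {p : Bool}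
    {v : SuperInd B z mix ρ}
    (hv : v ∈ parityPart (withFermions B z mix) (withFermionsAction ρ) p) :
    bAct B z mix ρ y v ∈ parityPart (withFermions B z mix) (withFermionsAction ρ) p := by
  have := act_mem_parityPart (withFermions B z mix) (withFermionsAction ρ) (.inl y) hv
  rwa [show (withFermions B z mix).odd (.inl y) = false from D.even y, Bool.false_xor] at this

theorem fAct_mem_degPart (f : FGen) {e : ℤ} {v : SuperInd B z mix ρ}
    (hv : v ∈ degPart (withFermions B z mix) (withFermionsAction ρ) e) :
    fAct B z mix ρ f v ∈ degPart (withFermions B z mix) (withFermionsAction ρ)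
      ((withFermions B z mix).deg (.inr f) + e) :=
  act_mem_degPart (withFermions B z mix) (withFermionsAction ρ) (.inr f) hv

theorem bAct_mem_degPart (y : ι) {e : ℤ} {v : SuperInd B z mix ρ}
    (hv : v ∈ degPart (withFermions B z mix) (withFermionsAction ρ) e) :
    bAct B z mix ρ y v ∈ degPart (withFermions B z mix) (withFermionsAction ρ) (B.deg y + e) :=
  act_mem_degPart (withFermions B z mix) (withFermionsAction ρ) (.inl y) hv

namespace IsDecoupling

theorem factorization_tilde (D : IsDecoupling B z mix s dir d) (hρ : ρ z = LinearMap.id)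
    (hshift : ∀ y v, shift y v = s y • quad B z mix ρ (dir y) (d y) v)
    (hΦ : IsFactorization B z mix ρ shift Φ) (y : ι) (h : Ind B ρ) (b : Fock) :
    D.tilde hρ y (Φ (h ⊗ₜ b)) = Φ (act B ρ y h ⊗ₜ b) := by
  rw [hΦ.2.1, hshift, D.tilde_apply]

theorem factorization_bilin (D : IsDecoupling B z mix s dir d) (hρ : ρ z = LinearMap.id)
    (hΦ : IsFactorization B z mix ρ shift Φ) (i : Fin 3) (m : ℤ) (h : Ind B ρ) (b : Fock) :
    (D.superRep hρ).bilin i m (Φ (h ⊗ₜ b)) = Φ (h ⊗ₜ fockRep.bilin i m b) :=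
  (FermionRep.map_bilin (R := fockRep) (R' := D.superRep hρ) (σ := 1) (one_mul 1)
    (f := Φ.toLinearMap ∘ₗ TensorProduct.mk ℂ (Ind B ρ) Fock h)
    (fun j n v => by rw [one_smul]; exact hΦ.2.2 (.psi j n) h v) i m b).symm

/-- The original modes become sums of operators acting on one factor only. Gradings and forms are
compared through this formula. -/
theorem factorization_bAct (D : IsDecoupling B z mix s dir d) (hρ : ρ z = LinearMap.id)
    (hshift : ∀ y v, shift y v = s y • quad B z mix ρ (dir y) (d y) v)
    (hΦ : IsFactorization B z mix ρ shift Φ) (y : ι) (h : Ind B ρ) (b : Fock) :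
    bAct B z mix ρ y (Φ (h ⊗ₜ b)) =
      Φ (act B ρ y h ⊗ₜ b) - s y • Φ (h ⊗ₜ fockRep.bilin (dir y) (d y) b) := by
  rw [← D.factorization_tilde hρ hshift hΦ, ← D.factorization_bilin hρ hΦ, tilde, corrected_apply,
    one_mul, add_sub_cancel_right]

theorem bilin_mem_parityPart (D : IsDecoupling B z mix s dir d) (hρ : ρ z = LinearMap.id)
    (i : Fin 3) (m : ℤ) {p : Bool} {v : SuperInd B z mix ρ}
    (hv : v ∈ parityPart (withFermions B z mix) (withFermionsAction ρ) p) :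
    (D.superRep hρ).bilin i m v ∈ parityPart (withFermions B z mix) (withFermionsAction ρ) p := by
  refine FermionRep.bilin_mem _ i m fun j k n => ?_
  have h := act_mem_parityPart (withFermions B z mix) (withFermionsAction ρ) (.inr (.psi j n))
    (act_mem_parityPart _ _ (.inr (.psi k (m - n - 1))) hv)
  change _ ∈ parityPart _ _ (xor true (xor true p)) at h
  rwa [show xor true (xor true p) = p by cases p <;> rfl] at h

theorem bilin_mem_degPart (D : IsDecoupling B z mix s dir d) (hρ : ρ z = LinearMap.id)
    (i : Fin 3) (m : ℤ) {e : ℤ} {v : SuperInd B z mix ρ}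
    (hv : v ∈ degPart (withFermions B z mix) (withFermionsAction ρ) e) :
    (D.superRep hρ).bilin i m v ∈
      degPart (withFermions B z mix) (withFermionsAction ρ) (2 * m + e) := by
  refine FermionRep.bilin_mem _ i m fun j k n => ?_
  have h := act_mem_degPart (withFermions B z mix) (withFermionsAction ρ) (.inr (.psi j n))
    (act_mem_degPart _ _ (.inr (.psi k (m - n - 1))) hv)
  change _ ∈ degPart _ _ ((2 * n + 1) + ((2 * (m - n - 1) + 1) + e)) at h
  rwa [show (2 * n + 1) + ((2 * (m - n - 1) + 1) + e) = 2 * m + e by ring] at h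

theorem _root_.SuperLoop.fock_bilin_mem_parityPart (i : Fin 3) (m : ℤ) {p : Bool} {b : Fock}
    (hb : b ∈ parityPart fermions fermionsAction p) :
    fockRep.bilin i m b ∈ parityPart fermions fermionsAction p :=
  isDecoupling_fermions.bilin_mem_parityPart (C := ℂ) (ρ := fun _ => LinearMap.id) rfl i m hb

theorem _root_.SuperLoop.fock_bilin_mem_degPart (i : Fin 3) (m : ℤ) {e : ℤ} {b : Fock}
    (hb : b ∈ degPart fermions fermionsAction e) :
    fockRep.bilin i m b ∈ degPart fermions fermionsAction (2 * m + e) :=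
  isDecoupling_fermions.bilin_mem_degPart (C := ℂ) (ρ := fun _ => LinearMap.id) rfl i m hb

/-- Corrections are products of two odd modes, hence even. So decoupled modes preserve the parity of
the super space, and original modes preserve the parity of the Fock factor; each fact yields one
inclusion by induction on words. -/
theorem preserves_parity (D : IsDecoupling B z mix s dir d) (hρ : ρ z = LinearMap.id)
    (hshift : ∀ y v, shift y v = s y • quad B z mix ρ (dir y) (d y) v)
    (hΦ : IsFactorization B z mix ρ shift Φ) (p : Bool) :
    Submodule.span ℂ {v | ∃ h, ∃ b ∈ parityPart fermions fermionsAction p, v = Φ (h ⊗ₜ b)} =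
      parityPart (withFermions B z mix) (withFermionsAction ρ) p := by
  apply le_antisymm
  · refine Submodule.span_le.2 ?_
    rintro _ ⟨h, b, hb, rfl⟩
    refine ind_induction ((parityPart (withFermions B z mix) (withFermionsAction ρ) p).comap
      (Φ.toLinearMap ∘ₗ (TensorProduct.mk ℂ (Ind B ρ) Fock).flip b)) (fun c => ?_)
      (fun y h hh => ?_) h
    · refine (Submodule.span_le.2 ?_ : parityPart fermions fermionsAction p ≤
        (parityPart (withFermions B z mix) (withFermionsAction ρ) p).comap
          (Φ.toLinearMap ∘ₗ TensorProduct.mk ℂ (Ind B ρ) Fock (vac B ρ c))) hb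
      clear hb b
      rintro _ ⟨l, r, rfl, rfl⟩
      refine (?_ : Φ (vac B ρ c ⊗ₜ word fermions fermionsAction l r) ∈
        parityPart (withFermions B z mix) (withFermionsAction ρ) _)
      induction l with
      | nil =>
        refine (?_ : Φ (vac B ρ c ⊗ₜ vac fermions fermionsAction r) ∈
          parityPart (withFermions B z mix) (withFermionsAction ρ) false)
        rw [vac_eq_smul_fockVac, TensorProduct.tmul_smul, map_smul, hΦ.1]
        exact Submodule.smul_mem _ _ (vac_mem_parityPart _ _ c)
      | cons a l ih =>
        rw [List.foldr_cons]
        refine (?_ : Φ (vac B ρ c ⊗ₜ act fermions fermionsAction a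
          (word fermions fermionsAction l r)) ∈
          parityPart (withFermions B z mix) (withFermionsAction ρ) _)
        rcases a with ⟨⟩ | f
        · rw [act_unit, show fermions.odd (.inl ()) = false from rfl, Bool.false_xor]
          exact ih
        · rw [hΦ.2.2]
          exact fAct_mem_parityPart f ih
    · have hh : Φ (h ⊗ₜ b) ∈ parityPart (withFermions B z mix) (withFermionsAction ρ) p := hh
      refine (?_ : Φ (act B ρ y h ⊗ₜ b) ∈
        parityPart (withFermions B z mix) (withFermionsAction ρ) p)
      rw [← D.factorization_tilde hρ hshift hΦ, tilde, corrected_apply]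
      refine Submodule.add_mem _ ?_ (Submodule.smul_mem _ _ (D.bilin_mem_parityPart hρ _ _ hh))
      exact D.bAct_mem_parityPart y hh
  · refine Submodule.span_le.2 ?_
    rintro _ ⟨l, c, rfl, rfl⟩
    induction l with
    | nil =>
      exact Submodule.subset_span ⟨vac B ρ c, fockVac, vac_mem_parityPart _ _ 1, (hΦ.1 c).symm⟩
    | cons a l ih =>
      set q := List.foldr (fun y b => ((withFermions B z mix).odd y).xor b) false l with hq
      change act _ _ a (word _ _ l c) ∈ Submodule.span ℂ {v | ∃ h, ∃ b ∈ parityPart fermions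
        fermionsAction (xor ((withFermions B z mix).odd a) q), v = Φ (h ⊗ₜ b)}
      rcases a with y | f
      · change _ ∈ Submodule.span ℂ {v | ∃ h, ∃ b ∈ parityPart fermions
          fermionsAction (xor (B.odd y) q), v = Φ (h ⊗ₜ b)}
        rw [D.even, Bool.false_xor]
        refine (Submodule.span_le.2 ?_ : Submodule.span ℂ _ ≤
          (Submodule.span ℂ _).comap (bAct B z mix ρ y)) ih
        rintro _ ⟨h, b, hb, rfl⟩
        change bAct B z mix ρ y (Φ (h ⊗ₜ b)) ∈ Submodule.span ℂ _
        rw [D.factorization_bAct hρ hshift hΦ]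
        refine Submodule.sub_mem _ (Submodule.subset_span ⟨_, _, hb, rfl⟩)
          (Submodule.smul_mem _ _ (Submodule.subset_span ⟨_, _, ?_, rfl⟩))
        exact fock_bilin_mem_parityPart _ _ hb
      · refine (Submodule.span_le.2 ?_ : Submodule.span ℂ _ ≤
          (Submodule.span ℂ _).comap (fAct B z mix ρ f)) ih
        rintro _ ⟨h, b, hb, rfl⟩
        change fAct B z mix ρ f (Φ (h ⊗ₜ b)) ∈ Submodule.span ℂ _
        rw [← hΦ.2.2]
        exact Submodule.subset_span ⟨_, _, act_mem_parityPart fermions fermionsAction (.inr f) hb, rfl⟩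

theorem preserves_degree (D : IsDecoupling B z mix s dir d) (hρ : ρ z = LinearMap.id)
    (hshift : ∀ y v, shift y v = s y • quad B z mix ρ (dir y) (d y) v)
    (hΦ : IsFactorization B z mix ρ shift Φ) (e : ℤ) :
    Submodule.span ℂ {v | ∃ d₁ d₂ : ℤ, d₁ + d₂ = e ∧ ∃ h ∈ degPart B ρ d₁,
      ∃ b ∈ degPart fermions fermionsAction d₂, v = Φ (h ⊗ₜ b)} =
      degPart (withFermions B z mix) (withFermionsAction ρ) e := by
  -- The number `d y` is tied to the degree only for modes that are really corrected; for the others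
  -- the bilinear has coefficient zero.
  have hdeg : ∀ y, s y = 0 ∨ B.deg y = 2 * d y := fun y => or_iff_not_imp_left.2 (D.deg_eq y)
  have hfdeg : ∀ f, fermions.deg (.inr f) = (withFermions B z mix).deg (.inr f) :=
    fun f => by cases f <;> rfl
  apply le_antisymm
  · refine Submodule.span_le.2 ?_
    rintro _ ⟨d₁, d₂, rfl, h, hh, b, hb, rfl⟩
    refine (Submodule.span_le.2 ?_ : degPart B ρ d₁ ≤
      (degPart (withFermions B z mix) (withFermionsAction ρ) (d₁ + d₂)).comap
      (Φ.toLinearMap ∘ₗ (TensorProduct.mk ℂ (Ind B ρ) Fock).flip b)) hh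
    clear hh h
    rintro _ ⟨l, c, rfl, rfl⟩
    refine (?_ : Φ (word B ρ l c ⊗ₜ b) ∈
      degPart (withFermions B z mix) (withFermionsAction ρ) _)
    induction l with
    | nil =>
      refine (Submodule.span_le.2 ?_ : degPart fermions fermionsAction d₂ ≤
        (degPart (withFermions B z mix) (withFermionsAction ρ) _).comap
          (Φ.toLinearMap ∘ₗ TensorProduct.mk ℂ (Ind B ρ) Fock (vac B ρ c))) hb
      clear hb b
      rintro _ ⟨l, r, rfl, rfl⟩
      refine (?_ : Φ (vac B ρ c ⊗ₜ word fermions fermionsAction l r) ∈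
        degPart (withFermions B z mix) (withFermionsAction ρ) _)
      induction l with
      | nil =>
        refine (?_ : Φ (vac B ρ c ⊗ₜ vac fermions fermionsAction r) ∈
          degPart (withFermions B z mix) (withFermionsAction ρ) _)
        rw [vac_eq_smul_fockVac, TensorProduct.tmul_smul, map_smul, hΦ.1]
        exact Submodule.smul_mem _ _ (vac_mem_degPart _ _ c)
      | cons a l ih =>
        refine (?_ : Φ (vac B ρ c ⊗ₜ act fermions fermionsAction a
          (word fermions fermionsAction l r)) ∈
          degPart (withFermions B z mix) (withFermionsAction ρ) _)
        rw [List.map_nil, List.sum_nil, zero_add] at ih ⊢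
        rw [List.map_cons, List.sum_cons]
        rcases a with ⟨⟩ | f
        · rw [act_unit]
          change _ ∈ degPart _ _ (0 + _)
          rwa [zero_add]
        · rw [hΦ.2.2, hfdeg]
          exact fAct_mem_degPart f ih
    | cons y l ih =>
      refine (?_ : Φ (act B ρ y (word B ρ l c) ⊗ₜ b) ∈
        degPart (withFermions B z mix) (withFermionsAction ρ) _)
      rw [← D.factorization_tilde hρ hshift hΦ, tilde, corrected_apply, List.map_cons,
        List.sum_cons, add_assoc]
      refine Submodule.add_mem _ (bAct_mem_degPart y ih) ?_
      rcases hdeg y with hs | hs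
      · rw [hs, mul_zero, zero_smul]; exact Submodule.zero_mem _
      · rw [hs]; exact Submodule.smul_mem _ _ (D.bilin_mem_degPart hρ _ _ ih)
  · refine Submodule.span_le.2 ?_
    rintro _ ⟨l, c, rfl, rfl⟩
    induction l with
    | nil =>
      exact Submodule.subset_span ⟨0, 0, rfl, vac B ρ c, vac_mem_degPart _ _ c, fockVac,
        vac_mem_degPart _ _ 1, (hΦ.1 c).symm⟩
    | cons a l ih =>
      rw [List.map_cons, List.sum_cons]
      generalize (l.map (withFermions B z mix).deg).sum = q at ih ⊢
      change act _ _ a (word _ _ l c) ∈ Submodule.span ℂ _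
      refine (Submodule.span_le.2 ?_ : Submodule.span ℂ _ ≤
        (Submodule.span ℂ _).comap (act (withFermions B z mix) (withFermionsAction ρ) a)) ih
      rintro _ ⟨d₁, d₂, rfl, h, hh, b, hb, rfl⟩
      rcases a with y | f
      · change bAct B z mix ρ y (Φ (h ⊗ₜ b)) ∈ Submodule.span ℂ _
        rw [D.factorization_bAct hρ hshift hΦ]
        refine Submodule.sub_mem _ (Submodule.subset_span ⟨B.deg y + d₁, d₂, add_assoc _ _ _,
          _, act_mem_degPart B ρ y hh, _, hb, rfl⟩) ?_
        rcases hdeg y with hs | hs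
        · rw [hs, zero_smul]; exact Submodule.zero_mem _
        · refine Submodule.smul_mem _ _ (Submodule.subset_span ⟨d₁, 2 * d y + d₂, ?_, _, hh, _,
            fock_bilin_mem_degPart _ _ hb, rfl⟩)
          change _ = B.deg y + _
          rw [hs]; ring
      · change fAct B z mix ρ f (Φ (h ⊗ₜ b)) ∈ Submodule.span ℂ _
        rw [← hΦ.2.2, ← hfdeg]
        exact Submodule.subset_span ⟨d₁, _, add_left_comm _ _ _, _, hh, _,
          act_mem_degPart fermions fermionsAction (.inr f) hb, rfl⟩

theorem preservesGradings (D : IsDecoupling B z mix s dir d) (hρ : ρ z = LinearMap.id)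
    (hshift : ∀ y v, shift y v = s y • quad B z mix ρ (dir y) (d y) v)
    (hΦ : IsFactorization B z mix ρ shift Φ) : PreservesGradings B z mix ρ Φ :=
  ⟨D.preserves_parity hρ hshift hΦ, D.preserves_degree hρ hshift hΦ⟩

end IsDecoupling

end Factorization

/-! ### Hilbert space completions -/

theorem completesToHilbertTensor {A F H : Type} [AddCommGroup A] [Module ℂ A] [AddCommGroup F]
    [Module ℂ F] [AddCommGroup H] [Module ℂ H] (Φ : (A ⊗[ℂ] F) ≃ₗ[ℂ] H) :
    CompletesToHilbertTensor Φ := by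
  intro K L _ _ _ _ _ _ jA jF hA dA hF dF
  let c : K ⊗[ℂ] L →ₗ[ℂ] UniformSpace.Completion (K ⊗[ℂ] L) :=
    (UniformSpace.Completion.toComplL (𝕜 := ℂ)).toLinearMap
  refine ⟨c ∘ₗ TensorProduct.map jA jF ∘ₗ Φ.symm.toLinearMap, ⟨fun a b => ?_, ?_, ?_⟩, ?_⟩
  · change c (TensorProduct.map jA jF (Φ.symm (Φ (a ⊗ₜ b)))) = _
    rw [Φ.symm_apply_apply, TensorProduct.map_tmul]; rfl
  · have h1 : Function.Injective c := UniformSpace.Completion.coe_injective _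
    -- Over a field all modules are flat, so the tensor product of injective maps is injective.
    exact h1.comp ((TensorProduct.map_injective_of_flat_flat _ _ hA hF).comp Φ.symm.injective)
  -- The closure of the range is a subspace, and by joint continuity of `⊗ₜ` it contains all pure
  -- tensors.
  · have hd : DenseRange (TensorProduct.map jA jF) := by
      have hcl : ∀ x : K ⊗[ℂ] L,
          x ∈ (LinearMap.range (TensorProduct.map jA jF)).topologicalClosure := by
        intro x
        induction x using TensorProduct.induction_on with
        | zero => exact Submodule.zero_mem _
        | add x y hx hy => exact Submodule.add_mem _ hx hy
        | tmul k l =>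
          have hkl := map_mem_closure (TensorProduct.continuous_tmul (𝕜 := ℂ) (E := K) (F := L))
            (dA.prodMap dF (k, l))
            (t := (LinearMap.range (TensorProduct.map jA jF) : Set (K ⊗[ℂ] L)))
            (by rintro _ ⟨⟨a, b⟩, rfl⟩; exact ⟨a ⊗ₜ b, rfl⟩)
          exact hkl
      intro x
      exact hcl x
    have h2 : DenseRange c := UniformSpace.Completion.denseRange_coe
    have h3 := h2.comp hd (UniformSpace.Completion.continuous_coe _)
    refine h3.mono ?_
    rintro _ ⟨x, rfl⟩
    exact ⟨Φ x, by change c (TensorProduct.map jA jF (Φ.symm (Φ x))) = _; rw [Φ.symm_apply_apply]; rfl⟩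
  · rintro j ⟨hj, -, -⟩
    refine LinearMap.ext fun v => ?_
    obtain ⟨x, rfl⟩ := Φ.surjective v
    have : j ∘ₗ Φ.toLinearMap = c ∘ₗ TensorProduct.map jA jF :=
      TensorProduct.ext' fun a b => hj a b
    refine (LinearMap.congr_fun this x).trans ?_
    change _ = c (TensorProduct.map jA jF (Φ.symm (Φ x)))
    rw [Φ.symm_apply_apply]; rfl

/-! ### Contravariant forms -/

/-- The adjoint of a creation mode has positive degree and kills `C`, so `C` is orthogonal to all
images of creation modes. This determines the pairing of `C` with any vector; modes on the left are
then moved to the right. -/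
theorem IsContravariant.unique {ι : Type} {S : ModeAlgebra ι} {C : Type} [AddCommGroup C]
    [Module ℂ C] {ρ : ι → C →ₗ[ℂ] C} {pair : C → C → ℂ} {dag : ι → ι} {sgn : ι → ℝ}
    (hS : IsHomogeneous S) (hdag : ∀ y, dag (dag y) = y) (hdeg : ∀ y, S.deg (dag y) = -S.deg y)
    (hsgn : ∀ y, sgn y ≠ 0) {h h' : Ind S ρ →ₗ⋆[ℂ] Ind S ρ →ₗ[ℂ] ℂ}
    (H : IsContravariant S ρ pair dag sgn h) (H' : IsContravariant S ρ pair dag sgn h') :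
    h' = h := by
  have key : ∀ {k : Ind S ρ →ₗ⋆[ℂ] Ind S ρ →ₗ[ℂ] ℂ}, IsContravariant S ρ pair dag sgn k →
      ∀ y, S.deg y < 0 → ∀ c w, k (vac S ρ c) (act S ρ y w) = 0 := by
    intro k hk y hy c w
    have e := hk.2 (dag y) (vac S ρ c) w
    rw [act_vac_pos S ρ (by rw [hdeg]; omega), hdag, map_zero, LinearMap.zero_apply] at e
    exact (mul_eq_zero.1 e.symm).resolve_left (by exact_mod_cast hsgn _)
  have hvac : ∀ c w, h' (vac S ρ c) w = h (vac S ρ c) w := by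
    intro c w
    refine ind_neg_induction hS (LinearMap.eqLocus (h' (vac S ρ c)) (h (vac S ρ c)))
      (fun e => ?_) (fun y hy w _ => ?_) w
    · exact (H'.1 c e).trans (H.1 c e).symm
    · exact (key H' y hy c w).trans (key H y hy c w).symm
  let P : Submodule ℂ (Ind S ρ) :=
    { carrier := {v | ∀ w, h' v w = h v w}
      add_mem' := fun {a b} ha hb w => by
        simp only [map_add, LinearMap.add_apply]; rw [ha w, hb w]
      zero_mem' := fun w => by simp only [map_zero]
      smul_mem' := fun r a ha w => by
        simp only [LinearMap.map_smulₛₗ, LinearMap.smul_apply]; rw [ha w] }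
  refine LinearMap.ext fun v => LinearMap.ext fun w => ?_
  refine ind_induction P hvac (fun y v hv w => ?_) v w
  rw [H.2, H'.2, hv]

/-- Taking adjoints reverses the order of the two factors and negates their degrees. Interchanging
`j` and `k` in `ε_{ijk}` produces the minus sign. -/
theorem ContravariantF.bilin {hf : Fock →ₗ⋆[ℂ] Fock →ₗ[ℂ] ℂ} (H : ContravariantF hf) (i : Fin 3)
    (m : ℤ) (b b' : Fock) :
    hf (fockRep.bilin i m b) b' = -hf b (fockRep.bilin i (-m) b') := by
  have hpsi : ∀ j n b b', hf (fockRep.psi j n b) b' = hf b (fockRep.psi j (-n - 1) b') := by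
    intro j n b b'
    refine (H.2 (.inr (.psi j n)) b b').trans ?_
    rw [Complex.ofReal_one, one_mul]; rfl
  -- The form is conjugate-linear in its first argument, so the sum is taken out through an additive
  -- map.
  let g : Fock →+ ℂ :=
    { toFun := fun b => hf b b'
      map_zero' := by rw [map_zero, LinearMap.zero_apply]
      map_add' := fun x y => by rw [map_add, LinearMap.add_apply] }
  have key : ∀ j k, hf (∑ᶠ n : ℤ, fockRep.psi j n (fockRep.psi k (m - n - 1) b)) b' =
      hf b (∑ᶠ n : ℤ, fockRep.psi k n (fockRep.psi j (-m - n - 1) b')) := by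
    intro j k
    rw [map_finsum _ (fockRep.finite_support k j (-m) b')]
    refine (g.map_finsum (fockRep.finite_support j k m b)).trans ?_
    -- After the shift of `n` by `m` the adjoint modes carry the indices `n` and `-m - n - 1`, as in
    -- the bilinear of degree `-m`.
    rw [← finsum_comp_equiv (Equiv.addRight m)]
    refine finsum_congr fun n => ?_
    change hf (fockRep.psi j (n + m) (fockRep.psi k (m - (n + m) - 1) b)) b' = _
    rw [hpsi, hpsi, show -(m - (n + m) - 1) - 1 = n by ring, show -(n + m) - 1 = -m - n - 1 by ring]
  simp only [FermionRep.bilin_apply, map_sum, LinearMap.sum_apply, map_smul, LinearMap.map_smulₛₗ,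
    LinearMap.smul_apply, key, Complex.conj_ofReal]
  rw [Finset.sum_comm, ← Finset.sum_neg_distrib]
  refine Finset.sum_congr rfl fun k _ => ?_
  rw [← Finset.sum_neg_distrib]
  refine Finset.sum_congr rfl fun j _ => ?_
  rw [eps_swap_right i k j, Complex.ofReal_neg, neg_smul]

/-- The product of two sesquilinear forms. -/
def prodForm {A F : Type} [AddCommGroup A] [Module ℂ A] [AddCommGroup F] [Module ℂ F]
    (hb : A →ₗ⋆[ℂ] A →ₗ[ℂ] ℂ) (hf : F →ₗ⋆[ℂ] F →ₗ[ℂ] ℂ) :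
    (A ⊗[ℂ] F) →ₗ⋆[ℂ] (A ⊗[ℂ] F) →ₗ[ℂ] ℂ :=
  (TensorProduct.lift (TensorProduct.mapBilinear (.id ℂ) A F ℂ ℂ)).compr₂ (.mul' ℂ ℂ) ∘ₛₗ
    TensorProduct.map hb hf

theorem prodForm_tmul {A F : Type} [AddCommGroup A] [Module ℂ A] [AddCommGroup F] [Module ℂ F]
    (hb : A →ₗ⋆[ℂ] A →ₗ[ℂ] ℂ) (hf : F →ₗ⋆[ℂ] F →ₗ[ℂ] ℂ) (a a' : A) (b b' : F) :
    prodForm hb hf (a ⊗ₜ b) (a' ⊗ₜ b') = hb a a' * hf b b' := rfl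

theorem fermionDag_fermionDag (f : FGen) : fermionDag (fermionDag f) = f := by
  rcases f with ⟨i, n⟩ | ⟨i, n⟩ <;> simp [fermionDag]

variable {ι : Type} {B : ModeAlgebra ι} {z : ι} {mix : ι → FGen → (FGen →₀ ℂ)}
  {s : ι → ℂ} {dir : ι → Fin 3} {d : ι → ℤ}
  {C : Type} [AddCommGroup C] [Module ℂ C] {ρ : ι → C →ₗ[ℂ] C}
  {shift : ι → SuperInd B z mix ρ → SuperInd B z mix ρ}
  {Φ : (Ind B ρ ⊗[ℂ] Fock) ≃ₗ[ℂ] SuperInd B z mix ρ}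

/-- The form is the product form transported by `Φ`. An original even mode is its action on the
first factor minus `s y` times a bilinear; the adjoint of the latter is given by
`ContravariantF.bilin`, and `hs` is the resulting compatibility of `s` with the signs. -/
theorem IsDecoupling.contravariant (D : IsDecoupling B z mix s dir d) (hρ : ρ z = LinearMap.id)
    (hshift : ∀ y v, shift y v = s y • quad B z mix ρ (dir y) (d y) v)
    (hΦ : IsFactorization B z mix ρ shift Φ) {pair : C → C → ℂ} {dag : ι → ι} {sgn : ι → ℝ}
    (hdag : ∀ y, dag (dag y) = y) (hdeg : ∀ y, B.deg (dag y) = -B.deg y)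
    (hsgn : ∀ y, sgn y ≠ 0) (hdir : ∀ y, dir (dag y) = dir y) (hd : ∀ y, d (dag y) = -d y)
    (hs : ∀ y, (starRingEnd ℂ) (s y) = -(sgn y * s (dag y)))
    {hb : Ind B ρ →ₗ⋆[ℂ] Ind B ρ →ₗ[ℂ] ℂ} (Hb : IsContravariant B ρ pair dag sgn hb)
    {hf : Fock →ₗ⋆[ℂ] Fock →ₗ[ℂ] ℂ} (Hf : ContravariantF hf) :
    ∃ h, IsContravariant (withFermions B z mix) (withFermionsAction ρ) pair
        (Sum.map dag fermionDag) (Sum.elim sgn (fun _ => 1)) h ∧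
      (∀ h', IsContravariant (withFermions B z mix) (withFermionsAction ρ) pair
        (Sum.map dag fermionDag) (Sum.elim sgn (fun _ => 1)) h' → h' = h) ∧
      ∀ a a' b b', h (Φ (a ⊗ₜ b)) (Φ (a' ⊗ₜ b')) = hb a a' * hf b b' := by
  let h : SuperInd B z mix ρ →ₗ⋆[ℂ] SuperInd B z mix ρ →ₗ[ℂ] ℂ :=
    ((prodForm hb hf).compl₂ Φ.symm.toLinearMap).comp Φ.symm.toLinearMap
  have hh : ∀ x x', h (Φ x) (Φ x') = prodForm hb hf x x' := by
    intro x x'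
    change prodForm hb hf (Φ.symm (Φ x)) (Φ.symm (Φ x')) = _
    rw [Φ.symm_apply_apply, Φ.symm_apply_apply]
  have ht : ∀ a a' b b', h (Φ (a ⊗ₜ b)) (Φ (a' ⊗ₜ b')) = hb a a' * hf b b' :=
    fun a a' b b' => (hh _ _).trans (prodForm_tmul _ _ _ _ _ _)
  have hc : IsContravariant (withFermions B z mix) (withFermionsAction ρ) pair
      (Sum.map dag fermionDag) (Sum.elim sgn (fun _ => 1)) h := by
    constructor
    · intro c c'
      have h1 := ht (vac B ρ c) (vac B ρ c') fockVac fockVac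
      rw [hΦ.1, hΦ.1] at h1
      refine h1.trans ?_
      rw [Hb.1, fockVac, Hf.1]; simp
    · intro y v w
      obtain ⟨x, rfl⟩ := Φ.surjective v
      obtain ⟨x', rfl⟩ := Φ.surjective w
      induction x using TensorProduct.induction_on with
      | zero => simp only [map_zero, LinearMap.zero_apply, mul_zero]
      | add x₁ x₂ h₁ h₂ => simp only [map_add, LinearMap.add_apply, h₁, h₂, mul_add]
      | tmul a b =>
        induction x' using TensorProduct.induction_on with
        | zero => simp only [map_zero, mul_zero]
        | add x₁ x₂ h₁ h₂ => simp only [map_add, h₁, h₂, mul_add]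
        | tmul a' b' =>
          rcases y with y | f
          · refine (?_ : h (bAct B z mix ρ y (Φ (a ⊗ₜ b))) (Φ (a' ⊗ₜ b')) =
              (sgn y : ℂ) * h (Φ (a ⊗ₜ b)) (bAct B z mix ρ (dag y) (Φ (a' ⊗ₜ b'))))
            rw [D.factorization_bAct hρ hshift hΦ, D.factorization_bAct hρ hshift hΦ, map_sub,
              map_sub, LinearMap.sub_apply, LinearMap.map_smulₛₗ, LinearMap.smul_apply, map_smul,
              ht, ht, ht, ht, Hb.2, Hf.bilin, hs, hdir, hd, smul_eq_mul, smul_eq_mul]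
            ring
          · refine (?_ : h (fAct B z mix ρ f (Φ (a ⊗ₜ b))) (Φ (a' ⊗ₜ b')) =
              ((1 : ℝ) : ℂ) * h (Φ (a ⊗ₜ b)) (fAct B z mix ρ (fermionDag f) (Φ (a' ⊗ₜ b'))))
            rw [← hΦ.2.2, ← hΦ.2.2, ht, ht, Hf.2]
            simp only [Sum.map_inr]
            ring
  refine ⟨h, hc, fun h' hc' => hc.unique D.homogeneous_super ?_ ?_ ?_ hc', ht⟩
  · rintro (y | f)
    · simp [hdag]
    · simp [fermionDag_fermionDag]
  · rintro (y | (⟨i, n⟩ | ⟨i, n⟩))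
    · exact hdeg y
    · change 2 * (-n - 1) + 1 = -(2 * n + 1); ring
    · change 2 * (-n - 1) + 1 = -(2 * n + 1); ring
  · rintro (y | f)
    · exact hsgn y
    · exact one_ne_zero

/-! ### Normally ordered products -/

section Fields

variable {H : Type} [AddCommGroup H] [Module ℂ H]

/-- The coefficients are linear, and on every vector the powers of `z` are bounded below. -/
structure IsField (A : LogField H) : Prop where
  linear : ∀ p q, IsLinearMap ℂ (A p q)
  bounded : ∀ v, ∃ N : ℤ, ∀ p q, p < N → A p q v = 0

/-- Linear modes, on every vector only finitely many of which with `n ≥ 0` do not vanish. -/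
structure IsModes (a : ℤ → H → H) : Prop where
  linear : ∀ n, IsLinearMap ℂ (a n)
  bounded : ∀ v, ∃ N : ℤ, ∀ n, N ≤ n → a n v = 0

variable {a : ℤ → H → H} {A : LogField H}

theorem isField_idField : IsField (idField : LogField H) where
  linear p q := ⟨fun v w => by unfold idField; split_ifs <;> simp,
    fun r v => by unfold idField; split_ifs <;> simp⟩
  bounded v := ⟨0, fun p q hp => if_neg fun h => by omega⟩

/-- For very negative `n` the exponent `p + n + 1 + k` lies below the bound of `A` on `v`; for large
`n` the mode `a n` kills `v`. -/
theorem nprod_finite_support (ha : IsModes a) (hA : IsField A) (σ : ℂ) (k : ℕ) (p : ℤ) (q : ℕ)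
    (v : H) : (Function.support fun n : ℤ => ((Ring.choose (-n - 1) k : ℤ) : ℂ) •
      (if n < 0 then a n (A (p + n + 1 + k) q v) else σ • A (p + n + 1 + k) q (a n v))).Finite := by
  obtain ⟨N, hN⟩ := hA.bounded v
  obtain ⟨N', hN'⟩ := ha.bounded v
  refine (Set.finite_Icc (min (N - p - 1 - k) 0) (max N' 0)).subset fun n hn => ?_
  by_contra hc
  refine hn ?_
  simp only [Set.mem_Icc, not_and_or, not_le] at hc
  simp only
  split_ifs with h0
  · rw [hN _ _ (by omega), (ha.linear n).map_zero, smul_zero]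
  · rw [hN' n (by omega), (hA.linear _ _).map_zero, smul_zero, smul_zero]

theorem IsField.nprod (ha : IsModes a) (hA : IsField A) (σ : ℂ) (k : ℕ) :
    IsField (nprod σ a k A) where
  linear p q := by
    refine ⟨fun v w => ?_, fun r v => ?_⟩
    · unfold SuperLoop.nprod
      rw [← finsum_add_distrib (nprod_finite_support ha hA σ k p q v)
        (nprod_finite_support ha hA σ k p q w)]
      refine finsum_congr fun n => ?_
      rw [← smul_add]
      congr 1
      split_ifs
      · rw [(hA.linear _ _).map_add, (ha.linear n).map_add]
      · rw [(ha.linear n).map_add, (hA.linear _ _).map_add, smul_add]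
    · unfold SuperLoop.nprod
      rw [smul_finsum]
      refine finsum_congr fun n => ?_
      rw [smul_comm]
      congr 1
      split_ifs
      · rw [(hA.linear _ _).map_smul, (ha.linear n).map_smul]
      · rw [(ha.linear n).map_smul, (hA.linear _ _).map_smul, smul_comm]
  bounded v := by
    obtain ⟨N, hN⟩ := hA.bounded v
    obtain ⟨N', hN'⟩ := ha.bounded v
    -- For `0 ≤ n < N'` the field is applied to the finitely many vectors `a n v`, each with its own
    -- bound; `M` is a common one.
    choose f hf using fun n => hA.bounded (a n v)
    obtain ⟨M, hM⟩ := ((Finset.Ico 0 N').image f).bddBelow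
    refine ⟨min (N - k) (M - N' - 1 - k), fun p q hp => ?_⟩
    unfold SuperLoop.nprod
    refine (finsum_congr fun n => ?_).trans finsum_zero
    split_ifs with h0
    · rw [hN _ _ (by omega), (ha.linear n).map_zero, smul_zero]
    · by_cases hn : N' ≤ n
      · rw [hN' n hn, (hA.linear _ _).map_zero, smul_zero, smul_zero]
      · have := hM (Finset.mem_coe.2 (Finset.mem_image_of_mem f
          (Finset.mem_Ico.2 ⟨not_lt.1 h0, not_le.1 hn⟩)))
        rw [hf n _ _ (by omega), smul_zero, smul_zero]

theorem nprod_commute (ha : IsModes a) (hA : IsField A) (σ : ℂ) (k : ℕ) {T : H → H}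
    (hT : IsLinearMap ℂ T) (h1 : ∀ n v, T (a n v) = a n (T v))
    (h2 : ∀ p q v, T (A p q v) = A p q (T v)) (p : ℤ) (q : ℕ) (v : H) :
    T (nprod σ a k A p q v) = nprod σ a k A p q (T v) := by
  unfold nprod
  refine (map_finsum (hT.mk' T) (nprod_finite_support ha hA σ k p q v)).trans ?_
  refine finsum_congr fun n => ?_
  rw [map_smul]
  congr 1
  split_ifs
  · rw [IsLinearMap.mk'_apply, h1, h2]
  · rw [map_smul, IsLinearMap.mk'_apply, h2, h1]

/-- On the vacuum the modes with `n ≥ 0` vanish, the binomial coefficient removes `-k - 1 < n < 0`,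
and regularity of `A` removes `n < -k - 1` at `z^0`. What remains is `a_{-k-1} v` with coefficient
`1`. -/
theorem Creates.nprod (ha : IsModes a) {σ : ℂ} {k : ℕ} {Ω v : H} (hΩ : ∀ n, 0 ≤ n → a n Ω = 0)
    (hA : IsField A) (h : Creates Ω v A) :
    Creates Ω (a (-(k : ℤ) - 1) v) (nprod σ a k A) := by
  -- Here `-n - 1` is a natural number smaller than `k`.
  have hchoose : ∀ n : ℤ, n < 0 → -(k : ℤ) - 1 < n → Ring.choose (-n - 1) k = 0 := by
    intro n h0 hn
    obtain ⟨m, hm⟩ := Int.eq_ofNat_of_zero_le (show 0 ≤ -n - 1 by omega)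
    rw [hm, Ring.choose_natCast, Nat.choose_eq_zero_of_lt (by omega),
      Nat.cast_zero]
  have hz : ∀ (p : ℤ) (q : ℕ) (n : ℤ), (p < 0 ∨ 0 < q ∨ (n ≠ -(k : ℤ) - 1 ∧ p = 0)) →
      ((Ring.choose (-n - 1) k : ℤ) : ℂ) • (if n < 0 then a n (A (p + n + 1 + k) q Ω)
        else σ • A (p + n + 1 + k) q (a n Ω)) = 0 := by
    intro p q n hpq
    split_ifs with h0
    · by_cases hn : -(k : ℤ) - 1 < n
      · rw [hchoose n h0 hn, Int.cast_zero, zero_smul]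
      · rw [h.2 _ _ (by omega), (ha.linear n).map_zero, smul_zero]
    · rw [hΩ n (by omega), (hA.linear _ _).map_zero, smul_zero, smul_zero]
  constructor
  · unfold SuperLoop.nprod
    rw [finsum_eq_single _ (-(k : ℤ) - 1) fun n hn => hz 0 0 n (.inr (.inr ⟨hn, rfl⟩)),
      if_pos (by omega), show (0 : ℤ) + (-(k : ℤ) - 1) + 1 + k = 0 by ring, h.1,
      show -(-(k : ℤ) - 1) - 1 = (k : ℕ) by ring, Ring.choose_natCast, Nat.choose_self]
    simp
  · intro p q hpq
    unfold SuperLoop.nprod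
    exact (finsum_congr fun n => hz p q n (by omega)).trans finsum_zero

variable {κ : Type} {cur : κ → ℤ → H → H} {o : Bool} {base : H → LogField H → Prop}

theorem StateField.isField (hcur : ∀ x, IsModes (cur x)) (hbase : ∀ v A, base v A → IsField A)
    {p : Bool} {v : H} {A : LogField H} (h : StateField cur o base p v A) : IsField A := by
  induction h with
  | base v A h => exact hbase v A h
  | current x k p v A _ ih => exact ih.nprod (hcur x) _ k
  | add p v w A B _ _ ih1 ih2 =>
    refine ⟨fun p q => ⟨fun v w => ?_, fun r v => ?_⟩, fun v => ?_⟩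
    · simp only [Pi.add_apply, (ih1.linear p q).map_add, (ih2.linear p q).map_add]; abel
    · simp only [Pi.add_apply, (ih1.linear p q).map_smul, (ih2.linear p q).map_smul, smul_add]
    · obtain ⟨N, hN⟩ := ih1.bounded v
      obtain ⟨M, hM⟩ := ih2.bounded v
      refine ⟨min N M, fun p q hp => ?_⟩
      simp only [Pi.add_apply]
      rw [hN _ _ (by omega), hM _ _ (by omega), add_zero]
  | smul p r v A _ ih =>
    refine ⟨fun p q => ⟨fun v w => ?_, fun r' v => ?_⟩, fun v => ?_⟩
    · simp only [Pi.smul_apply, (ih.linear p q).map_add, smul_add]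
    · simp only [Pi.smul_apply, (ih.linear p q).map_smul]; rw [smul_comm]
    · obtain ⟨N, hN⟩ := ih.bounded v
      refine ⟨N, fun p q hp => ?_⟩
      simp only [Pi.smul_apply]
      rw [hN _ _ hp, smul_zero]

theorem StateField.commute (hcur : ∀ x, IsModes (cur x)) (hbase : ∀ v A, base v A → IsField A)
    {T : H → H} (hT : IsLinearMap ℂ T) (h1 : ∀ x n v, T (cur x n v) = cur x n (T v))
    (h2 : ∀ v A, base v A → ∀ p q w, T (A p q w) = A p q (T w))
    {p : Bool} {v : H} {A : LogField H} (h : StateField cur o base p v A) :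
    ∀ p q w, T (A p q w) = A p q (T w) := by
  induction h with
  | base v A h => exact h2 v A h
  | current x k p v A h ih =>
    exact nprod_commute (hcur x) (h.isField hcur hbase) _ k hT (h1 x) ih
  | add p v w A B _ _ ih1 ih2 =>
    intro p q w
    simp only [Pi.add_apply, hT.map_add, ih1, ih2]
  | smul p r v A _ ih =>
    intro p q w
    simp only [Pi.smul_apply, hT.map_smul, ih]

theorem StateField.creates (hcur : ∀ x, IsModes (cur x)) (hbase : ∀ v A, base v A → IsField A)
    {Ω : H} (hΩ : ∀ x n, 0 ≤ n → cur x n Ω = 0) (h2 : ∀ v A, base v A → Creates Ω v A)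
    {p : Bool} {v : H} {A : LogField H} (h : StateField cur o base p v A) : Creates Ω v A := by
  induction h with
  | base v A h => exact h2 v A h
  | current x k p v A h ih => exact ih.nprod (hcur x) (hΩ x) (h.isField hcur hbase)
  | add p v w A B _ _ ih1 ih2 =>
    refine ⟨?_, fun p q hpq => ?_⟩
    · simp only [Pi.add_apply, ih1.1, ih2.1]
    · simp only [Pi.add_apply, ih1.2 p q hpq, ih2.2 p q hpq, add_zero]
  | smul p r v A _ ih =>
    refine ⟨?_, fun p q hpq => ?_⟩
    · simp only [Pi.smul_apply, ih.1]
    · simp only [Pi.smul_apply, ih.2 p q hpq, smul_zero]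

end Fields

/-! ### Fields of functions -/

/-- A bound for the degree of the part of a term on the right. -/
def Term.rdeg (t : Term) : ℤ := max 0 (-t.zexp)

theorem finite_terms (N : ℕ) : {t : Term | t.zexp.natAbs ≤ N}.Finite := by
  -- A term is encoded by its constructor, its indices and its mode number; only the mode number is
  -- unbounded.
  let f : Term → Fin 5 × Fin 3 × Fin 3 × Fin 3 × ℤ := fun t => match t with
    | .x i n => (0, i, 0, 0, n.1)
    | .xlog i => (1, i, 0, 0, 0)
    | .xs i n => (2, i, 0, 0, n.1)
    | .xslog i => (3, i, 0, 0, 0)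
    | .mixed i j k n => (4, i, j, k, n.1)
  have hf : Function.Injective f := by
    rintro (⟨i, n⟩ | i | ⟨i, n⟩ | i | ⟨i, j, k, n⟩) (⟨i', n'⟩ | i' | ⟨i', n'⟩ | i' | ⟨i', j', k', n'⟩)
      h <;> simp [f] at h ⊢ <;> simp [Subtype.ext_iff, h]
  have hfin : (Set.univ ×ˢ Set.univ ×ˢ Set.univ ×ˢ Set.univ ×ˢ Set.Icc (-(N : ℤ)) N :
      Set (Fin 5 × Fin 3 × Fin 3 × Fin 3 × ℤ)).Finite :=
    Set.finite_univ.prod (Set.finite_univ.prod (Set.finite_univ.prod (Set.finite_univ.prod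
      (Set.finite_Icc _ _))))
  refine (hfin.preimage hf.injOn).subset ?_
  rintro t ht
  simp only [Set.mem_preimage, Set.mem_prod, Set.mem_univ, true_and, Set.mem_Icc]
  rcases t with ⟨i, n⟩ | i | ⟨i, n⟩ | i | ⟨i, j, k, n⟩ <;>
    simp only [Set.mem_ofPred_eq, Term.zexp, f] at ht ⊢ <;> omega

/-- Since zero modes are excluded from the terms, every term involves a power of `z` or a logarithm.
So the total weight bounds the length of a sequence of terms. -/
theorem Term.one_le_weight (t : Term) : 1 ≤ t.zexp.natAbs + t.lexp := by
  rcases t with ⟨i, n⟩ | i | ⟨i, n⟩ | i | ⟨i, j, k, n⟩ <;> simp only [Term.zexp, Term.lexp]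
  · have := n.2; omega
  · omega
  · have := n.2; omega
  · omega
  · omega

theorem finite_lists (N : ℕ) :
    {l : List Term | (l.map fun t => t.zexp.natAbs + t.lexp).sum ≤ N}.Finite := by
  induction N with
  | zero =>
    refine (Set.finite_singleton []).subset ?_
    rintro (_ | ⟨t, l⟩) h
    · rfl
    · have := t.one_le_weight
      simp only [Set.mem_ofPred_eq, List.map_cons, List.sum_cons] at h
      omega
  | succ N ih =>
    refine ((Set.finite_singleton []).union
      (Set.Finite.image2 List.cons (finite_terms (N + 1)) ih)).subset ?_
    rintro (_ | ⟨t, l⟩) h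
    · exact .inl rfl
    · have := t.one_le_weight
      simp only [Set.mem_ofPred_eq, List.map_cons, List.sum_cons] at h
      exact .inr ⟨t, by simp only [Set.mem_ofPred_eq]; omega, l,
        by simp only [Set.mem_ofPred_eq]; omega, rfl⟩

/-- From `|a| = a + 2 max(0, -a)`: the weight of a sequence is determined by its exponents and by
the degree that its annihilating part raises, which is bounded on a given vector. -/
theorem sum_natAbs_zexp (l : List Term) :
    (((l.map fun t => t.zexp.natAbs + t.lexp).sum : ℕ) : ℤ) =
      (l.map Term.zexp).sum + 2 * (l.map Term.rdeg).sum + ((l.map Term.lexp).sum : ℕ) := by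
  induction l with
  | nil => simp
  | cons t l ih =>
    have : (t.zexp.natAbs : ℤ) = t.zexp + 2 * t.rdeg := by unfold Term.rdeg; omega
    simp only [List.map_cons, List.sum_cons, Nat.cast_add] at ih ⊢
    rw [ih, this]; ring

theorem sum_zexp_ge (l : List Term) : -(l.map Term.rdeg).sum ≤ (l.map Term.zexp).sum := by
  induction l with
  | nil => simp
  | cons t l ih =>
    have : -t.rdeg ≤ t.zexp := by unfold Term.rdeg; omega
    simp only [List.map_cons, List.sum_cons]; omega

theorem symPartial_nil {H C : Type} [AddCommGroup C] [Module ℂ C] (O : ExpansionOps H C) (f : C) :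
    symPartial O [] f = f := by
  simp [symPartial]

section FunctionFields

variable {H C : Type} [AddCommGroup H] [Module ℂ H] {O : ExpansionOps H C}

/-- Operators that are linear and compatible with a filtration by degree. -/
structure ExpansionOps.IsGraded (O : ExpansionOps H C) (F : ℤ → Submodule ℂ H) : Prop where
  pos : ∀ e, 0 < e → ∀ v ∈ F e, v = 0
  exhaustive : ∀ v, ∃ e, v ∈ F e
  left_linear : ∀ t : Term, IsLinearMap ℂ (t.left O)
  right_linear : ∀ t : Term, IsLinearMap ℂ (t.right O)
  mul_linear : ∀ g, IsLinearMap ℂ (O.mul g)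
  right_mem : ∀ (t : Term) (e : ℤ), ∀ v ∈ F e, t.right O v ∈ F (e + 2 * t.rdeg)

theorem foldr_right_mem {F : ℤ → Submodule ℂ H} (hO : O.IsGraded F) (l : List Term)
    {e : ℤ} {v : H} (hv : v ∈ F e) :
    l.foldr (fun t w => t.right O w) v ∈ F (e + 2 * (l.map Term.rdeg).sum) := by
  induction l with
  | nil => simpa using hv
  | cons t l ih =>
    have := hO.right_mem t _ _ ih
    simp only [List.map_cons, List.sum_cons, List.foldr_cons]
    convert this using 2
    ring

variable [AddCommGroup C] [Module ℂ C]

/-- The summand of the field of `f` that belongs to a sequence of terms. -/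
def fieldSummand (O : ExpansionOps H C) (f : C) (l : List Term) (v : H) : H :=
  ((l.map Term.coeff).prod / (l.length.factorial : ℂ)) •
    l.foldr (fun t w => t.left O w)
      (O.mul (symPartial O l f) (l.foldr (fun t w => t.right O w) v))

theorem functionField_eq (f : C) (p : ℤ) (q : ℕ) (v : H) : functionField O f p q v =
    ∑ᶠ l : {l : List Term // (l.map Term.zexp).sum = p ∧ (l.map Term.lexp).sum = q},
      fieldSummand O f l.1 v := rfl

theorem foldr_isLinearMap {T : Term → H → H} (hT : ∀ t, IsLinearMap ℂ (T t)) (l : List Term) :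
    IsLinearMap ℂ fun v => l.foldr (fun t w => T t w) v := by
  induction l with
  | nil => exact ⟨fun _ _ => rfl, fun _ _ => rfl⟩
  | cons t l ih =>
    refine ⟨fun v w => ?_, fun r v => ?_⟩
    · simp only [List.foldr_cons]; rw [ih.map_add, (hT t).map_add]
    · simp only [List.foldr_cons]; rw [ih.map_smul, (hT t).map_smul]

variable {F : ℤ → Submodule ℂ H}

theorem fieldSummand_isLinearMap (hO : O.IsGraded F) (f : C) (l : List Term) :
    IsLinearMap ℂ (fieldSummand O f l) := by
  have h1 := foldr_isLinearMap hO.right_linear l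
  have h2 := foldr_isLinearMap hO.left_linear l
  have h3 := hO.mul_linear (symPartial O l f)
  refine ⟨fun v w => ?_, fun r v => ?_⟩
  · unfold fieldSummand
    rw [h1.map_add, h3.map_add, h2.map_add, smul_add]
  · unfold fieldSummand
    rw [h1.map_smul, h3.map_smul, h2.map_smul, smul_comm]

theorem fieldSummand_eq_zero (hO : O.IsGraded F) (f : C) (l : List Term) {e : ℤ} {v : H}
    (hv : v ∈ F e) (h : 0 < e + 2 * (l.map Term.rdeg).sum) : fieldSummand O f l v = 0 := by
  unfold fieldSummand
  rw [hO.pos _ h _ (foldr_right_mem hO l hv), (hO.mul_linear _).map_zero,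
    (foldr_isLinearMap hO.left_linear l).map_zero, smul_zero]

theorem functionField_finite_support (hO : O.IsGraded F) (f : C) (p : ℤ) (q : ℕ) (v : H) :
    (Function.support fun l : {l : List Term // (l.map Term.zexp).sum = p ∧
      (l.map Term.lexp).sum = q} => fieldSummand O f l.1 v).Finite := by
  obtain ⟨e, he⟩ := hO.exhaustive v
  -- If `R` is the total of `rdeg`, a nonzero summand needs `e + 2R ≤ 0`, so its weight `p + 2R + q`
  -- is at most `p - e + q`.
  refine ((finite_lists (p - e + q).toNat).preimage Subtype.val_injective.injOn).subset ?_
  rintro ⟨l, hl⟩ hs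
  simp only [Set.mem_preimage, Set.mem_ofPred_eq]
  have h : ¬ 0 < e + 2 * (l.map Term.rdeg).sum := fun h =>
    hs (fieldSummand_eq_zero hO f l he h)
  have h2 := sum_natAbs_zexp l
  rw [hl.1, hl.2] at h2
  omega

theorem isField_functionField (hO : O.IsGraded F) (f : C) : IsField (functionField O f) where
  linear p q := by
    refine ⟨fun v w => ?_, fun r v => ?_⟩
    · rw [functionField_eq, functionField_eq, functionField_eq, ← finsum_add_distrib
        (functionField_finite_support hO f p q v) (functionField_finite_support hO f p q w)]
      exact finsum_congr fun l => (fieldSummand_isLinearMap hO f l.1).map_add v w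
    · rw [functionField_eq, functionField_eq, smul_finsum]
      exact finsum_congr fun l => (fieldSummand_isLinearMap hO f l.1).map_smul r v
  bounded v := by
    obtain ⟨e, he⟩ := hO.exhaustive v
    -- For `p < min e 0` the total `R ≥ -p` of `rdeg` exceeds both `-e` and `0`, whence `e + 2R >
    -- 0`.
    refine ⟨min e 0, fun p q hp => ?_⟩
    rw [functionField_eq]
    refine (finsum_congr fun l => ?_).trans finsum_zero
    refine fieldSummand_eq_zero hO f l.1 he ?_
    have := sum_zexp_ge l.1
    rw [l.2.1] at this
    omega

theorem functionField_commute (hO : O.IsGraded F) {T : H → H} (hT : IsLinearMap ℂ T)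
    (h1 : ∀ (t : Term) v, T (t.left O v) = t.left O (T v))
    (h2 : ∀ (t : Term) v, T (t.right O v) = t.right O (T v))
    (h3 : ∀ g v, T (O.mul g v) = O.mul g (T v)) (f : C) (p : ℤ) (q : ℕ) (v : H) :
    T (functionField O f p q v) = functionField O f p q (T v) := by
  rw [functionField_eq, functionField_eq]
  refine (map_finsum (hT.mk' T) (functionField_finite_support hO f p q v)).trans ?_
  refine finsum_congr fun l => ?_
  have k : ∀ {S : Term → H → H}, (∀ t v, T (S t v) = S t (T v)) → ∀ (l : List Term) v,
      T (l.foldr (fun t w => S t w) v) = l.foldr (fun t w => S t w) (T v) := by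
    intro S hS l v
    induction l with
    | nil => rfl
    | cons t l ih => simp only [List.foldr_cons]; rw [hS, ih]
  unfold fieldSummand
  rw [map_smul, IsLinearMap.mk'_apply, k h1, h3, k h2]

/-- On the vacuum a term either vanishes or is a pure creation term, with a positive power of `z`
and no logarithm. So no negative power or logarithm survives, and only the empty sequence
contributes to `z^0`. -/
theorem creates_functionField (hO : O.IsGraded F) {Ω : H} (f : C)
    (h : ∀ t : Term, t.right O Ω = 0 ∨ (t.right O Ω = Ω ∧ 0 < t.zexp ∧ t.lexp = 0)) :
    Creates Ω (O.mul f Ω) (functionField O f) := by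
  have key : ∀ l : List Term, l.foldr (fun t w => t.right O w) Ω = 0 ∨
      (0 ≤ (l.map Term.zexp).sum ∧ (l ≠ [] → 0 < (l.map Term.zexp).sum) ∧
        (l.map Term.lexp).sum = 0 ∧ l.foldr (fun t w => t.right O w) Ω = Ω) := by
    intro l
    induction l with
    | nil => exact .inr ⟨le_rfl, fun h => absurd rfl h, rfl, rfl⟩
    | cons t l ih =>
      simp only [List.foldr_cons, List.map_cons, List.sum_cons]
      rcases ih with ih | ⟨i1, -, i3, i4⟩
      · rw [ih, (hO.right_linear t).map_zero]; exact .inl rfl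
      · rw [i4]
        rcases h t with h | ⟨j1, j2, j3⟩
        · exact .inl h
        · exact .inr ⟨by omega, fun _ => by omega, by omega, j1⟩
  have hz : ∀ l : List Term, l.foldr (fun t w => t.right O w) Ω = 0 → fieldSummand O f l Ω = 0 := by
    intro l hl
    unfold fieldSummand
    rw [hl, (hO.mul_linear _).map_zero, (foldr_isLinearMap hO.left_linear l).map_zero, smul_zero]
  constructor
  · rw [functionField_eq, finsum_eq_single _ ⟨[], rfl, rfl⟩]
    · simp [fieldSummand, symPartial_nil]
    · rintro ⟨l, hl⟩ hne
      refine hz l ?_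
      rcases key l with k | ⟨-, k, -⟩
      · exact k
      · have := k fun hl => hne (Subtype.ext hl)
        omega
  · intro p q hpq
    rw [functionField_eq]
    refine (finsum_congr fun l => ?_).trans finsum_zero
    refine hz l.1 ?_
    have := l.2.1
    have := l.2.2
    rcases key l.1 with k | ⟨k1, -, k3, -⟩
    · exact k
    · omega

end FunctionFields

section Expansion

variable {H C : Type} [AddCommGroup H] [Module ℂ H] {O : ExpansionOps H C}

theorem ExpansionOps.isGraded {F : ℤ → Submodule ℂ H} (hpos : ∀ e, 0 < e → ∀ v ∈ F e, v = 0)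
    (hex : ∀ v, ∃ e, v ∈ F e)
    (hx : ∀ i n, n ≠ 0 → IsLinearMap ℂ (O.x i n)) (hw : ∀ i, IsLinearMap ℂ (O.w i))
    (hy : ∀ i n, n ≠ 0 → IsLinearMap ℂ (O.y i n)) (hd : ∀ i, IsLinearMap ℂ (O.d i))
    (hmul : ∀ g, IsLinearMap ℂ (O.mul g))
    (hx' : ∀ i n, n ≠ 0 → ∀ e, ∀ v ∈ F e, O.x i n v ∈ F (e + 2 * n))
    (hw' : ∀ i e, ∀ v ∈ F e, O.w i v ∈ F e)
    (hy' : ∀ i n, n ≠ 0 → ∀ e, ∀ v ∈ F e, O.y i n v ∈ F (e + 2 * n))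
    (hd' : ∀ i e, ∀ v ∈ F e, O.d i v ∈ F e) : O.IsGraded F where
  pos := hpos
  exhaustive := hex
  mul_linear := hmul
  left_linear t := by
    have hid : IsLinearMap ℂ fun v : H => v := ⟨fun _ _ => rfl, fun _ _ => rfl⟩
    rcases t with ⟨i, n⟩ | i | ⟨i, n⟩ | i | ⟨i, j, k, n⟩ <;> unfold Term.left <;> simp only
    · split_ifs
      exacts [hx i n n.2, hid]
    · exact hid
    · split_ifs
      exacts [hy i n n.2, hid]
    · exact hid
    · split_ifs
      exacts [hx k n n.2, hid]
  right_linear t := by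
    have hid : IsLinearMap ℂ fun v : H => v := ⟨fun _ _ => rfl, fun _ _ => rfl⟩
    rcases t with ⟨i, n⟩ | i | ⟨i, n⟩ | i | ⟨i, j, k, n⟩ <;> unfold Term.right <;> simp only
    · split_ifs
      exacts [hid, hx i n n.2]
    · exact hw i
    · split_ifs
      exacts [hid, hy i n n.2]
    · exact hd i
    · split_ifs
      · exact hw j
      · refine ⟨fun v w => ?_, fun r v => ?_⟩
        · rw [(hx k n n.2).map_add, (hw j).map_add]
        · rw [(hx k n n.2).map_smul, (hw j).map_smul]
  right_mem t e v hv := by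
    have hneg : ∀ n : ℤ, n < 0 → v ∈ F (e + 2 * max 0 (- -n)) := fun n hn => by
      rwa [max_eq_left (by omega), mul_zero, add_zero]
    rcases t with ⟨i, n⟩ | i | ⟨i, n⟩ | i | ⟨i, j, k, n⟩ <;>
      simp only [Term.right, Term.rdeg, Term.zexp, neg_zero, max_self, mul_zero, add_zero]
    · split_ifs with h
      · exact hneg n h
      · rw [neg_neg, max_eq_right (by omega)]; exact hx' i n n.2 e v hv
    · exact hw' i e v hv
    · split_ifs with h
      · exact hneg n h
      · rw [neg_neg, max_eq_right (by omega)]; exact hy' i n n.2 e v hv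
    · exact hd' i e v hv
    · split_ifs with h
      · exact hw' j _ v (hneg n h)
      · rw [neg_neg, max_eq_right (by omega)]; exact hw' j _ _ (hx' k n n.2 e v hv)

end Expansion

section Terms

variable {H C : Type} {O : ExpansionOps H C}

theorem Term.left_commute {T : H → H} (hx : ∀ i n, n ≠ 0 → ∀ v, T (O.x i n v) = O.x i n (T v))
    (hy : ∀ i n, n ≠ 0 → ∀ v, T (O.y i n v) = O.y i n (T v)) (t : Term) (v : H) :
    T (t.left O v) = t.left O (T v) := by
  rcases t with ⟨i, n⟩ | i | ⟨i, n⟩ | i | ⟨i, j, k, n⟩ <;> simp only [Term.left]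
  · split_ifs
    exacts [hx i n n.2 v, rfl]
  · split_ifs
    exacts [hy i n n.2 v, rfl]
  · split_ifs
    exacts [hx k n n.2 v, rfl]

theorem Term.right_commute {T : H → H} (hx : ∀ i n, n ≠ 0 → ∀ v, T (O.x i n v) = O.x i n (T v))
    (hw : ∀ i v, T (O.w i v) = O.w i (T v))
    (hy : ∀ i n, n ≠ 0 → ∀ v, T (O.y i n v) = O.y i n (T v))
    (hd : ∀ i v, T (O.d i v) = O.d i (T v)) (t : Term) (v : H) :
    T (t.right O v) = t.right O (T v) := by
  rcases t with ⟨i, n⟩ | i | ⟨i, n⟩ | i | ⟨i, j, k, n⟩ <;> simp only [Term.right]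
  · split_ifs
    exacts [rfl, hx i n n.2 v]
  · exact hw i v
  · split_ifs
    exacts [rfl, hy i n n.2 v]
  · exact hd i v
  · split_ifs
    · exact hw j v
    · rw [hw, hx k n n.2]

theorem Term.right_vacuum [AddCommGroup H] {Ω : H} (hx : ∀ i n, 0 < n → O.x i n Ω = 0)
    (hw : ∀ i, O.w i Ω = 0)
    (hw0 : ∀ i, O.w i 0 = 0) (hy : ∀ i n, 0 < n → O.y i n Ω = 0) (hd : ∀ i, O.d i Ω = 0)
    (t : Term) : t.right O Ω = 0 ∨ (t.right O Ω = Ω ∧ 0 < t.zexp ∧ t.lexp = 0) := by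
  have hn : ∀ n : {n : ℤ // n ≠ 0}, ¬ n.1 < 0 → 0 < n.1 := fun n h => by
    have := n.2; omega
  rcases t with ⟨i, n⟩ | i | ⟨i, n⟩ | i | ⟨i, j, k, n⟩ <;>
    simp only [Term.right, Term.zexp, Term.lexp]
  · split_ifs with h
    · exact .inr ⟨rfl, by omega, by trivial⟩
    · exact .inl (hx i n (hn n h))
  · exact .inl (hw i)
  · split_ifs with h
    · exact .inr ⟨rfl, by omega, by trivial⟩
    · exact .inl (hy i n (hn n h))
  · exact .inl (hd i)
  · split_ifs with h
    · exact .inl (hw j)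
    · rw [hx k n (hn n h)]; exact .inl (hw0 j)

end Terms

/-! ### The degree filtration and fermionic fields on super-induced modules -/

section Super

variable {ι : Type} {B : ModeAlgebra ι} {z : ι} {mix : ι → FGen → (FGen →₀ ℂ)}
  {s : ι → ℂ} {dir : ι → Fin 3} {d : ι → ℤ}
  {C : Type} [AddCommGroup C] [Module ℂ C] {ρ : ι → C →ₗ[ℂ] C}
  {shift : ι → SuperInd B z mix ρ → SuperInd B z mix ρ}
  {Φ : (Ind B ρ ⊗[ℂ] Fock) ≃ₗ[ℂ] SuperInd B z mix ρ}

/-- The degree filtration of the induced module of an extension by fermions. -/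
abbrev sFilt (B : ModeAlgebra ι) (z : ι) (mix : ι → FGen → (FGen →₀ ℂ)) (ρ : ι → C →ₗ[ℂ] C)
    (e : ℤ) : Submodule ℂ (SuperInd B z mix ρ) :=
  filt (withFermions B z mix) (withFermionsAction ρ) e

theorem IsDecoupling.fAct_mem_filt (D : IsDecoupling B z mix s dir d) (f : FGen) {e : ℤ}
    {v : SuperInd B z mix ρ} (hv : v ∈ sFilt B z mix ρ e) :
    fAct B z mix ρ f v ∈ sFilt B z mix ρ (e + (withFermions B z mix).deg (.inr f)) :=
  act_mem_filt (withFermionsAction ρ) D.homogeneous_super (.inr f) hv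

theorem IsDecoupling.tilde_mem_filt (D : IsDecoupling B z mix s dir d) (hρ : ρ z = LinearMap.id)
    (y : ι) {e : ℤ} {v : SuperInd B z mix ρ} (hv : v ∈ sFilt B z mix ρ e) :
    D.tilde hρ y v ∈ sFilt B z mix ρ (e + B.deg y) := by
  rw [tilde, corrected_apply]
  refine Submodule.add_mem _
    (act_mem_filt (withFermionsAction ρ) D.homogeneous_super (.inl y) hv) ?_
  by_cases hs : s y = 0
  · rw [hs, mul_zero, zero_smul]; exact Submodule.zero_mem _
  · refine Submodule.smul_mem _ _ (FermionRep.bilin_mem _ _ _ fun j k n => ?_)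
    have h := D.fAct_mem_filt (.psi j n) (D.fAct_mem_filt (.psi k (d y - n - 1)) hv)
    have e1 : e + (withFermions B z mix).deg (.inr (.psi k (d y - n - 1))) +
        (withFermions B z mix).deg (.inr (.psi j n)) = e + B.deg y := by
      rw [D.deg_eq y hs]
      change e + (2 * (d y - n - 1) + 1) + (2 * n + 1) = _
      ring
    rw [e1] at h
    exact h

theorem IsDecoupling.sFilt_pos {e : ℤ} (he : 0 < e) {v : SuperInd B z mix ρ}
    (hv : v ∈ sFilt B z mix ρ e) : v = 0 :=
  filt_pos (withFermions B z mix) (withFermionsAction ρ) he hv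

theorem IsDecoupling.exists_mem_sFilt (D : IsDecoupling B z mix s dir d)
    (v : SuperInd B z mix ρ) : ∃ e, v ∈ sFilt B z mix ρ e :=
  exists_mem_filt D.homogeneous_super v

/-! ### States with a fermionic field -/

/-- The modes of the fermionic fields. -/
abbrev fermionCur (B : ModeAlgebra ι) (z : ι) (mix : ι → FGen → (FGen →₀ ℂ)) (ρ : ι → C →ₗ[ℂ] C)
    (a : Fin 3 × Bool) (n : ℤ) (v : SuperInd B z mix ρ) : SuperInd B z mix ρ :=
  fAct B z mix ρ (fermionMode a n) v

/-- The fermionic state-field correspondence generated from the state `Ω`. -/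
abbrev FermionState (B : ModeAlgebra ι) (z : ι) (mix : ι → FGen → (FGen →₀ ℂ))
    (ρ : ι → C →ₗ[ℂ] C) (Ω : SuperInd B z mix ρ) :
    Bool → SuperInd B z mix ρ → LogField (SuperInd B z mix ρ) → Prop :=
  StateField (fermionCur B z mix ρ) true (fun v A => v = Ω ∧ A = idField)

theorem deg_fermionMode (a : Fin 3 × Bool) (n : ℤ) :
    (withFermions B z mix).deg (.inr (fermionMode a n)) = 2 * n + 1 := by
  rcases a with ⟨i, _ | _⟩ <;> rfl

theorem exists_fermionMode (f : FGen) : ∃ a n, f = fermionMode a n := by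
  cases f with
  | psi i n => exact ⟨(i, false), n, rfl⟩
  | psis i n => exact ⟨(i, true), n, rfl⟩

theorem fermionCur_vac (c : C) (a : Fin 3 × Bool) (n : ℤ) (hn : 0 ≤ n) :
    fermionCur B z mix ρ a n (sVac B z mix ρ c) = 0 :=
  fAct_vac _ (by rw [deg_fermionMode]; omega) c

theorem IsDecoupling.isModes_fermionCur (D : IsDecoupling B z mix s dir d) (a : Fin 3 × Bool) :
    IsModes (fermionCur B z mix ρ a) where
  linear n := (fAct B z mix ρ (fermionMode a n)).isLinear
  bounded v := by
    obtain ⟨e, he⟩ := exists_act_eq_zero D.homogeneous_super v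
    refine ⟨|e|, fun n hn => he _ ?_⟩
    rw [deg_fermionMode]
    have := le_abs_self e
    have := abs_nonneg e
    omega

theorem isField_of_eq_idField {Ω : SuperInd B z mix ρ} (v : SuperInd B z mix ρ)
    (A : LogField (SuperInd B z mix ρ)) (h : v = Ω ∧ A = idField) : IsField A := by
  rw [h.2]; exact isField_idField

theorem IsDecoupling.fermionState_creates (D : IsDecoupling B z mix s dir d) (c : C) {p : Bool}
    {v : SuperInd B z mix ρ} {A : LogField (SuperInd B z mix ρ)}
    (h : FermionState B z mix ρ (sVac B z mix ρ c) p v A) : Creates (sVac B z mix ρ c) v A := by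
  refine StateField.creates D.isModes_fermionCur isField_of_eq_idField (fermionCur_vac c) ?_ h
  rintro v A ⟨rfl, rfl⟩
  exact ⟨if_pos ⟨rfl, rfl⟩, fun p q hpq => if_neg fun h => by omega⟩

/-- Each coefficient of `A` is a linear operator commuting with all fermionic modes, and every
fermionic field is built from these modes and the identity. -/
theorem IsDecoupling.trivialOPE (D : IsDecoupling B z mix s dir d) {Ω : SuperInd B z mix ρ}
    {A : LogField (SuperInd B z mix ρ)} (hA : IsField A)
    (hc : ∀ f p q v, fAct B z mix ρ f (A p q v) = A p q (fAct B z mix ρ f v)) {p : Bool}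
    {w : SuperInd B z mix ρ} {A' : LogField (SuperInd B z mix ρ)}
    (h : FermionState B z mix ρ Ω p w A') : TrivialOPE A A' := by
  intro p q p' q' v
  refine StateField.commute (T := A p q) D.isModes_fermionCur isField_of_eq_idField (hA.linear p q)
    (fun x n v => (hc _ p q v).symm) ?_ h p' q' v
  rintro v A ⟨rfl, rfl⟩ p' q' w
  unfold idField
  split_ifs
  · rfl
  · exact (hA.linear p q).map_zero

theorem IsDecoupling.fAct_anticomm (D : IsDecoupling B z mix s dir d) (hρ : ρ z = LinearMap.id)
    (f g : FGen) : ∃ r : ℂ, ∀ v : SuperInd B z mix ρ,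
      fAct B z mix ρ f (fAct B z mix ρ g v) =
        (-1 : ℂ) • fAct B z mix ρ g (fAct B z mix ρ f v) + r • v := by
  have hite : ∀ (P : Prop) [Decidable P] (v : SuperInd B z mix ρ),
      (if P then v else 0) = (if P then (1 : ℂ) else 0) • v := by
    intro P _ v; split_ifs <;> simp
  rcases f with ⟨i, m⟩ | ⟨i, m⟩ <;> rcases g with ⟨j, n⟩ | ⟨j, n⟩
  · exact ⟨0, fun v => by rw [fAct_psi_psi]; simp⟩
  · refine ⟨if j = i ∧ n + m = -1 then 1 else 0, fun v => ?_⟩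
    rw [D.fAct_psis_psi hρ, hite]; module
  · refine ⟨if i = j ∧ m + n = -1 then 1 else 0, fun v => ?_⟩
    rw [D.fAct_psis_psi hρ, hite]; simp
  · exact ⟨0, fun v => by rw [fAct_psis_psis]; simp⟩

theorem fermionState_zero (Ω : SuperInd B z mix ρ) (p : Bool) :
    ∃ A, FermionState B z mix ρ Ω p 0 A := by
  have h0 : FermionState B z mix ρ Ω false Ω idField := .base _ _ ⟨rfl, rfl⟩
  cases p with
  | false => exact ⟨_, zero_smul ℂ Ω ▸ StateField.smul _ 0 _ _ h0⟩
  -- The base state is even, so in odd parity the zero vector is obtained as zero times a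
  -- one-fermion state.
  | true => exact ⟨_, zero_smul ℂ (fermionCur B z mix ρ (0, false) (-((0 : ℕ) : ℤ) - 1) Ω) ▸
      StateField.smul _ 0 _ _ (StateField.current (0, false) 0 _ _ _ h0)⟩

/-- The correspondence only provides creation modes. An arbitrary mode is anticommuted inwards, each
contraction returning an earlier state, until it meets the vacuum, which it annihilates unless it
creates. -/
theorem IsDecoupling.fermionState_fAct (D : IsDecoupling B z mix s dir d)
    (hρ : ρ z = LinearMap.id) (c : C) {p : Bool} {v : SuperInd B z mix ρ}
    {A : LogField (SuperInd B z mix ρ)}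
    (h : FermionState B z mix ρ (sVac B z mix ρ c) p v A) :
    ∀ f, ∃ A', FermionState B z mix ρ (sVac B z mix ρ c) (xor true p) (fAct B z mix ρ f v) A' := by
  have hneg : ∀ {p : Bool} {v : SuperInd B z mix ρ} {A : LogField (SuperInd B z mix ρ)},
      FermionState B z mix ρ (sVac B z mix ρ c) p v A → ∀ a n, n < 0 →
      ∃ A', FermionState B z mix ρ (sVac B z mix ρ c) (xor true p)
        (fAct B z mix ρ (fermionMode a n) v) A' := by
    intro p v A h a n hn
    obtain ⟨k, rfl⟩ : ∃ k : ℕ, n = -(k : ℤ) - 1 := ⟨(-n - 1).toNat, by omega⟩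
    exact ⟨_, StateField.current a k _ _ _ h⟩
  induction h with
  | base v A h =>
    intro f
    obtain ⟨a, n, rfl⟩ := exists_fermionMode f
    rcases lt_or_ge n 0 with hn | hn
    · exact hneg (.base v A h) a n hn
    · rw [h.1, show fAct B z mix ρ (fermionMode a n) (sVac B z mix ρ c) = 0 from
        fermionCur_vac c a n hn]
      exact fermionState_zero _ _
  | current x k p v A h ih =>
    intro f
    obtain ⟨r, hr⟩ := D.fAct_anticomm hρ f (fermionMode x (-(k : ℤ) - 1))
    obtain ⟨A', hA'⟩ := ih f
    have h1 := StateField.smul _ (-1) _ _ (StateField.current x k _ _ _ hA')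
    have h2 := StateField.smul _ r _ _ h
    rw [show xor true (xor true p) = p by cases p <;> rfl] at h1 ⊢
    exact ⟨_, hr v ▸ StateField.add _ _ _ _ _ h1 h2⟩
  | add p v w A A' _ _ ih1 ih2 =>
    intro f
    obtain ⟨A₁, h1⟩ := ih1 f
    obtain ⟨A₂, h2⟩ := ih2 f
    rw [map_add]
    exact ⟨_, StateField.add _ _ _ _ _ h1 h2⟩
  | smul p r v A _ ih =>
    intro f
    obtain ⟨A₁, h1⟩ := ih f
    rw [map_smul]
    exact ⟨_, StateField.smul _ _ _ _ h1⟩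

/-- The parity parts of the Fock space are spanned by words in arbitrary modes, so the converse
direction needs stability under all modes, as supplied by `fermionState_fAct`. -/
theorem IsDecoupling.fermionState_iff (D : IsDecoupling B z mix s dir d)
    (hρ : ρ z = LinearMap.id) (hΦ : IsFactorization B z mix ρ shift Φ) (c : C) (p : Bool)
    (v : SuperInd B z mix ρ) :
    (∃ A, FermionState B z mix ρ (sVac B z mix ρ c) p v A) ↔
      ∃ b ∈ parityPart fermions fermionsAction p, v = Φ (vac B ρ c ⊗ₜ b) := by
  constructor
  · rintro ⟨A, h⟩
    induction h with
    | base v A h =>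
      exact ⟨fockVac, vac_mem_parityPart fermions fermionsAction 1, h.1.trans (hΦ.1 c).symm⟩
    | current x k p v A _ ih =>
      obtain ⟨b, hb, rfl⟩ := ih
      exact ⟨act fermions fermionsAction (.inr (fermionMode x (-(k : ℤ) - 1))) b,
        act_mem_parityPart fermions fermionsAction (.inr (fermionMode x (-(k : ℤ) - 1))) hb,
        (hΦ.2.2 (fermionMode x (-(k : ℤ) - 1)) (vac B ρ c) b).symm⟩
    | add p v w A A' _ _ ih1 ih2 =>
      obtain ⟨b, hb, rfl⟩ := ih1
      obtain ⟨b', hb', rfl⟩ := ih2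
      exact ⟨b + b', Submodule.add_mem _ hb hb', by rw [TensorProduct.tmul_add, map_add]⟩
    | smul p r v A _ ih =>
      obtain ⟨b, hb, rfl⟩ := ih
      exact ⟨r • b, Submodule.smul_mem _ r hb, by rw [TensorProduct.tmul_smul, map_smul]⟩
  · rintro ⟨b, hb, rfl⟩
    unfold parityPart at hb
    induction hb using Submodule.span_induction with
    | mem b hb =>
      obtain ⟨l, r, rfl, rfl⟩ := hb
      induction l with
      | nil =>
        change ∃ A, FermionState B z mix ρ _ false (Φ (vac B ρ c ⊗ₜ vac fermions fermionsAction r)) A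
        rw [vac_eq_smul_fockVac, TensorProduct.tmul_smul, map_smul, hΦ.1]
        exact ⟨_, StateField.smul _ _ _ _ (.base _ _ ⟨rfl, rfl⟩)⟩
      | cons a l ih =>
        obtain ⟨A, hA⟩ := ih
        rw [List.foldr_cons]
        change ∃ A, FermionState B z mix ρ _ _ (Φ (vac B ρ c ⊗ₜ act fermions fermionsAction a
          (word fermions fermionsAction l r))) A
        rcases a with ⟨⟩ | f
        · rw [act_unit, show fermions.odd (.inl ()) = false from rfl, Bool.false_xor]
          exact ⟨A, hA⟩
        · rw [hΦ.2.2]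
          exact D.fermionState_fAct hρ c hA f
    | zero =>
      rw [TensorProduct.tmul_zero, map_zero]
      exact fermionState_zero _ p
    | add x y _ _ ih1 ih2 =>
      obtain ⟨A₁, h1⟩ := ih1
      obtain ⟨A₂, h2⟩ := ih2
      rw [TensorProduct.tmul_add, map_add]
      exact ⟨_, StateField.add _ _ _ _ _ h1 h2⟩
    | smul r x _ ih =>
      obtain ⟨A₁, h1⟩ := ih
      rw [TensorProduct.tmul_smul, map_smul]
      exact ⟨_, StateField.smul _ _ _ _ h1⟩

end Super

/-! ### Multiplication operators -/

section Multiplication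

variable {ι : Type} {B : ModeAlgebra ι} {z : ι} {mix : ι → FGen → (FGen →₀ ℂ)}
  {s : ι → ℂ} {dir : ι → Fin 3} {d : ι → ℤ}
  {C : Type} [AddCommGroup C] [Module ℂ C] {ρ : ι → C →ₗ[ℂ] C}

/-- The action `F ↦ (g ↦ F (δ g) + ∑_j X_j (F (∂_j g)))` on maps from functions to states, which
describes the commutator of a mode with multiplication operators. -/
def mulBracket {H : Type} [AddCommGroup H] [Module ℂ H] (δ : ι → C →ₗ[ℂ] C)
    (pd : Fin 3 → C →ₗ[ℂ] C) (X : ι → Fin 3 → H →ₗ[ℂ] H) (y : ι) :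
    (C →ₗ[ℂ] H) →ₗ[ℂ] (C →ₗ[ℂ] H) :=
  LinearMap.lcomp ℂ H (δ y) + ∑ j, LinearMap.compRight ℂ (X y j) ∘ₗ LinearMap.lcomp ℂ H (pd j)

theorem mulBracket_apply {H : Type} [AddCommGroup H] [Module ℂ H] (δ : ι → C →ₗ[ℂ] C)
    (pd : Fin 3 → C →ₗ[ℂ] C) (X : ι → Fin 3 → H →ₗ[ℂ] H) (y : ι) (F : C →ₗ[ℂ] H) (g : C) :
    mulBracket δ pd X y F g = F (δ y g) + ∑ j, X y j (F (pd j g)) := by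
  simp only [mulBracket, LinearMap.add_apply, LinearMap.sum_apply]
  rfl

theorem IsDecoupling.bAct_bAct (D : IsDecoupling B z mix s dir d) (a b : ι)
    (v : SuperInd B z mix ρ) : bAct B z mix ρ a (bAct B z mix ρ b v) =
      bAct B z mix ρ b (bAct B z mix ρ a v) +
        Finsupp.linearCombination ℂ (bAct B z mix ρ) (B.bracket a b) v := by
  refine (isModeRep_bAct (ρ := ρ) a b v).trans ?_
  rw [D.even, show koszul false (B.odd b) = 1 by simp [koszul], one_smul]

theorem IsDecoupling.bAct_fAct (D : IsDecoupling B z mix s dir d) (y : ι) (f : FGen)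
    (v : SuperInd B z mix ρ) : bAct B z mix ρ y (fAct B z mix ρ f v) =
      fAct B z mix ρ f (bAct B z mix ρ y v) +
        Finsupp.linearCombination ℂ (fAct B z mix ρ) (mix y f) v := by
  have h := act_act (withFermions B z mix) (withFermionsAction ρ) (.inl y) (.inr f) v
  change _ = koszul (B.odd y) true • _ + Finsupp.linearCombination ℂ
    (act (withFermions B z mix) (withFermionsAction ρ)) ((mix y f).mapDomain Sum.inr) v at h
  rw [D.even, show koszul false true = 1 by simp [koszul], one_smul,
    Finsupp.linearCombination_mapDomain] at h
  exact h

/-- Conditions under which functions act on the induced module by multiplication operators `M g`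
with `[y, M g] = M (δ_y g) + ∑_j X_{y,j} M (∂_j g)`. -/
structure MulData (B : ModeAlgebra ι) (z : ι) (mix : ι → FGen → (FGen →₀ ℂ))
    (ρ : ι → C →ₗ[ℂ] C) (mul : C →ₗ[ℂ] C →ₗ[ℂ] C) (δ : ι → C →ₗ[ℂ] C) (pd : Fin 3 → C →ₗ[ℂ] C)
    (X : ι → Fin 3 → SuperInd B z mix ρ →ₗ[ℂ] SuperInd B z mix ρ) : Prop where
  X_fAct : ∀ y j f v, X y j (fAct B z mix ρ f v) = fAct B z mix ρ f (X y j v)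
  X_comm : ∀ a b j l v, X a j (X b l v) = X b l (X a j v)
  pd_comm : ∀ j l g, pd j (pd l g) = pd l (pd j g)
  pd_δ : ∀ j y g, pd j (δ y g) = δ y (pd j g)
  bracket : ∀ a b F g, Finsupp.linearCombination ℂ (mulBracket δ pd X) (B.bracket a b) F g =
    F (δ a (δ b g)) - F (δ b (δ a g)) +
      ∑ j, ((bAct B z mix ρ a (X b j (F (pd j g))) - X b j (bAct B z mix ρ a (F (pd j g)))) -
        (bAct B z mix ρ b (X a j (F (pd j g))) - X a j (bAct B z mix ρ b (F (pd j g)))))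
  X_vac : ∀ y j c, 0 ≤ B.deg y → X y j (sVac B z mix ρ c) = 0
  leibniz : ∀ y g c, 0 ≤ B.deg y → extendedAction B ρ y (mul g c) =
    mul (δ y g) c + mul g (extendedAction B ρ y c)

variable {mul : C →ₗ[ℂ] C →ₗ[ℂ] C} {δ : ι → C →ₗ[ℂ] C} {pd : Fin 3 → C →ₗ[ℂ] C}
  {X : ι → Fin 3 → SuperInd B z mix ρ →ₗ[ℂ] SuperInd B z mix ρ}

/-- The modes on maps from functions to states. -/
def mulMode (δ : ι → C →ₗ[ℂ] C) (pd : Fin 3 → C →ₗ[ℂ] C)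
    (X : ι → Fin 3 → SuperInd B z mix ρ →ₗ[ℂ] SuperInd B z mix ρ) :
    ι ⊕ FGen → (C →ₗ[ℂ] SuperInd B z mix ρ) →ₗ[ℂ] (C →ₗ[ℂ] SuperInd B z mix ρ) :=
  Sum.elim (fun y => LinearMap.compRight ℂ (bAct B z mix ρ y) - mulBracket δ pd X y)
    (fun f => LinearMap.compRight ℂ (fAct B z mix ρ f))

theorem mulMode_inl (y : ι) (F : C →ₗ[ℂ] SuperInd B z mix ρ) (g : C) :
    mulMode δ pd X (.inl y) F g = bAct B z mix ρ y (F g) - F (δ y g) -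
      ∑ j, X y j (F (pd j g)) := by
  rw [← sub_add_eq_sub_sub, ← mulBracket_apply]; rfl

theorem mulMode_inr (f : FGen) (F : C →ₗ[ℂ] SuperInd B z mix ρ) (g : C) :
    mulMode δ pd X (.inr f) F g = fAct B z mix ρ f (F g) := rfl

theorem linearCombination_apply_apply {κ V W : Type} [AddCommGroup V] [Module ℂ V]
    [AddCommGroup W] [Module ℂ W] (T : κ → V →ₗ[ℂ] W) (c : κ →₀ ℂ) (v : V) :
    Finsupp.linearCombination ℂ T c v = c.sum fun k r => r • T k v := by
  rw [Finsupp.linearCombination_apply, Finsupp.sum, LinearMap.sum_apply]; rfl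

/-- In the commutator of two even modes the terms with two `X` cancel, since the `X` and the `∂_j`
commute. The terms with two `δ`, and those with one `X` and one mode, are those in the condition
`bracket`. -/
theorem MulData.isModeRep (D : IsDecoupling B z mix s dir d) (hρ : ρ z = LinearMap.id)
    (K : MulData B z mix ρ mul δ pd X) (hδz : δ z = 0) (hXz : X z = 0) :
    IsModeRep (withFermions B z mix) (mulMode δ pd X) := by
  have hmix : ∀ y f F g, mulMode δ pd X (.inl y) (mulMode δ pd X (.inr f) F) g =
      mulMode δ pd X (.inr f) (mulMode δ pd X (.inl y) F) g +
        Finsupp.linearCombination ℂ (mulMode δ pd X) ((mix y f).mapDomain Sum.inr) F g := by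
    intro y f F g
    rw [Finsupp.linearCombination_mapDomain]
    have : Finsupp.linearCombination ℂ (mulMode δ pd X ∘ Sum.inr) (mix y f) F g =
        Finsupp.linearCombination ℂ (fAct B z mix ρ) (mix y f) (F g) := by
      rw [linearCombination_apply_apply, linearCombination_apply_apply, Finsupp.sum, Finsupp.sum,
        LinearMap.sum_apply]
      rfl
    rw [this]
    simp only [mulMode_inl, mulMode_inr, K.X_fAct, D.bAct_fAct, map_sub, map_sum]
    abel
  intro a b F
  refine LinearMap.ext fun g => ?_
  rw [LinearMap.add_apply, LinearMap.smul_apply]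
  rcases a with a | a <;> rcases b with b | b
  · change _ = koszul (B.odd a) (B.odd b) • _ + Finsupp.linearCombination ℂ (mulMode δ pd X)
      ((B.bracket a b).mapDomain Sum.inl) F g
    rw [D.even, show koszul false (B.odd b) = 1 by simp [koszul], one_smul,
      Finsupp.linearCombination_mapDomain]
    have h1 : Finsupp.linearCombination ℂ (mulMode δ pd X ∘ Sum.inl) (B.bracket a b) F g =
        Finsupp.linearCombination ℂ (bAct B z mix ρ) (B.bracket a b) (F g) -
          Finsupp.linearCombination ℂ (mulBracket δ pd X) (B.bracket a b) F g := by
      rw [linearCombination_apply_apply, linearCombination_apply_apply,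
        linearCombination_apply_apply, Finsupp.sum, Finsupp.sum, Finsupp.sum,
        LinearMap.sum_apply, LinearMap.sum_apply, ← Finset.sum_sub_distrib]
      refine Finset.sum_congr rfl fun k _ => ?_
      rw [LinearMap.smul_apply, LinearMap.smul_apply, ← smul_sub]
      rfl
    rw [h1, K.bracket]
    simp only [mulMode_inl, map_sub, map_sum, D.bAct_bAct a b, Finset.sum_sub_distrib]
    have hX : ∑ j, ∑ l, X b j (X a l (F (pd l (pd j g)))) =
        ∑ j, ∑ l, X a j (X b l (F (pd l (pd j g)))) := by
      rw [Finset.sum_comm]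
      refine Finset.sum_congr rfl fun j _ => Finset.sum_congr rfl fun l _ => ?_
      rw [K.X_comm, K.pd_comm]
    simp only [hX, K.pd_δ]
    abel
  · change _ = koszul (B.odd a) true • _ + Finsupp.linearCombination ℂ (mulMode δ pd X)
      ((mix a b).mapDomain Sum.inr) F g
    rw [D.even, show koszul false true = 1 by simp [koszul], one_smul]
    exact hmix a b F g
  · change _ = koszul true (B.odd b) • _ + Finsupp.linearCombination ℂ (mulMode δ pd X)
      (-(mix b a).mapDomain Sum.inr) F g
    rw [D.even, show koszul true false = 1 by simp [koszul], one_smul, hmix b a, map_neg,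
      LinearMap.neg_apply, LinearMap.neg_apply]
    abel
  · have hz : ∀ F : C →ₗ[ℂ] SuperInd B z mix ρ, mulMode δ pd X (.inl z) F = F := by
      intro F
      refine LinearMap.ext fun g => ?_
      rw [mulMode_inl, hδz, hXz, D.bAct_central hρ]
      simp
    refine (act_act (withFermions B z mix) (withFermionsAction ρ) (.inr a) (.inr b) (F g)).trans ?_
    refine congrArg₂ (· + ·) rfl ?_
    -- Fermions bracket into the central line only, and `z` acts as the identity both on states and
    -- on maps from functions to states.
    have hsup : ∀ k ∈ ((withFermions B z mix).bracket (.inr a) (.inr b)).support, k = .inl z := by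
      intro k hk
      rcases a with ⟨i, m⟩ | ⟨i, m⟩ <;> rcases b with ⟨j, n⟩ | ⟨j, n⟩ <;>
        simp only [withFermions] at hk
      · simp at hk
      · split_ifs at hk
        · exact Finset.mem_singleton.1 (Finsupp.support_single_subset hk)
        · simp at hk
      · split_ifs at hk
        · exact Finset.mem_singleton.1 (Finsupp.support_single_subset hk)
        · simp at hk
      · simp at hk
    rw [linearCombination_apply_apply, linearCombination_apply_apply, Finsupp.sum, Finsupp.sum,
      LinearMap.sum_apply]
    refine Finset.sum_congr rfl fun k hk => ?_
    rw [hsup k hk, hz, LinearMap.smul_apply]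
    congr 1
    exact LinearMap.congr_fun (D.bAct_central hρ) (F g)

/-- The universal property with target the maps from functions to states, starting from `c ↦ (g ↦ g
c)`; exchanging the two arguments of the lift gives `M`. The Leibniz rule is the condition on modes
of nonnegative degree. -/
theorem MulData.exists_mul (D : IsDecoupling B z mix s dir d) (hρ : ρ z = LinearMap.id)
    (K : MulData B z mix ρ mul δ pd X) (hδz : δ z = 0) (hXz : X z = 0) :
    ∃ M : C →ₗ[ℂ] SuperInd B z mix ρ →ₗ[ℂ] SuperInd B z mix ρ,
      (∀ g c, M g (sVac B z mix ρ c) = sVac B z mix ρ (mul g c)) ∧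
      (∀ g f v, M g (fAct B z mix ρ f v) = fAct B z mix ρ f (M g v)) ∧
      ∀ y g v, bAct B z mix ρ y (M g v) - M g (bAct B z mix ρ y v) =
        M (δ y g) v + ∑ j, X y j (M (pd j g) v) := by
  obtain ⟨L, h1, h2⟩ := exists_ind_lift (ρ := withFermionsAction ρ)
    (K.isModeRep D hρ hδz hXz)
    (LinearMap.compRight ℂ (sVac B z mix ρ) ∘ₗ mul.flip) (by
      intro y c hy
      refine LinearMap.ext fun g => ?_
      rcases y with y | f
      · have hy : 0 ≤ B.deg y := hy
        rw [mulMode_inl]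
        change bAct B z mix ρ y (sVac B z mix ρ (mul g c)) - sVac B z mix ρ (mul (δ y g) c) -
          ∑ j, X y j (sVac B z mix ρ (mul (pd j g) c)) =
            sVac B z mix ρ (mul g (extendedAction B ρ y c))
        rw [bAct_vac hy, K.leibniz y g c hy, map_add]
        simp only [K.X_vac _ _ _ hy, Finset.sum_const_zero]
        abel
      · have : extendedAction (withFermions B z mix) (withFermionsAction ρ) (.inr f) = 0 := by
          unfold extendedAction; split_ifs <;> rfl
        rw [this, LinearMap.zero_apply, map_zero, LinearMap.zero_apply]
        exact fAct_vac f hy _)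
  refine ⟨L.flip, fun g c => ?_, fun g f v => ?_, fun y g v => ?_⟩
  · rw [LinearMap.flip_apply, h1]; rfl
  · rw [LinearMap.flip_apply, h2, mulMode_inr, LinearMap.flip_apply]
  · have := LinearMap.congr_fun (h2 (.inl y) v) g
    rw [mulMode_inl] at this
    simp only [LinearMap.flip_apply]
    rw [this]; abel

theorem IsDecoupling.mul_unique (D : IsDecoupling B z mix s dir d)
    {M M' : C →ₗ[ℂ] SuperInd B z mix ρ →ₗ[ℂ] SuperInd B z mix ρ}
    (hv : ∀ g c, M g (sVac B z mix ρ c) = M' g (sVac B z mix ρ c))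
    (hf : ∀ g f v, M g (fAct B z mix ρ f v) = fAct B z mix ρ f (M g v))
    (hf' : ∀ g f v, M' g (fAct B z mix ρ f v) = fAct B z mix ρ f (M' g v))
    (hb : ∀ y, B.deg y < 0 → ∀ g v, bAct B z mix ρ y (M g v) - M g (bAct B z mix ρ y v) =
      ∑ j, X y j (M (pd j g) v))
    (hb' : ∀ y, B.deg y < 0 → ∀ g v, bAct B z mix ρ y (M' g v) - M' g (bAct B z mix ρ y v) =
      ∑ j, X y j (M' (pd j g) v)) : M = M' := by
  refine LinearMap.ext fun g => LinearMap.ext fun v => ?_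
  -- The commutator with `M g` involves `M (∂_j g)`, so the induction has to treat all functions at
  -- the same time.
  have key : M.flip v = M'.flip v := by
    refine ind_neg_induction D.homogeneous_super (LinearMap.eqLocus M.flip M'.flip)
      (fun c => LinearMap.ext fun g => hv g c) (fun y hy v h => LinearMap.ext fun g => ?_) v
    have h : ∀ g, M g v = M' g v := fun g => LinearMap.congr_fun (show M.flip v = M'.flip v from h) g
    rcases y with y | f
    · refine (?_ : M g (bAct B z mix ρ y v) = M' g (bAct B z mix ρ y v))
      have e := hb y hy g v
      have e' := hb' y hy g v
      simp only [h] at e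
      rw [← e', sub_right_inj] at e
      exact e
    · refine (?_ : M g (fAct B z mix ρ f v) = M' g (fAct B z mix ρ f v))
      rw [hf, hf', h]
  exact LinearMap.congr_fun key g

end Multiplication

/-! ### Derivations of smooth functions -/

/-- The second derivatives cancel by symmetry; what remains is the derivative along the Lie bracket
of the fields. -/
theorem fderiv_fderiv_apply_sub {f : E → ℂ} {Z W : E → E} {p : E} (hf : ContDiffAt ℝ ∞ f p)
    (hZ : DifferentiableAt ℝ Z p) (hW : DifferentiableAt ℝ W p) :
    fderiv ℝ (fun q => fderiv ℝ f q (W q)) p (Z p) - fderiv ℝ (fun q => fderiv ℝ f q (Z q)) p (W p) =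
      fderiv ℝ f p (fderiv ℝ W p (Z p) - fderiv ℝ Z p (W p)) := by
  have hd : DifferentiableAt ℝ (fderiv ℝ f) p :=
    (hf.fderiv_right (m := ∞) (by simp)).differentiableAt (by simp)
  have hs : IsSymmSndFDerivAt ℝ f p := hf.isSymmSndFDerivAt (by
    rw [minSmoothness_of_isRCLikeNormedField]; exact ENat.LEInfty.out)
  rw [fderiv_clm_apply hd hW, fderiv_clm_apply hd hZ]
  simp only [add_apply, ContinuousLinearMap.comp_apply,
    ContinuousLinearMap.flip_apply, map_sub]
  rw [hs.eq (Z p) (W p)]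
  abel

theorem fderiv_dualField (i : Fin 3) (p : E) : fderiv ℝ (dualField i) p = 0 :=
  fderiv_const_apply _

theorem fderiv_twistedField (t : ℝ) (i : Fin 3) (p e : E) :
    fderiv ℝ (twistedField t i) p e = (fun k => t * ∑ j, eps i j k * e.2 j, 0) := by
  have hd : DifferentiableAt ℝ (twistedField t i) p :=
    (contDiff_twistedField t i).differentiable (by simp) p
  have h1 := hd.hasFDerivAt.hasLineDerivAt e
  have h2 : HasLineDerivAt ℝ (twistedField t i)
      ((fun k => t * ∑ j, eps i j k * e.2 j, 0) : E) p e := by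
    unfold HasLineDerivAt
    have h3 : HasDerivAt (fun r : ℝ => twistedField t i p +
        r • ((fun k => t * ∑ j, eps i j k * e.2 j, 0) : E))
        ((1 : ℝ) • ((fun k => t * ∑ j, eps i j k * e.2 j, 0) : E)) 0 :=
      ((hasDerivAt_id (0 : ℝ)).smul_const _).const_add _
    rw [one_smul] at h3
    refine h3.congr_of_eventuallyEq (Filter.Eventually.of_forall fun r => ?_)
    refine Prod.ext (funext fun k => ?_) ?_
    · simp [twistedField, Fin.sum_univ_three]; ring
    · simp [twistedField]
  exact h1.lineDeriv.symm.trans h2.lineDeriv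

/-- The value `t = 1/2` gives the bracket of the `W^*`, with `-ε`, and `t = -1/2` that of the `β`
zero modes, with `ε`. -/
theorem twistedField_bracket (t : ℝ) (i j : Fin 3) (p : E) :
    fderiv ℝ (twistedField t j) p (twistedField t i p) -
      fderiv ℝ (twistedField t i) p (twistedField t j p) =
      ∑ k, (-2 * t * eps i j k) • dualField k p := by
  rw [fderiv_twistedField, fderiv_twistedField]
  refine Prod.ext (funext fun k => ?_) ?_
  · have hs : ∀ a b, ∑ l, eps a l k * (twistedField t b p).2 l = eps a b k := fun a b => by
      simp [twistedField, Pi.single_apply]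
    simp only [Prod.fst_sub, Pi.sub_apply, hs, Prod.fst_sum, Finset.sum_apply, dualField,
      Prod.smul_fst, Pi.smul_apply, Pi.single_apply, smul_eq_mul, mul_ite, mul_one, mul_zero,
      Finset.sum_ite_eq, Finset.mem_univ, if_true]
    rw [eps_swap_left]; ring
  · simp [dualField, Prod.snd_sum]

section Open

variable {U : TopologicalSpace.Opens E}

theorem Smooth.ext' {f g : Smooth U} (h : ∀ p ∈ U, f.1 p = g.1 p) : f = g := by
  refine Subtype.ext (funext fun p => ?_)
  by_cases hp : p ∈ U
  · exact h p hp
  · rw [f.2.2 p hp, g.2.2 p hp]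

theorem derivFn_apply (Z : E → E) (hZ : ContDiff ℝ ∞ Z) (f : Smooth U) {p : E} (hp : p ∈ U) :
    (derivFn U Z hZ f).1 p = fderiv ℝ f.1 p (Z p) :=
  Set.indicator_of_mem (s := (U : Set E)) hp (fun p => fderiv ℝ f.1 p (Z p))

theorem fderiv_derivFn (Z : E → E) (hZ : ContDiff ℝ ∞ Z) (f : Smooth U) {p : E} (hp : p ∈ U) :
    fderiv ℝ (derivFn U Z hZ f).1 p = fderiv ℝ (fun q => fderiv ℝ f.1 q (Z q)) p := by
  -- `derivFn` is cut off outside `U`, but near a point of the open set `U` it agrees with the uncut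
  -- derivative.
  refine Filter.EventuallyEq.fderiv_eq ?_
  filter_upwards [U.isOpen.mem_nhds hp] with q hq
  exact derivFn_apply Z hZ f hq

theorem Smooth.contDiffAt (f : Smooth U) {p : E} (hp : p ∈ U) : ContDiffAt ℝ ∞ f.1 p :=
  f.2.1.contDiffAt (U.isOpen.mem_nhds hp)

theorem derivFn_derivFn_sub {Z W : E → E} (hZ : ContDiff ℝ ∞ Z) (hW : ContDiff ℝ ∞ W)
    (f : Smooth U) {p : E} (hp : p ∈ U) :
    (derivFn U Z hZ (derivFn U W hW f)).1 p - (derivFn U W hW (derivFn U Z hZ f)).1 p =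
      fderiv ℝ f.1 p (fderiv ℝ W p (Z p) - fderiv ℝ Z p (W p)) := by
  rw [derivFn_apply Z hZ _ hp, derivFn_apply W hW _ hp, fderiv_derivFn W hW f hp,
    fderiv_derivFn Z hZ f hp]
  exact fderiv_fderiv_apply_sub (Smooth.contDiffAt f hp) (hZ.differentiable (by simp) p)
    (hW.differentiable (by simp) p)

/-- The derivation `∂/∂x^*_i`. -/
abbrev dualD (U : TopologicalSpace.Opens E) (i : Fin 3) : Smooth U →ₗ[ℂ] Smooth U :=
  derivFn U (dualField i) (contDiff_dualField i)

/-- The derivation along an invariant vector field. -/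
abbrev twistedD (U : TopologicalSpace.Opens E) (t : ℝ) (i : Fin 3) : Smooth U →ₗ[ℂ] Smooth U :=
  derivFn U (twistedField t i) (contDiff_twistedField t i)

theorem dualD_comm (i j : Fin 3) (f : Smooth U) :
    dualD U i (dualD U j f) = dualD U j (dualD U i f) := by
  refine Smooth.ext' fun p hp => sub_eq_zero.1 ?_
  rw [derivFn_derivFn_sub _ _ f hp, fderiv_dualField, fderiv_dualField]
  simp

theorem dualD_twistedD (t : ℝ) (i j : Fin 3) (f : Smooth U) :
    dualD U i (twistedD U t j f) = twistedD U t j (dualD U i f) := by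
  refine Smooth.ext' fun p hp => sub_eq_zero.1 ?_
  rw [derivFn_derivFn_sub _ _ f hp, fderiv_dualField, fderiv_twistedField]
  have : ((fun k => t * ∑ l, eps j l k * (dualField i p).2 l, 0) : E) = 0 := by
    refine Prod.ext (funext fun k => ?_) rfl
    simp [dualField]
  rw [this]
  simp

theorem twistedD_comm (t : ℝ) (i j : Fin 3) (f : Smooth U) :
    twistedD U t i (twistedD U t j f) - twistedD U t j (twistedD U t i f) =
      ∑ k, ((-2 * t * eps i j k : ℝ) : ℂ) • dualD U k f := by
  refine Smooth.ext' fun p hp => ?_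
  refine (derivFn_derivFn_sub (contDiff_twistedField t i) (contDiff_twistedField t j) f hp).trans ?_
  rw [twistedField_bracket, map_sum, Submodule.coe_sum, Finset.sum_apply]
  refine Finset.sum_congr rfl fun k _ => ?_
  rw [map_smul, Submodule.coe_smul, Pi.smul_apply, derivFn_apply _ _ f hp]
  rw [Complex.coe_smul]

theorem derivFn_mul (Z : E → E) (hZ : ContDiff ℝ ∞ Z) (f g : Smooth U) :
    derivFn U Z hZ (Smooth.mul f g) =
      Smooth.mul (derivFn U Z hZ f) g + Smooth.mul f (derivFn U Z hZ g) := by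
  refine Smooth.ext' fun p hp => ?_
  rw [derivFn_apply Z hZ _ hp]
  change fderiv ℝ (fun q => f.1 q * g.1 q) p (Z p) =
    (derivFn U Z hZ f).1 p * g.1 p + f.1 p * (derivFn U Z hZ g).1 p
  rw [derivFn_apply Z hZ _ hp, derivFn_apply Z hZ _ hp,
    fderiv_fun_mul (Smooth.diffAt f hp) (Smooth.diffAt g hp)]
  simp only [add_apply, smul_apply, smul_eq_mul]
  ring

theorem derivFn_one (Z : E → E) (hZ : ContDiff ℝ ∞ Z) : derivFn U Z hZ (Smooth.one U) = 0 := by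
  refine Smooth.ext' fun p hp => ?_
  rw [derivFn_apply Z hZ _ hp]
  have : fderiv ℝ (Smooth.one U).1 p = fderiv ℝ (fun _ : E => (1 : ℂ)) p := by
    refine Filter.EventuallyEq.fderiv_eq ?_
    filter_upwards [U.isOpen.mem_nhds hp] with q hq
    exact Set.indicator_of_mem (s := (U : Set E)) hq (fun _ => (1 : ℂ))
  rw [this, fderiv_const_apply]
  rfl

/-- Multiplication of smooth functions as a bilinear map. -/
def mulSmooth (U : TopologicalSpace.Opens E) : Smooth U →ₗ[ℂ] Smooth U →ₗ[ℂ] Smooth U :=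
  LinearMap.mk₂ ℂ Smooth.mul
    (fun _ _ _ => Subtype.ext (funext fun _ => add_mul _ _ _))
    (fun _ _ _ => Subtype.ext (funext fun _ => mul_assoc _ _ _))
    (fun _ _ _ => Subtype.ext (funext fun _ => mul_add _ _ _))
    (fun _ _ _ => Subtype.ext (funext fun _ => mul_left_comm _ _ _))

theorem Smooth.mul_one (f : Smooth U) : Smooth.mul f (Smooth.one U) = f := by
  refine Smooth.ext' fun p hp => ?_
  change f.1 p * (U : Set E).indicator (fun _ => 1) p = f.1 p
  rw [Set.indicator_of_mem (show p ∈ (U : Set E) from hp), _root_.mul_one]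

end Open

section Global

/-- The derivation `∂/∂x^*_i` of functions on `X`. -/
abbrev dualX (i : Fin 3) : SmoothX →ₗ[ℂ] SmoothX :=
  derivX (dualField i) (contDiff_dualField i) (dualField_inv i)

/-- The derivation of functions on `X` along a left invariant vector field. -/
abbrev twistedX (i : Fin 3) : SmoothX →ₗ[ℂ] SmoothX :=
  derivX (twistedField (-1 / 2) i) (contDiff_twistedField _ i) (twistedField_inv i)

variable {Z W : E → E} {hZ : ContDiff ℝ ∞ Z} {hW : ContDiff ℝ ∞ W}
  {iZ : ∀ g p : E, Z (gmul g p) = ((Z p).1 + (1 / 2 : ℝ) • det3 g.2 (Z p).2, (Z p).2)}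
  {iW : ∀ g p : E, W (gmul g p) = ((W p).1 + (1 / 2 : ℝ) • det3 g.2 (W p).2, (W p).2)}

theorem derivX_derivX_sub (f : SmoothX) (p : E) :
    (derivX Z hZ iZ (derivX W hW iW f)).1 p - (derivX W hW iW (derivX Z hZ iZ f)).1 p =
      fderiv ℝ f.1 p (fderiv ℝ W p (Z p) - fderiv ℝ Z p (W p)) :=
  fderiv_fderiv_apply_sub f.2.1.contDiffAt (hZ.differentiable (by simp) p)
    (hW.differentiable (by simp) p)

theorem dualX_comm (i j : Fin 3) (f : SmoothX) : dualX i (dualX j f) = dualX j (dualX i f) := by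
  refine Subtype.ext (funext fun p => sub_eq_zero.1 ?_)
  rw [derivX_derivX_sub, fderiv_dualField, fderiv_dualField]
  simp

theorem dualX_twistedX (i j : Fin 3) (f : SmoothX) :
    dualX i (twistedX j f) = twistedX j (dualX i f) := by
  refine Subtype.ext (funext fun p => sub_eq_zero.1 ?_)
  rw [derivX_derivX_sub, fderiv_dualField, fderiv_twistedField]
  have : ((fun k => -1 / 2 * ∑ l, eps j l k * (dualField i p).2 l, 0) : E) = 0 := by
    refine Prod.ext (funext fun k => ?_) rfl
    simp [dualField]
  rw [this]
  simp

theorem twistedX_comm (i j : Fin 3) (f : SmoothX) :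
    twistedX i (twistedX j f) - twistedX j (twistedX i f) =
      ∑ k, (eps i j k : ℂ) • dualX k f := by
  refine Subtype.ext (funext fun p => ?_)
  refine (derivX_derivX_sub f p).trans ?_
  rw [twistedField_bracket, map_sum, Submodule.coe_sum, Finset.sum_apply]
  refine Finset.sum_congr rfl fun k _ => ?_
  rw [map_smul, Submodule.coe_smul, Pi.smul_apply, show -2 * (-1 / 2) * eps i j k = eps i j k by ring]
  rw [Complex.coe_smul]
  rfl

theorem derivX_mul (f g : SmoothX) : derivX Z hZ iZ (SmoothX.mul f g) =
    SmoothX.mul (derivX Z hZ iZ f) g + SmoothX.mul f (derivX Z hZ iZ g) := by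
  refine Subtype.ext (funext fun p => ?_)
  change fderiv ℝ (fun q => f.1 q * g.1 q) p (Z p) =
    fderiv ℝ f.1 p (Z p) * g.1 p + f.1 p * fderiv ℝ g.1 p (Z p)
  rw [fderiv_fun_mul (f.2.1.differentiable (by simp) p) (g.2.1.differentiable (by simp) p)]
  simp only [add_apply, smul_apply, smul_eq_mul]
  ring

theorem derivX_one : derivX Z hZ iZ SmoothX.one = 0 := by
  refine Subtype.ext (funext fun p => ?_)
  change fderiv ℝ (fun _ : E => (1 : ℂ)) p (Z p) = 0
  rw [fderiv_const_apply]; rfl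

/-- Multiplication of smooth functions on `X` as a bilinear map. -/
def mulSmoothX : SmoothX →ₗ[ℂ] SmoothX →ₗ[ℂ] SmoothX :=
  LinearMap.mk₂ ℂ SmoothX.mul
    (fun _ _ _ => Subtype.ext (funext fun _ => add_mul _ _ _))
    (fun _ _ _ => Subtype.ext (funext fun _ => mul_assoc _ _ _))
    (fun _ _ _ => Subtype.ext (funext fun _ => mul_add _ _ _))
    (fun _ _ _ => Subtype.ext (funext fun _ => mul_left_comm _ _ _))

theorem SmoothX.mul_one (f : SmoothX) : SmoothX.mul f SmoothX.one = f :=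
  Subtype.ext (funext fun p => _root_.mul_one (f.1 p))

end Global

/-! ### The modes of super-loops -/

/-- The factor of the correction of an even mode. -/
def loopFactor : LGen → ℂ
  | .Ws _ => -(1 / 4)
  | .xs _ m => 1 / (4 * (m : ℂ))
  | _ => 0

/-- The index of an even mode. -/
def loopDir : LGen → Fin 3
  | .Ws i => i
  | .xs i _ => i
  | _ => 0

/-- The degree of the correction of an even mode. -/
def loopDeg : LGen → ℤ
  | .xs _ m => m
  | _ => 0

/-- Brackets of even modes contain only `x`, `W` and `ħ`, none of which is corrected. Homogeneity
and the condition `s_bracket` are read off together. -/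
theorem loopB_bracket_mem (a b : LGen) : loopB.bracket a b ∈
    Finsupp.supported ℂ ℂ {c | loopB.deg c = loopB.deg a + loopB.deg b ∧ loopFactor c = 0} := by
  have hs : ∀ (S : Set LGen) (c : LGen) (r : ℂ), c ∈ S →
      Finsupp.single c r ∈ Finsupp.supported ℂ ℂ S := fun S c r h => Finsupp.single_mem_supported ℂ r h
  rcases a with i | i | ⟨i, m⟩ | ⟨i, m⟩ | _ <;> rcases b with j | j | ⟨j, n⟩ | ⟨j, n⟩ | _ <;>
    simp only [loopB] <;> try exact Submodule.zero_mem _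
  · split_ifs with h
    · exact hs _ _ _ ⟨by simp [h.2], rfl⟩
    · exact Submodule.zero_mem _
  · exact Submodule.sum_mem _ fun k _ => hs _ _ _ ⟨rfl, rfl⟩
  · split_ifs with h
    · exact hs _ _ _ ⟨by simp [h.2], rfl⟩
    · exact Submodule.zero_mem _
  · exact Submodule.sum_mem _ fun k _ => hs _ _ _ ⟨by simp, rfl⟩
  · split_ifs with h
    · exact Submodule.neg_mem _ (hs _ _ _ ⟨by simp [h.2], rfl⟩)
    · exact Submodule.zero_mem _
  · split_ifs with h
    · exact Submodule.neg_mem _ (hs _ _ _ ⟨by simp; omega, rfl⟩)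
    · exact Submodule.zero_mem _
  · split_ifs with h
    · exact Submodule.neg_mem _ (hs _ _ _ ⟨by simp [h.2], rfl⟩)
    · exact Submodule.zero_mem _
  · exact Submodule.sum_mem _ fun k _ => hs _ _ _ ⟨by simp, rfl⟩
  · split_ifs with h
    · exact hs _ _ _ ⟨by simp; omega, rfl⟩
    · exact Submodule.zero_mem _
  · split_ifs with h h h h
    · exact Submodule.zero_mem _
    · exact Submodule.sum_mem _ fun k _ => hs _ _ _ ⟨by simp [h], rfl⟩
    · exact Submodule.sum_mem _ fun k _ => hs _ _ _ ⟨by simp [h], rfl⟩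
    · exact Submodule.sum_mem _ fun k _ => Submodule.add_mem _ (hs _ _ _ ⟨by simp; ring, rfl⟩)
        (hs _ _ _ ⟨by simp; omega, rfl⟩)
    · exact Submodule.sum_mem _ fun k _ => Submodule.add_mem _ (hs _ _ _ ⟨by simp; ring, rfl⟩)
        (Submodule.zero_mem _)

/-- The factors are half of the structure constants: `2 · (-1/4) = -1/2` for `W^*` and `2 · 1/(4m) =
1/(2m)` for `x^*_m`. For `m = 0` the convention `1 / 0 = 0` leaves `x^*_0` uncorrected, as it
should. -/
theorem isDecoupling_loop :
    IsDecoupling loopB .hbar loopMix loopFactor loopDir loopDeg where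
  even _ := rfl
  homogeneous a b _ hc := ((Finsupp.mem_supported ℂ _).1 (loopB_bracket_mem a b) hc).1
  deg_z := rfl
  s_z := rfl
  bracket_z _ := rfl
  mix_psi y i n := by cases y <;> rfl
  mix_psis y j n := by
    rcases y with i | i | ⟨i, m⟩ | ⟨i, m⟩ | _ <;>
      simp only [loopMix, loopFactor, loopDir, loopDeg, mul_zero, zero_mul, Finsupp.single_zero,
        Finset.sum_const_zero]
    · refine Finset.sum_congr rfl fun k _ => ?_
      rw [zero_add]
      congr 1
      ring
    · split_ifs with h
      · simp [h]
      · refine Finset.sum_congr rfl fun k _ => ?_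
        congr 1
        field_simp
        ring
  deg_eq y hy := by
    rcases y with i | i | ⟨i, m⟩ | ⟨i, m⟩ | _
    · exact absurd rfl hy
    · rfl
    · exact absurd rfl hy
    · rfl
    · exact absurd rfl hy
  s_bracket a b _ hc := ((Finsupp.mem_supported ℂ _).1 (loopB_bracket_mem a b) hc).2

section Loop

variable {U : TopologicalSpace.Opens E}

theorem loopShift_eq (y : LGen) (v : Hs U) : loopShift U y v =
    loopFactor y • quad loopB .hbar loopMix (loopAction U) (loopDir y) (loopDeg y) v := by
  rcases y with i | i | ⟨i, m⟩ | ⟨i, m⟩ | _ <;>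
    simp only [loopShift, loopFactor, loopDir, loopDeg, zero_smul, neg_smul]
  split_ifs with h
  · simp [h]
  · rfl

theorem lb_hbar (v : Hs U) : lb U .hbar v = v :=
  LinearMap.congr_fun (isDecoupling_loop.bAct_central (ρ := loopAction U) rfl) v

theorem lb_lb (a b : LGen) (v : Hs U) : lb U a (lb U b v) = lb U b (lb U a v) +
    Finsupp.linearCombination ℂ (lb U) (loopB.bracket a b) v :=
  isDecoupling_loop.bAct_bAct a b v

theorem lb_comm {a b : LGen} (h : loopB.bracket a b = 0) (v : Hs U) :
    lb U a (lb U b v) = lb U b (lb U a v) := by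
  rw [lb_lb, h, map_zero, LinearMap.zero_apply, add_zero]

theorem lb_xs_x (i j : Fin 3) (m n : ℤ) (v : Hs U) :
    lb U (.xs i m) (lb U (.x j n) v) = lb U (.x j n) (lb U (.xs i m) v) +
      (if i = j ∧ m + n = 0 ∧ n ≠ 0 then 1 / (n : ℂ) else 0) • v := by
  rw [lb_lb]
  congr 1
  simp only [loopB]
  split_ifs
  · rw [Finsupp.linearCombination_single, LinearMap.smul_apply, lb_hbar]
  · rw [map_zero, LinearMap.zero_apply, zero_smul]

theorem lb_x_fAct (i : Fin 3) (n : ℤ) (f : FGen) (v : Hs U) :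
    lb U (.x i n) (lf U f v) = lf U f (lb U (.x i n) v) := by
  rw [isDecoupling_loop.bAct_fAct, show loopMix (.x i n) f = 0 by cases f <;> rfl, map_zero,
    LinearMap.zero_apply, add_zero]

/-- The derivation by which a zero mode acts on functions. -/
def loopDer (U : TopologicalSpace.Opens E) : LGen → Smooth U →ₗ[ℂ] Smooth U
  | .W i => dualD U i
  | .Ws i => twistedD U (1 / 2) i
  | _ => 0

/-- The operators in the commutators of the modes with multiplication operators. -/
def loopX (U : TopologicalSpace.Opens E) : LGen → Fin 3 → Hs U →ₗ[ℂ] Hs U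
  | .xs i n => fun j => ∑ k, ((eps i j k : ℂ) / (2 * n)) • lb U (.x k n)
  | _ => 0

theorem loopX_xs (i : Fin 3) (n : ℤ) (j : Fin 3) (v : Hs U) : loopX U (.xs i n) j v =
    ∑ k, ((eps i j k : ℂ) / (2 * n)) • lb U (.x k n) v := by
  simp only [loopX, LinearMap.sum_apply, LinearMap.smul_apply]

/-- For `n = 0` the coefficients are divided by zero and vanish. Hence only `x_n` with `n ≠ 0`
matter, which is essential for `T = W^*_i`: it does not commute with `x_0`. -/
theorem loopX_comm_of {T : Hs U →ₗ[ℂ] Hs U}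
    (h : ∀ k n v, n ≠ 0 → T (lb U (.x k n) v) = lb U (.x k n) (T v)) (y : LGen) (j : Fin 3)
    (v : Hs U) : T (loopX U y j v) = loopX U y j (T v) := by
  rcases y with i | i | ⟨i, m⟩ | ⟨i, m⟩ | _ <;>
    try exact map_zero T
  rw [loopX_xs, loopX_xs, map_sum]
  refine Finset.sum_congr rfl fun k _ => ?_
  rw [map_smul]
  by_cases hm : m = 0
  · simp [hm]
  · rw [h k m v hm]

/-- The central term `1/n` of `[x^*, x]` multiplies the coefficient `ε/(2n)`. -/
theorem lb_xs_loopX (i i' : Fin 3) (m n : ℤ) (j : Fin 3) (v : Hs U) :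
    lb U (.xs i m) (loopX U (.xs i' n) j v) = loopX U (.xs i' n) j (lb U (.xs i m) v) +
      (if m + n = 0 ∧ n ≠ 0 then (eps i' j i : ℂ) / (2 * n ^ 2) else 0) • v := by
  rw [loopX_xs, loopX_xs, map_sum]
  simp only [map_smul, lb_xs_x, smul_add, Finset.sum_add_distrib, smul_smul]
  congr 1
  rw [← Finset.sum_smul]
  congr 1
  by_cases h : m + n = 0 ∧ n ≠ 0
  · have h2 := h.2
    simp only [h, ne_eq, not_false_eq_true, and_self, and_true, if_true, mul_ite, mul_zero,
      Finset.sum_ite_eq, Finset.mem_univ]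
    have : (n : ℂ) ≠ 0 := by exact_mod_cast h2
    field_simp
  · rw [if_neg h]
    refine Finset.sum_eq_zero fun k _ => ?_
    rw [if_neg fun h' => h h'.2, mul_zero]

theorem mulBracket_loop_W (k : Fin 3) (F : Smooth U →ₗ[ℂ] Hs U) (g : Smooth U) :
    mulBracket (loopDer U) (dualD U) (loopX U) (.W k) F g = F (dualD U k g) := by
  rw [mulBracket_apply]
  simp [loopDer, loopX]

theorem mulBracket_loop_x (k : Fin 3) (n : ℤ) :
    mulBracket (loopDer U) (dualD U) (loopX U) (.x k n) = 0 :=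
  LinearMap.ext fun F => LinearMap.ext fun g => by
    rw [mulBracket_apply]; simp [loopDer, loopX]

theorem mulBracket_loop_hbar : mulBracket (loopDer U) (dualD U) (loopX U) .hbar = 0 :=
  LinearMap.ext fun F => LinearMap.ext fun g => by
    rw [mulBracket_apply]; simp [loopDer, loopX]

theorem mulBracket_loop_sum_x (r : Fin 3 → ℂ) (n : ℤ) : Finsupp.linearCombination ℂ
    (mulBracket (loopDer U) (dualD U) (loopX U)) (∑ k, Finsupp.single (LGen.x k n) (r k)) = 0 := by
  rw [map_sum]
  refine Finset.sum_eq_zero fun k _ => ?_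
  rw [Finsupp.linearCombination_single, mulBracket_loop_x, smul_zero]

/-- The `x` part of the bracket acts by zero on both sides. For `m = -n ≠ 0` the bracket also
contains `ε W / m^2`, which acts by `∂/∂x^*`; it is matched by two central terms, each contributing
`ε / (2 m^2)`. -/
theorem loop_bracket_xs (i i' : Fin 3) (m n : ℤ) (F : Smooth U →ₗ[ℂ] Hs U) (g : Smooth U) :
    Finsupp.linearCombination ℂ (mulBracket (loopDer U) (dualD U) (loopX U))
        (loopB.bracket (.xs i m) (.xs i' n)) F g =
      ∑ j, ((lb U (.xs i m) (loopX U (.xs i' n) j (F (dualD U j g))) -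
          loopX U (.xs i' n) j (lb U (.xs i m) (F (dualD U j g)))) -
        (lb U (.xs i' n) (loopX U (.xs i m) j (F (dualD U j g))) -
          loopX U (.xs i m) j (lb U (.xs i' n) (F (dualD U j g))))) := by
  have hxs := mulBracket_loop_sum_x (U := U)
  simp only [lb_xs_loopX, add_sub_cancel_left, loopB]
  by_cases hm : m = 0
  · by_cases hn : n = 0
    · subst hm hn; simp
    · rw [if_neg fun h => hn h.2, if_neg hn, if_pos hm, hxs]
      subst hm
      simp [hn]
  · by_cases hn : n = 0
    · rw [if_neg fun h => hm h.1, if_pos hn, hxs]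
      subst hn
      simp [hm]
    rw [if_neg fun h => hm h.1, if_neg hn, if_neg hm, Finset.sum_add_distrib, map_add, hxs,
      zero_add, map_sum, LinearMap.sum_apply, LinearMap.sum_apply]
    refine Finset.sum_congr rfl fun k _ => ?_
    rw [← sub_smul]
    by_cases h : m + n = 0
    · have hn' : (n : ℂ) = -m := by
        rw [show n = -m by omega]; push_cast; ring
      have e1 : eps i i' k = -eps i k i' := eps_swap_right _ _ _
      have e2 : eps i' k i = -eps i k i' := by
        rw [eps_swap_right i' i k, eps_swap_left i i' k, neg_neg, e1]
      have hm' : (m : ℂ) ≠ 0 := by exact_mod_cast hm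
      rw [if_pos h, if_pos ⟨h, hn⟩, if_pos ⟨by omega, hm⟩, Finsupp.linearCombination_single,
        LinearMap.smul_apply, LinearMap.smul_apply, mulBracket_loop_W, hn',
        e1, e2]
      congr 1
      push_cast
      field_simp
      ring
    · rw [if_neg h, if_neg fun h' => h h'.1, if_neg fun h' => h (by omega), map_zero, sub_zero,
        zero_smul]
      rfl

/-- Besides two modes `x^*`, the only pair with a contribution is two `W^*`, where it is the Lie
bracket of the vector fields. For all other pairs the derivations commute, `X` commutes with the
other mode, and the bracket consists of modes acting by zero. -/
theorem loop_bracket (a b : LGen) (F : Smooth U →ₗ[ℂ] Hs U) (g : Smooth U) :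
    Finsupp.linearCombination ℂ (mulBracket (loopDer U) (dualD U) (loopX U)) (loopB.bracket a b) F g =
    F (loopDer U a (loopDer U b g)) - F (loopDer U b (loopDer U a g)) +
      ∑ j, ((lb U a (loopX U b j (F (dualD U j g))) - loopX U b j (lb U a (F (dualD U j g)))) -
        (lb U b (loopX U a j (F (dualD U j g))) - loopX U a j (lb U b (F (dualD U j g))))) := by
  have hz : ∀ (P : Prop) [Decidable P] (r : ℂ), Finsupp.linearCombination ℂ
      (mulBracket (loopDer U) (dualD U) (loopX U))
      (if P then Finsupp.single LGen.hbar r else 0) = 0 := by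
    intro P _ r
    split_ifs
    · rw [Finsupp.linearCombination_single, mulBracket_loop_hbar, smul_zero]
    · exact map_zero _
  have hz' : ∀ (P : Prop) [Decidable P] (r : ℂ), Finsupp.linearCombination ℂ
      (mulBracket (loopDer U) (dualD U) (loopX U))
      (if P then -Finsupp.single LGen.hbar r else 0) = 0 := by
    intro P _ r
    split_ifs
    · rw [← Finsupp.single_neg, Finsupp.linearCombination_single, mulBracket_loop_hbar, smul_zero]
    · exact map_zero _
  have hc : ∀ (y : LGen), (∀ k n, n ≠ 0 → loopB.bracket y (.x k n) = 0) → ∀ y' j v,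
      lb U y (loopX U y' j v) - loopX U y' j (lb U y v) = 0 := fun y hy y' j v =>
    sub_eq_zero.2 (loopX_comm_of (T := lb U y) (fun k n v hn => lb_comm (hy k n hn) v) y' j v)
  have hcW : ∀ i y' j v, lb U (.W i) (loopX U y' j v) - loopX U y' j (lb U (.W i) v) = 0 :=
    fun i => hc (.W i) fun _ _ _ => rfl
  have hcWs : ∀ i y' j v, lb U (.Ws i) (loopX U y' j v) - loopX U y' j (lb U (.Ws i) v) = 0 :=
    fun i => hc (.Ws i) fun _ _ hn => if_neg fun h => hn h.2
  have hcx : ∀ i m y' j v, lb U (.x i m) (loopX U y' j v) - loopX U y' j (lb U (.x i m) v) = 0 :=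
    fun i m => hc (.x i m) fun _ _ _ => rfl
  have hch : ∀ y' j v, lb U .hbar (loopX U y' j v) - loopX U y' j (lb U .hbar v) = 0 :=
    hc .hbar fun _ _ _ => rfl
  have hX0 : ∀ y j v, (∀ i n, y ≠ .xs i n) → loopX U y j v = 0 := by
    intro y j v hy
    rcases y with i | i | ⟨i, m⟩ | ⟨i, m⟩ | _
    · rfl
    · rfl
    · rfl
    · exact absurd rfl (hy i m)
    · rfl
  have hxs := mulBracket_loop_sum_x (U := U)
  rcases a with i | i | ⟨i, m⟩ | ⟨i, m⟩ | _
  · simp only [hcW, zero_sub]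
    rcases b with i' | i' | ⟨i', n⟩ | ⟨i', n⟩ | _
    · simp only [hcW, neg_zero, Finset.sum_const_zero, add_zero, loopDer, dualD_comm i i',
        sub_self]
      rfl
    · simp only [hcWs, neg_zero, Finset.sum_const_zero, add_zero, loopDer, dualD_twistedD,
        sub_self]
      rfl
    · simp only [hcx, neg_zero, Finset.sum_const_zero, add_zero, loopDer, LinearMap.zero_apply,
        map_zero, sub_self]
      rfl
    · simp only [hX0 (.W i) _ _ (fun _ _ => LGen.noConfusion), map_zero, sub_self, neg_zero,
        Finset.sum_const_zero, add_zero, loopDer, LinearMap.zero_apply]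
      exact LinearMap.congr_fun (LinearMap.congr_fun (hz _ _) F) g
    · simp only [hch, neg_zero, Finset.sum_const_zero, add_zero, loopDer, LinearMap.zero_apply,
        map_zero, sub_self]
      rfl
  · simp only [hcWs, hX0 (.Ws i) _ _ (fun _ _ => LGen.noConfusion), map_zero, sub_self,
      Finset.sum_const_zero, add_zero]
    rcases b with i' | i' | ⟨i', n⟩ | ⟨i', n⟩ | _
    · simp only [loopDer, dualD_twistedD, sub_self]
      rfl
    · simp only [loopDer]
      rw [← map_sub, twistedD_comm, map_sum]
      simp only [loopB]
      rw [map_sum, LinearMap.sum_apply, LinearMap.sum_apply]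
      refine Finset.sum_congr rfl fun k _ => ?_
      rw [Finsupp.linearCombination_single, LinearMap.smul_apply, LinearMap.smul_apply,
        mulBracket_loop_W, map_smul]
      congr 1
      push_cast
      ring
    · simp only [loopDer, LinearMap.zero_apply, map_zero, sub_self]
      exact LinearMap.congr_fun (LinearMap.congr_fun (hz _ _) F) g
    · simp only [loopDer, LinearMap.zero_apply, map_zero, sub_self]
      exact LinearMap.congr_fun (LinearMap.congr_fun (hxs _ _) F) g
    · simp only [loopDer, LinearMap.zero_apply, map_zero, sub_self]
      rfl
  · simp only [hcx, hX0 (.x i m) _ _ (fun _ _ => LGen.noConfusion), map_zero, sub_self,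
      Finset.sum_const_zero, add_zero, loopDer, LinearMap.zero_apply]
    rcases b with i' | i' | ⟨i', n⟩ | ⟨i', n⟩ | _
    · rfl
    · exact LinearMap.congr_fun (LinearMap.congr_fun (hz' _ _) F) g
    · rfl
    · exact LinearMap.congr_fun (LinearMap.congr_fun (hz' _ _) F) g
    · rfl
  · simp only [loopDer, LinearMap.zero_apply, map_zero, sub_self, zero_add]
    rcases b with i' | i' | ⟨i', n⟩ | ⟨i', n⟩ | _
    · simp only [hcW, hX0 (.W i') _ _ (fun _ _ => LGen.noConfusion), map_zero, sub_self,
        Finset.sum_const_zero]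
      exact LinearMap.congr_fun (LinearMap.congr_fun (hz' _ _) F) g
    · simp only [hcWs, hX0 (.Ws i') _ _ (fun _ _ => LGen.noConfusion), map_zero, sub_self,
        Finset.sum_const_zero]
      exact LinearMap.congr_fun (LinearMap.congr_fun (hxs _ _) F) g
    · simp only [hcx, hX0 (.x i' n) _ _ (fun _ _ => LGen.noConfusion), map_zero, sub_self,
        Finset.sum_const_zero]
      exact LinearMap.congr_fun (LinearMap.congr_fun (hz _ _) F) g
    · exact loop_bracket_xs i i' m n F g
    · simp only [hch, hX0 .hbar _ _ (fun _ _ => LGen.noConfusion), map_zero, sub_self,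
        Finset.sum_const_zero]
      rfl
  · simp only [hch, hX0 .hbar _ _ (fun _ _ => LGen.noConfusion), map_zero, sub_self,
      Finset.sum_const_zero, add_zero, loopDer, LinearMap.zero_apply]
    rfl

theorem mulData_loop : MulData loopB .hbar loopMix (loopAction U) (mulSmooth U) (loopDer U)
    (dualD U) (loopX U) where
  X_fAct y j f v :=
    (loopX_comm_of (T := lf U f) (fun k n v _ => (lb_x_fAct k n f v).symm) y j v).symm
  X_comm a b j l v := by
    rcases a with i | i | ⟨i, m⟩ | ⟨i, m⟩ | _ <;>
      try exact (map_zero (loopX U b l)).symm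
    exact loopX_comm_of (T := loopX U (.xs i m) j) (fun k n v _ => (loopX_comm_of
      (T := lb U (.x k n)) (fun _ _ _ _ => lb_comm rfl _) (.xs i m) j v).symm) b l v
  pd_comm := dualD_comm
  pd_δ j y g := by
    rcases y with i | i | ⟨i, m⟩ | ⟨i, m⟩ | _ <;> simp only [loopDer, LinearMap.zero_apply, map_zero]
    · exact dualD_comm _ _ _
    · exact dualD_twistedD _ _ _ _
  bracket := loop_bracket
  X_vac y j c hy := by
    rcases y with i | i | ⟨i, m⟩ | ⟨i, m⟩ | _ <;> try rfl
    rw [loopX_xs]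
    refine Finset.sum_eq_zero fun k _ => ?_
    -- In degree zero the coefficient `1 / (2 · 0)` is zero; in positive degree `x_m` kills
    -- functions.
    rcases (show 0 ≤ m by simpa [loopB] using hy).eq_or_lt with rfl | hm
    · simp
    · rw [bAct_vac (y := LGen.x k m) hy, extendedAction, if_neg (by simp [loopB]; omega), LinearMap.zero_apply,
        map_zero, smul_zero]
  leibniz y g c hy := by
    have key : ∀ y, loopAction U y (mulSmooth U g c) =
        mulSmooth U (loopDer U y g) c + mulSmooth U g (loopAction U y c) := by
      intro y
      rcases y with i | i | ⟨i, m⟩ | ⟨i, m⟩ | _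
      · exact derivFn_mul _ (contDiff_dualField i) g c
      · exact derivFn_mul _ (contDiff_twistedField _ i) g c
      · simp only [loopDer, LinearMap.zero_apply, map_zero, zero_add]
        exact Smooth.ext' fun p _ => mul_left_comm _ _ _
      · simp only [loopDer, LinearMap.zero_apply, map_zero, zero_add]
        exact Smooth.ext' fun p _ => mul_left_comm _ _ _
      · simp only [loopDer, LinearMap.zero_apply, map_zero, zero_add]
        rfl
    unfold extendedAction
    split_ifs with h
    · exact key y
    · rcases y with i | i | ⟨i, m⟩ | ⟨i, m⟩ | _
      · exact absurd rfl h
      · exact absurd rfl h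
      · simp [loopDer]
      · simp [loopDer]
      · exact absurd rfl h

theorem existsUnique_isMultiplication (U : TopologicalSpace.Opens E) :
    ∃! M, IsMultiplication U M := by
  have hX : ∀ (M : Smooth U →ₗ[ℂ] Hs U →ₗ[ℂ] Hs U) g i n v,
      ∑ j, loopX U (.xs i n) j (M (dualD U j g) v) = ∑ j, ∑ k, ((eps i j k : ℂ) / (2 * n)) •
        lb U (.x k n) (M (derivFn U (dualField j) (contDiff_dualField j) g) v) :=
    fun M g i n v => Finset.sum_congr rfl fun j _ => loopX_xs _ _ _ _
  obtain ⟨M, h1, h2, h3⟩ := (mulData_loop (U := U)).exists_mul isDecoupling_loop rfl rfl rfl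
  have hM : IsMultiplication U M := by
    refine ⟨h1, fun g i n v => ?_, h2, fun g i n v _ => ?_⟩
    · refine (sub_eq_zero.1 ((h3 (.x i n) g v).trans ?_)).symm
      simp [loopDer, loopX]
    · rw [h3, hX]
      simp [loopDer]
  refine ⟨M, hM, fun M' hM' => ?_⟩
  -- All even creation modes are `x_m` or `x^*_m` with `m < 0`, for which the commutator is
  -- prescribed. The commutators with zero modes are not needed for uniqueness.
  have hb : ∀ M, IsMultiplication U M → ∀ y, loopB.deg y < 0 → ∀ g v,
      lb U y (M g v) - M g (lb U y v) = ∑ j, loopX U y j (M (dualD U j g) v) := by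
    intro M hM y hy g v
    rcases y with i | i | ⟨i, m⟩ | ⟨i, m⟩ | _
    · exact absurd hy (lt_irrefl _)
    · exact absurd hy (lt_irrefl _)
    · rw [hM.2.1, sub_self]
      exact (Finset.sum_eq_zero fun _ _ => rfl).symm
    · rw [hX]
      exact hM.2.2.2 g i m v (by rintro rfl; exact absurd hy (lt_irrefl _))
    · exact absurd hy (lt_irrefl _)
  exact isDecoupling_loop.mul_unique (fun g c => (hM'.1 g c).trans (hM.1 g c).symm) hM'.2.2.1
    hM.2.2.1 (hb M' hM') (hb M hM)

end Loop

/-! ### Quadratic modes of commuting modes -/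

section Quadratic

variable {H : Type} [AddCommGroup H] [Module ℂ H] {X : Fin 3 → ℤ → H →ₗ[ℂ] H}
  {F : ℤ → Submodule ℂ H}

/-- Commuting modes of a given degree on a filtered space without vectors of positive degree. -/
structure CommutingModes (X : Fin 3 → ℤ → H →ₗ[ℂ] H) (F : ℤ → Submodule ℂ H) : Prop where
  pos : ∀ e, 0 < e → ∀ v ∈ F e, v = 0
  exhaustive : ∀ v, ∃ e, v ∈ F e
  comm : ∀ i j m n v, X i m (X j n v) = X j n (X i m v)
  mem : ∀ i n e, ∀ v ∈ F e, X i n v ∈ F (e + 2 * n)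

namespace CommutingModes

theorem finite_support (hX : CommutingModes X F) (j k : Fin 3) (n : ℤ) (v : H) :
    (Function.support fun m : ℤ => (m : ℂ) • X j (n - m) (X k m v)).Finite := by
  obtain ⟨e, he⟩ := hX.exhaustive v
  have hv : ∀ i m, |e| < m → X i m v = 0 := fun i m hm =>
    hX.pos _ (by have := neg_abs_le e; have := abs_nonneg e; omega) _ (hX.mem i m e v he)
  refine (Set.finite_Icc (n - |e|) |e|).subset fun m hm => ?_
  by_contra h
  refine hm ?_
  rcases lt_or_ge |e| m with h' | h'
  · simp only [hv k m h', map_zero, smul_zero]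
  · have : |e| < n - m := by
      by_contra h''
      exact h ⟨by omega, h'⟩
    simp only [hX.comm j k, hv j _ this, map_zero, smul_zero]

/-- The operator `∑_{j,k} ε_{ijk} ∑_m m x^j_{n-m} x^k_m / 2`. -/
def quadMode (hX : CommutingModes X F) (i : Fin 3) (n : ℤ) : H →ₗ[ℂ] H :=
  ∑ j, ∑ k, ((eps i j k : ℂ) / 2) •
    { toFun := fun v => ∑ᶠ m : ℤ, (m : ℂ) • X j (n - m) (X k m v)
      map_add' := fun v w => by
        rw [← finsum_add_distrib (hX.finite_support j k n v) (hX.finite_support j k n w)]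
        exact finsum_congr fun m => by simp only [map_add, smul_add]
      map_smul' := fun r v => by
        rw [RingHom.id_apply, smul_finsum]
        exact finsum_congr fun m => by simp only [map_smul, smul_comm r] }

theorem quadMode_apply (hX : CommutingModes X F) (i : Fin 3) (n : ℤ) (v : H) :
    hX.quadMode i n v = ∑ j, ∑ k, ((eps i j k : ℂ) / 2) •
      ∑ᶠ m : ℤ, (m : ℂ) • X j (n - m) (X k m v) := by
  simp only [quadMode, LinearMap.sum_apply, LinearMap.smul_apply]
  rfl

theorem quadMode_mem (hX : CommutingModes X F) (i : Fin 3) (n : ℤ) (P : Submodule ℂ H) {v : H}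
    (h : ∀ j k m, X j (n - m) (X k m v) ∈ P) : hX.quadMode i n v ∈ P := by
  rw [quadMode_apply]
  refine Submodule.sum_mem _ fun j _ => Submodule.sum_mem _ fun k _ => Submodule.smul_mem _ _ ?_
  exact finsum_induction (· ∈ P) P.zero_mem (fun _ _ => P.add_mem)
    fun m => P.smul_mem _ (h j k m)

theorem quadMode_mem_filt (hX : CommutingModes X F) (i : Fin 3) (n : ℤ) {e : ℤ} {v : H}
    (hv : v ∈ F e) : hX.quadMode i n v ∈ F (e + 2 * n) :=
  hX.quadMode_mem i n _ fun j k m => by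
    have := hX.mem j (n - m) _ _ (hX.mem k m e v hv)
    rwa [show e + 2 * m + 2 * (n - m) = e + 2 * n by ring] at this

theorem commute_quadMode (hX : CommutingModes X F) {T : H →ₗ[ℂ] H}
    (h : ∀ i n v, T (X i n v) = X i n (T v)) (i : Fin 3) (n : ℤ) (v : H) :
    T (hX.quadMode i n v) = hX.quadMode i n (T v) := by
  rw [quadMode_apply, quadMode_apply]
  simp only [map_sum, map_smul]
  refine Finset.sum_congr rfl fun j _ => Finset.sum_congr rfl fun k _ => ?_
  rw [map_finsum T (hX.finite_support j k n v)]
  simp only [map_smul, h]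

/-- In degree zero the two indices are `m` and `-m`. Unless `m = 0`, where the factor `m` vanishes,
one of them is positive and can be applied first. -/
theorem quadMode_vacuum (hX : CommutingModes X F) (i : Fin 3) {Ω : H}
    (hΩ : ∀ j n, 0 < n → X j n Ω = 0) : hX.quadMode i 0 Ω = 0 := by
  refine (Submodule.mem_bot ℂ).1 (?_ : _ ∈ (⊥ : Submodule ℂ H))
  rw [quadMode_apply]
  refine Submodule.sum_mem _ fun j _ => Submodule.sum_mem _ fun k _ => Submodule.smul_mem _ _ ?_
  refine finsum_induction (· ∈ (⊥ : Submodule ℂ H)) (zero_mem _) (fun _ _ => add_mem) fun m => ?_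
  rcases lt_trichotomy m 0 with hm | rfl | hm
  · rw [hX.comm, hΩ j (0 - m) (by omega), map_zero, smul_zero]; exact zero_mem _
  · rw [Int.cast_zero, zero_smul]; exact zero_mem _
  · rw [hΩ k m hm, map_zero, smul_zero]; exact zero_mem _

end CommutingModes

end Quadratic

/-! ### States with a bosonic field -/

section FieldStates

variable {H : Type} [AddCommGroup H] [Module ℂ H] {κ : Type} {cur : κ → ℤ → H → H}
  {base : H → LogField H → Prop}

theorem StateField.mem_of_stable {P : Submodule ℂ H} (hb : ∀ v A, base v A → v ∈ P)
    (hc : ∀ x n, n < 0 → ∀ v ∈ P, cur x n v ∈ P) {o p : Bool} {v : H} {A : LogField H}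
    (h : StateField cur o base p v A) : v ∈ P := by
  induction h with
  | base v A h => exact hb v A h
  | current x k p v A _ ih => exact hc x _ (by omega) v ih
  | add p v w A B _ _ ih1 ih2 => exact P.add_mem ih1 ih2
  | smul p r v A _ ih => exact P.smul_mem r ih

/-- The space of states that have a field, for even currents. -/
def fieldStates (cur : κ → ℤ → H → H) (base : H → LogField H → Prop) (h0 : ∃ A, base 0 A) :
    Submodule ℂ H where
  carrier := {v | ∃ A, StateField cur false base false v A}
  add_mem' := fun ⟨_, h1⟩ ⟨_, h2⟩ => ⟨_, .add _ _ _ _ _ h1 h2⟩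
  zero_mem' := h0.imp fun _ h => .base _ _ h
  smul_mem' := fun r _ ⟨_, h⟩ => ⟨_, .smul _ r _ _ h⟩

theorem cur_mem_fieldStates {h0 : ∃ A, base 0 A} (x : κ) {n : ℤ} (hn : n < 0) {v : H}
    (hv : v ∈ fieldStates cur base h0) : cur x n v ∈ fieldStates cur base h0 := by
  obtain ⟨k, rfl⟩ : ∃ k : ℕ, n = -(k : ℤ) - 1 := ⟨(-n - 1).toNat, by omega⟩
  obtain ⟨A, hA⟩ := hv
  exact ⟨_, .current x k _ _ _ hA⟩

/-- The scalar commutator brings back the vector `v` itself, so the induction carries the two claims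
that `v` and `T v` have fields. -/
theorem map_mem_fieldStates {h0 : ∃ A, base 0 A} {T : H →ₗ[ℂ] H}
    (hb : ∀ v A, base v A → T v ∈ fieldStates cur base h0)
    (hT : ∀ x n, n < 0 → ∃ r : ℂ, ∀ v, T (cur x n v) = cur x n (T v) + r • v) {v : H}
    (hv : v ∈ fieldStates cur base h0) : T v ∈ fieldStates cur base h0 := by
  obtain ⟨A, hA⟩ := hv
  refine (?_ : v ∈ fieldStates cur base h0 ⊓ (fieldStates cur base h0).comap T).2
  suffices ∀ p, StateField cur false base p v A →
      v ∈ fieldStates cur base h0 ⊓ (fieldStates cur base h0).comap T from this _ hA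
  intro p h
  refine StateField.mem_of_stable (P := fieldStates cur base h0 ⊓ (fieldStates cur base h0).comap T)
    (fun v A h => ⟨⟨A, .base _ _ h⟩, hb v A h⟩) ?_ h
  rintro x n hn v ⟨h1, h2⟩
  refine ⟨cur_mem_fieldStates x hn h1, ?_⟩
  obtain ⟨r, hr⟩ := hT x n hn
  refine (?_ : T (cur x n v) ∈ fieldStates cur base h0)
  rw [hr]
  exact Submodule.add_mem _ (cur_mem_fieldStates x hn h2) (Submodule.smul_mem _ r h1)

end FieldStates

/-! ### Bosonic fields on super-induced modules -/

section Bosonic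

variable {ι : Type} {B : ModeAlgebra ι} {z : ι} {mix : ι → FGen → (FGen →₀ ℂ)}
  {s : ι → ℂ} {dir : ι → Fin 3} {d : ι → ℤ}
  {C : Type} [AddCommGroup C] [Module ℂ C] {ρ : ι → C →ₗ[ℂ] C}
  {shift : ι → SuperInd B z mix ρ → SuperInd B z mix ρ}
  {Φ : (Ind B ρ ⊗[ℂ] Fock) ≃ₗ[ℂ] SuperInd B z mix ρ}
  {κ : Type} {cur : κ → ℤ → SuperInd B z mix ρ → SuperInd B z mix ρ}
  {O : ExpansionOps (SuperInd B z mix ρ) C}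

/-- The bosonic state-field correspondence generated from functions by even currents. -/
abbrev BosonState (cur : κ → ℤ → SuperInd B z mix ρ → SuperInd B z mix ρ)
    (O : ExpansionOps (SuperInd B z mix ρ) C) :
    SuperInd B z mix ρ → LogField (SuperInd B z mix ρ) → Prop :=
  StateField cur false (fun v A => ∃ f, v = sVac B z mix ρ f ∧ A = functionField O f) false

/-- The space of states with a bosonic field. -/
abbrev bosonStates (cur : κ → ℤ → SuperInd B z mix ρ → SuperInd B z mix ρ)
    (O : ExpansionOps (SuperInd B z mix ρ) C) : Submodule ℂ (SuperInd B z mix ρ) :=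
  fieldStates cur (fun v A => ∃ f, v = sVac B z mix ρ f ∧ A = functionField O f)
    ⟨functionField O 0, 0, (map_zero _).symm, rfl⟩

theorem vac_mem_bosonStates (f : C) : sVac B z mix ρ f ∈ bosonStates cur O :=
  ⟨_, .base _ _ ⟨f, rfl, rfl⟩⟩

/-- The states `Φ (h ⊗ |0⟩)`. -/
def bosonFactor (Φ : (Ind B ρ ⊗[ℂ] Fock) ≃ₗ[ℂ] SuperInd B z mix ρ) :
    Submodule ℂ (SuperInd B z mix ρ) :=
  LinearMap.range (Φ.toLinearMap ∘ₗ (TensorProduct.mk ℂ (Ind B ρ) Fock).flip fockVac)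

theorem mem_bosonFactor {v : SuperInd B z mix ρ} :
    v ∈ bosonFactor Φ ↔ ∃ h, v = Φ (h ⊗ₜ fockVac) :=
  ⟨fun ⟨h, e⟩ => ⟨h, e.symm⟩, fun ⟨h, e⟩ => ⟨h, e.symm⟩⟩

theorem IsDecoupling.tilde_mem_bosonFactor (D : IsDecoupling B z mix s dir d)
    (hρ : ρ z = LinearMap.id) (hshift : ∀ y v, shift y v = s y • quad B z mix ρ (dir y) (d y) v)
    (hΦ : IsFactorization B z mix ρ shift Φ) (y : ι) {v : SuperInd B z mix ρ}
    (hv : v ∈ bosonFactor Φ) : D.tilde hρ y v ∈ bosonFactor Φ := by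
  obtain ⟨h, rfl⟩ := mem_bosonFactor.1 hv
  exact mem_bosonFactor.2 ⟨_, D.factorization_tilde hρ hshift hΦ y h fockVac⟩

/-- One direction is stability of the bosonic factor under the currents. The other is induction over
creation modes of the first factor, which act through `Φ` by decoupled modes. -/
theorem IsDecoupling.bosonState_iff (D : IsDecoupling B z mix s dir d) (hρ : ρ z = LinearMap.id)
    (hshift : ∀ y v, shift y v = s y • quad B z mix ρ (dir y) (d y) v)
    (hΦ : IsFactorization B z mix ρ shift Φ)
    (hcur : ∀ x n, n < 0 → ∀ v ∈ bosonFactor Φ, cur x n v ∈ bosonFactor Φ)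
    (hneg : ∀ y, B.deg y < 0 → ∀ v ∈ bosonStates cur O, D.tilde hρ y v ∈ bosonStates cur O)
    (v : SuperInd B z mix ρ) :
    (∃ A, BosonState cur O v A) ↔ ∃ h, v = Φ (h ⊗ₜ fockVac) := by
  constructor
  · rintro ⟨A, h⟩
    refine mem_bosonFactor.1 (h.mem_of_stable ?_ hcur)
    rintro v A ⟨f, rfl, -⟩
    exact mem_bosonFactor.2 ⟨_, (hΦ.1 f).symm⟩
  · rintro ⟨h, rfl⟩
    refine ind_neg_induction D.homogeneous ((bosonStates cur O).comap
      (Φ.toLinearMap ∘ₗ (TensorProduct.mk ℂ (Ind B ρ) Fock).flip fockVac)) (fun c => ?_)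
      (fun y hy h hh => ?_) h
    · refine (?_ : Φ (vac B ρ c ⊗ₜ fockVac) ∈ bosonStates cur O)
      rw [hΦ.1]
      exact vac_mem_bosonStates c
    · refine (?_ : Φ (act B ρ y h ⊗ₜ fockVac) ∈ bosonStates cur O)
      rw [← D.factorization_tilde hρ hshift hΦ]
      exact hneg y hy _ hh

theorem bosonState_creates {F : ℤ → Submodule ℂ (SuperInd B z mix ρ)}
    (hcur : ∀ x, IsModes (cur x)) (hO : O.IsGraded F) {c : C}
    (hΩ : ∀ x n, 0 ≤ n → cur x n (sVac B z mix ρ c) = 0)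
    (ht : ∀ t : Term, t.right O (sVac B z mix ρ c) = 0 ∨
      (t.right O (sVac B z mix ρ c) = sVac B z mix ρ c ∧ 0 < t.zexp ∧ t.lexp = 0))
    (hmul : ∀ f, O.mul f (sVac B z mix ρ c) = sVac B z mix ρ f)
    {v : SuperInd B z mix ρ} {A : LogField (SuperInd B z mix ρ)} (h : BosonState cur O v A) :
    Creates (sVac B z mix ρ c) v A := by
  refine StateField.creates hcur ?_ hΩ ?_ h
  · rintro v A ⟨f, -, rfl⟩
    exact isField_functionField hO f
  · rintro v A ⟨f, rfl, rfl⟩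
    rw [← hmul f]
    exact creates_functionField hO f ht

/-- All ingredients of a bosonic field, the multiplication operators included, commute with each
fermionic mode; so do its coefficients. -/
theorem IsDecoupling.bosonState_trivialOPE (D : IsDecoupling B z mix s dir d)
    {F : ℤ → Submodule ℂ (SuperInd B z mix ρ)} (hcur : ∀ x, IsModes (cur x))
    (hO : O.IsGraded F)
    (h1 : ∀ f x n v, fAct B z mix ρ f (cur x n v) = cur x n (fAct B z mix ρ f v))
    (hx : ∀ f i n v, fAct B z mix ρ f (O.x i n v) = O.x i n (fAct B z mix ρ f v))
    (hw : ∀ f i v, fAct B z mix ρ f (O.w i v) = O.w i (fAct B z mix ρ f v))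
    (hy : ∀ f i n v, fAct B z mix ρ f (O.y i n v) = O.y i n (fAct B z mix ρ f v))
    (hd : ∀ f i v, fAct B z mix ρ f (O.d i v) = O.d i (fAct B z mix ρ f v))
    (hmul : ∀ f g v, fAct B z mix ρ f (O.mul g v) = O.mul g (fAct B z mix ρ f v))
    {v w Ω : SuperInd B z mix ρ} {A A' : LogField (SuperInd B z mix ρ)} {p : Bool}
    (h : BosonState cur O v A) (h' : FermionState B z mix ρ Ω p w A') : TrivialOPE A A' := by
  have hb : ∀ v A, (∃ f, v = sVac B z mix ρ f ∧ A = functionField O f) → IsField A := by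
    rintro v A ⟨f, -, rfl⟩
    exact isField_functionField hO f
  refine D.trivialOPE (StateField.isField hcur hb h) (fun f => ?_) h'
  refine StateField.commute hcur hb (fAct B z mix ρ f).isLinear (h1 f) ?_ h
  rintro v A ⟨g, -, rfl⟩
  exact functionField_commute hO (fAct B z mix ρ f).isLinear
    (Term.left_commute (fun i n _ => hx f i n) fun i n _ => hy f i n)
    (Term.right_commute (fun i n _ => hx f i n) (hw f) (fun i n _ => hy f i n) (hd f)) (hmul f) g

theorem IsDecoupling.tilde_central (D : IsDecoupling B z mix s dir d) (hρ : ρ z = LinearMap.id)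
    (v : SuperInd B z mix ρ) : D.tilde hρ z v = v := by
  rw [D.tilde_apply, D.s_z, zero_smul, add_zero, D.bAct_central hρ]; rfl

theorem IsDecoupling.tilde_tilde (D : IsDecoupling B z mix s dir d) (hρ : ρ z = LinearMap.id)
    (a b : ι) (v : SuperInd B z mix ρ) : D.tilde hρ a (D.tilde hρ b v) =
      D.tilde hρ b (D.tilde hρ a v) +
        Finsupp.linearCombination ℂ (D.tilde hρ) (B.bracket a b) v := by
  refine (D.isModeRep_tilde hρ a b v).trans ?_
  rw [D.even, show koszul false (B.odd b) = 1 by simp [koszul], one_smul]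

theorem IsDecoupling.tilde_comm (D : IsDecoupling B z mix s dir d) (hρ : ρ z = LinearMap.id)
    {a b : ι} (h : B.bracket a b = 0) (v : SuperInd B z mix ρ) :
    D.tilde hρ a (D.tilde hρ b v) = D.tilde hρ b (D.tilde hρ a v) := by
  rw [D.tilde_tilde, h, map_zero, LinearMap.zero_apply, add_zero]

end Bosonic

/-! ### Fields over a coordinate domain -/

section LoopFields

variable {U : TopologicalSpace.Opens E}

/-- The decoupled even modes, as linear maps. -/
def loopTilde (U : TopologicalSpace.Opens E) (y : LGen) : Hs U →ₗ[ℂ] Hs U :=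
  isDecoupling_loop.tilde (ρ := loopAction U) rfl y

theorem lt_eq (y : LGen) : lt U y = loopTilde U y := funext fun v => by
  rw [lt, loopShift_eq]; exact (isDecoupling_loop.tilde_apply rfl y v).symm

theorem loopTilde_comm {a b : LGen} (h : loopB.bracket a b = 0) (v : Hs U) :
    loopTilde U a (loopTilde U b v) = loopTilde U b (loopTilde U a v) :=
  isDecoupling_loop.tilde_comm rfl h v

theorem loopTilde_lf (y : LGen) (f : FGen) (v : Hs U) :
    lf U f (loopTilde U y v) = loopTilde U y (lf U f v) :=
  (isDecoupling_loop.tilde_fAct rfl y f v).symm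

theorem loopTilde_vac {y : LGen} (hy : 0 ≤ loopB.deg y) (c : Smooth U) :
    loopTilde U y (lvac U c) = lvac U (extendedAction loopB (loopAction U) y c) :=
  isDecoupling_loop.tilde_vac rfl hy c

/-- The degree filtration. -/
abbrev loopFilt (U : TopologicalSpace.Opens E) (e : ℤ) : Submodule ℂ (Hs U) :=
  sFilt loopB .hbar loopMix (loopAction U) e

theorem loopTilde_mem_filt (y : LGen) {e : ℤ} {v : Hs U} (hv : v ∈ loopFilt U e) :
    loopTilde U y v ∈ loopFilt U (e + loopB.deg y) :=
  isDecoupling_loop.tilde_mem_filt rfl y hv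

theorem commutingModes_loop :
    CommutingModes (fun i n => loopTilde U (.x i n)) (loopFilt U) where
  pos _ he _ hv := IsDecoupling.sFilt_pos he hv
  exhaustive := isDecoupling_loop.exists_mem_sFilt
  comm _ _ _ _ v := loopTilde_comm rfl v
  mem i n _ _ hv := loopTilde_mem_filt (.x i n) hv

/-- The operator `∑_{j,k} ε_{ijk} W^j x^k_n`. -/
def loopTwist (U : TopologicalSpace.Opens E) (i : Fin 3) (n : ℤ) : Hs U →ₗ[ℂ] Hs U :=
  ∑ j, ∑ k, (eps i j k : ℂ) • (loopTilde U (.W j) ∘ₗ loopTilde U (.x k n))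

theorem loopTwist_apply (i : Fin 3) (n : ℤ) (v : Hs U) : loopTwist U i n v =
    ∑ j, ∑ k, (eps i j k : ℂ) • loopTilde U (.W j) (loopTilde U (.x k n) v) := by
  simp only [loopTwist, LinearMap.sum_apply, LinearMap.smul_apply, LinearMap.comp_apply]

theorem loopTwist_mem (i : Fin 3) (n : ℤ) (P : Submodule ℂ (Hs U)) {v : Hs U}
    (h : ∀ j k, loopTilde U (.W j) (loopTilde U (.x k n) v) ∈ P) : loopTwist U i n v ∈ P := by
  rw [loopTwist_apply]
  exact Submodule.sum_mem _ fun j _ => Submodule.sum_mem _ fun k _ => Submodule.smul_mem _ _ (h j k)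

theorem loopTwist_mem_filt (i : Fin 3) (n : ℤ) {e : ℤ} {v : Hs U} (hv : v ∈ loopFilt U e) :
    loopTwist U i n v ∈ loopFilt U (e + 2 * n) :=
  loopTwist_mem i n _ fun j k => by
    have h := loopTilde_mem_filt (.W j) (loopTilde_mem_filt (.x k n) hv)
    rwa [show e + loopB.deg (.x k n) + loopB.deg (.W j) = e + 2 * n from add_zero _] at h

theorem commute_loopTwist {T : Hs U →ₗ[ℂ] Hs U}
    (hW : ∀ j v, T (loopTilde U (.W j) v) = loopTilde U (.W j) (T v))
    (hx : ∀ k n v, T (loopTilde U (.x k n) v) = loopTilde U (.x k n) (T v)) (i : Fin 3) (n : ℤ)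
    (v : Hs U) : T (loopTwist U i n v) = loopTwist U i n (T v) := by
  simp only [loopTwist_apply, map_sum, map_smul, hW, hx]

/-- The modes of the currents, as linear maps. -/
def loopCurrentMap (U : TopologicalSpace.Opens E) : Cur → ℤ → Hs U →ₗ[ℂ] Hs U
  | .alpha i, n => if n = 0 then loopTilde U (.W i) else (-(n : ℂ)) • loopTilde U (.x i n)
  | .beta i, n => (if n = 0 then loopTilde U (.Ws i) else (-(n : ℂ)) • loopTilde U (.xs i n))
      + loopTwist U i n + commutingModes_loop.quadMode i n

theorem loopCurrent_eq (x : Cur) (n : ℤ) : loopCurrent U x n = loopCurrentMap U x n := by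
  funext v
  cases x with
  | alpha i =>
    simp only [loopCurrent, loopCurrentMap, lt_eq]
    split_ifs <;> rfl
  | beta i =>
    simp only [loopCurrent, loopCurrentMap, lt_eq, LinearMap.add_apply, loopTwist_apply,
      CommutingModes.quadMode_apply]
    split_ifs <;> rfl

theorem loopCurrentMap_mem (P : Submodule ℂ (Hs U)) (h : ∀ y, ∀ v ∈ P, loopTilde U y v ∈ P)
    (x : Cur) (n : ℤ) {v : Hs U} (hv : v ∈ P) : loopCurrentMap U x n v ∈ P := by
  cases x with
  | alpha i =>
    simp only [loopCurrentMap]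
    split_ifs
    · exact h _ v hv
    · exact P.smul_mem _ (h _ v hv)
  | beta i =>
    refine P.add_mem (P.add_mem ?_ (loopTwist_mem i n P fun _ _ => h _ _ (h _ v hv)))
      (commutingModes_loop.quadMode_mem i n P fun _ _ _ => h _ _ (h _ v hv))
    split_ifs
    · exact h _ v hv
    · exact P.smul_mem _ (h _ v hv)

theorem loopCurrentMap_mem_filt (x : Cur) (n : ℤ) {e : ℤ} {v : Hs U} (hv : v ∈ loopFilt U e) :
    loopCurrentMap U x n v ∈ loopFilt U (e + 2 * n) := by
  have h0 : ∀ y : LGen, n = 0 → loopB.deg y = 0 → loopTilde U y v ∈ loopFilt U (e + 2 * n) := by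
    intro y hn hy
    have := loopTilde_mem_filt y hv
    rwa [hy, ← show 2 * n = 0 by omega] at this
  cases x with
  | alpha i =>
    simp only [loopCurrentMap]
    split_ifs with hn
    · exact h0 _ hn rfl
    · exact Submodule.smul_mem _ _ (loopTilde_mem_filt (.x i n) hv)
  | beta i =>
    refine Submodule.add_mem _ (Submodule.add_mem _ ?_ (loopTwist_mem_filt i n hv))
      (commutingModes_loop.quadMode_mem_filt i n hv)
    split_ifs with hn
    · exact h0 _ hn rfl
    · exact Submodule.smul_mem _ _ (loopTilde_mem_filt (.xs i n) hv)

theorem commute_loopCurrentMap {T : Hs U →ₗ[ℂ] Hs U}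
    (h : ∀ y v, T (loopTilde U y v) = loopTilde U y (T v)) (x : Cur) (n : ℤ) (v : Hs U) :
    T (loopCurrentMap U x n v) = loopCurrentMap U x n (T v) := by
  cases x with
  | alpha i =>
    simp only [loopCurrentMap]
    split_ifs
    · exact h _ v
    · simp only [LinearMap.smul_apply, map_smul, h]
  | beta i =>
    simp only [loopCurrentMap, LinearMap.add_apply, map_add,
      commute_loopTwist (fun j => h (.W j)) (fun k n => h (.x k n)),
      commutingModes_loop.commute_quadMode fun i n => h (.x i n)]
    congr 2
    split_ifs
    · exact h _ v
    · simp only [LinearMap.smul_apply, map_smul, h]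

theorem isModes_loopCurrent (x : Cur) : IsModes (loopCurrent U x) where
  linear n := by rw [loopCurrent_eq]; exact (loopCurrentMap U x n).isLinear
  bounded v := by
    obtain ⟨e, he⟩ := commutingModes_loop.exhaustive v
    refine ⟨|e| + 1, fun n hn => ?_⟩
    rw [loopCurrent_eq]
    refine commutingModes_loop.pos _ ?_ _ (loopCurrentMap_mem_filt x n he)
    have := neg_abs_le e
    have := abs_nonneg e
    omega

theorem loopVacuum_mem_filt : loopVacuum U ∈ loopFilt U 0 := vac_mem_filt _ _ _

theorem loopTilde_x_vacuum (i : Fin 3) (n : ℤ) (hn : 0 < n) :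
    loopTilde U (.x i n) (loopVacuum U) = 0 :=
  commutingModes_loop.pos _ (by simp [loopB]; omega) _
    (loopTilde_mem_filt (.x i n) loopVacuum_mem_filt)

theorem loopTilde_W_vacuum (i : Fin 3) : loopTilde U (.W i) (loopVacuum U) = 0 := by
  refine (loopTilde_vac (y := .W i) le_rfl _).trans ?_
  rw [extendedAction, if_pos (show loopB.deg (.W i) = 0 from rfl), loopAction, derivFn_one, map_zero]

theorem loopTilde_Ws_vacuum (i : Fin 3) : loopTilde U (.Ws i) (loopVacuum U) = 0 := by
  refine (loopTilde_vac (y := .Ws i) le_rfl _).trans ?_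
  rw [extendedAction, if_pos (show loopB.deg (.Ws i) = 0 from rfl), loopAction, derivFn_one, map_zero]

theorem loopTilde_W_x_vacuum (i k : Fin 3) (n : ℤ) :
    loopTilde U (.W i) (loopTilde U (.x k n) (loopVacuum U)) = 0 := by
  rw [loopTilde_comm rfl, loopTilde_W_vacuum, map_zero]

theorem loopCurrent_vacuum (x : Cur) (n : ℤ) (hn : 0 ≤ n) :
    loopCurrent U x n (loopVacuum U) = 0 := by
  rw [loopCurrent_eq]
  rcases hn.eq_or_lt with rfl | hn
  · cases x with
    | alpha i => exact loopTilde_W_vacuum i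
    | beta i =>
      simp only [loopCurrentMap, if_true, LinearMap.add_apply, loopTilde_Ws_vacuum,
        loopTwist_apply, loopTilde_W_x_vacuum, smul_zero, Finset.sum_const_zero, zero_add]
      exact commutingModes_loop.quadMode_vacuum i loopTilde_x_vacuum
  · exact commutingModes_loop.pos _ (by omega) _ (loopCurrentMap_mem_filt x n loopVacuum_mem_filt)

theorem loopOps_d (M : Smooth U →ₗ[ℂ] (Hs U →ₗ[ℂ] Hs U)) (i : Fin 3) :
    (loopOps U M).d i = loopTilde U (.Ws i) + (1 / 2 : ℂ) • loopTwist U i 0 := by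
  funext v
  simp only [loopOps, lt_eq, Pi.add_apply, Pi.smul_apply, loopTwist_apply, Finset.smul_sum,
    smul_smul]
  congr 1
  refine Finset.sum_congr rfl fun j _ => Finset.sum_congr rfl fun k _ => ?_
  congr 1
  ring

theorem isGraded_loopOps (M : Smooth U →ₗ[ℂ] (Hs U →ₗ[ℂ] Hs U)) :
    (loopOps U M).IsGraded (loopFilt U) := by
  have hl : ∀ y, IsLinearMap ℂ (lt U y) := fun y => by
    rw [lt_eq]; exact (loopTilde U y).isLinear
  have hm : ∀ y e, ∀ v ∈ loopFilt U e, lt U y v ∈ loopFilt U (e + loopB.deg y) := fun y e v hv => by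
    rw [lt_eq]; exact loopTilde_mem_filt y hv
  have h0 : ∀ y, loopB.deg y = 0 → ∀ e, ∀ v ∈ loopFilt U e, lt U y v ∈ loopFilt U e :=
    fun y hy e v hv => by
      have := hm y e v hv
      rwa [hy, add_zero] at this
  refine ExpansionOps.isGraded commutingModes_loop.pos commutingModes_loop.exhaustive
    (fun i n _ => hl _) (fun i => hl _) (fun i n _ => hl _) (fun i => ?_)
    (fun g => (M g).isLinear) (fun i n _ => hm (.x i n)) (fun i => h0 (.W i) rfl)
    (fun i n _ => hm (.xs i n)) (fun i e v hv => ?_)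
  · rw [loopOps_d]
    exact (loopTilde U (.Ws i) + (1 / 2 : ℂ) • loopTwist U i 0).isLinear
  · rw [loopOps_d]
    have h1 := loopTilde_mem_filt (.Ws i) hv
    have h2 := loopTwist_mem_filt i 0 hv
    rw [show loopB.deg (.Ws i) = 0 from rfl, add_zero] at h1
    rw [mul_zero, add_zero] at h2
    exact Submodule.add_mem _ h1 (Submodule.smul_mem _ _ h2)

theorem bosonicField_creates {M : Smooth U →ₗ[ℂ] (Hs U →ₗ[ℂ] Hs U)} (hM : IsMultiplication U M)
    {v : Hs U} {A : LogField (Hs U)} (h : BosonicField U M v A) : Creates (loopVacuum U) v A := by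
  have hxs : ∀ i n, 0 < n → (loopOps U M).y i n (loopVacuum U) = 0 := fun i n hn => by
    simp only [loopOps, lt_eq]
    exact commutingModes_loop.pos _ (by simp [loopB]; omega) _
      (loopTilde_mem_filt (.xs i n) loopVacuum_mem_filt)
  refine bosonState_creates isModes_loopCurrent (isGraded_loopOps M) loopCurrent_vacuum
    (Term.right_vacuum (fun i n hn => ?_) (fun i => ?_) (fun i => ?_) hxs (fun i => ?_))
    (fun f => ?_) h
  · simp only [loopOps, lt_eq]; exact loopTilde_x_vacuum i n hn
  · simp only [loopOps, lt_eq]; exact loopTilde_W_vacuum i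
  · simp only [loopOps, lt_eq, map_zero]
  · rw [loopOps_d]
    refine (congrArg₂ (· + ·) (loopTilde_Ws_vacuum i) (?_ : (1 / 2 : ℂ) • loopTwist U i 0
      (loopVacuum U) = 0)).trans (add_zero 0)
    simp only [loopTwist_apply, loopTilde_W_x_vacuum, smul_zero, Finset.sum_const_zero]
  · exact (hM.1 f _).trans (by rw [Smooth.mul_one])

theorem bosonicField_trivialOPE {M : Smooth U →ₗ[ℂ] (Hs U →ₗ[ℂ] Hs U)}
    (hM : IsMultiplication U M) {v w : Hs U} {A A' : LogField (Hs U)} {p : Bool}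
    (h : BosonicField U M v A) (h' : FermionicField U p w A') : TrivialOPE A A' := by
  have hc : ∀ f y v, lf U f (lt U y v) = lt U y (lf U f v) := fun f y v => by
    rw [lt_eq]; exact loopTilde_lf y f v
  refine isDecoupling_loop.bosonState_trivialOPE isModes_loopCurrent (isGraded_loopOps M)
    (fun f x n v => ?_) (fun f i n => hc f (.x i n)) (fun f i => hc f (.W i))
    (fun f i n => hc f (.xs i n)) (fun f i v => ?_) (fun f g v => (hM.2.2.1 g f v).symm) h h'
  · rw [loopCurrent_eq]
    exact commute_loopCurrentMap (T := lf U f) (fun y v => loopTilde_lf y f v) x n v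
  · simp only [loopOps, map_add, map_sum, map_smul, hc]

theorem loopTilde_x_xs (j i : Fin 3) (m n : ℤ) : ∃ r : ℂ, ∀ v : Hs U,
    loopTilde U (.x j m) (loopTilde U (.xs i n) v) =
      loopTilde U (.xs i n) (loopTilde U (.x j m) v) + r • v := by
  refine ⟨if i = j ∧ n + m = 0 ∧ m ≠ 0 then -(1 / (m : ℂ)) else 0, fun v => ?_⟩
  refine (isDecoupling_loop.tilde_tilde rfl (.x j m) (.xs i n) v).trans ?_
  congr 1
  rw [show loopB.bracket (.x j m) (.xs i n) = if i = j ∧ n + m = 0 ∧ m ≠ 0 then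
    -Finsupp.single .hbar (1 / (m : ℂ)) else 0 from rfl]
  split_ifs
  · rw [← Finsupp.single_neg, Finsupp.linearCombination_single, LinearMap.smul_apply]
    exact congrArg _ (isDecoupling_loop.tilde_central rfl v)
  · rw [map_zero, LinearMap.zero_apply, zero_smul]

/-- An operator commuting with `W` and `x` commutes with the twist and the quadratic part of `β`, so
its commutator with a current comes from `x^*` alone. -/
theorem exists_commutator_loopCurrent {T : Hs U →ₗ[ℂ] Hs U}
    (hW : ∀ j v, T (loopTilde U (.W j) v) = loopTilde U (.W j) (T v))
    (hx : ∀ k n v, T (loopTilde U (.x k n) v) = loopTilde U (.x k n) (T v))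
    (hxs : ∀ i n, n ≠ 0 → ∃ r : ℂ, ∀ v, T (loopTilde U (.xs i n) v) =
      loopTilde U (.xs i n) (T v) + r • v) (x : Cur) (n : ℤ) (hn : n < 0) :
    ∃ r : ℂ, ∀ v, T (loopCurrent U x n v) = loopCurrent U x n (T v) + r • v := by
  rw [loopCurrent_eq]
  cases x with
  | alpha i =>
    refine ⟨0, fun v => ?_⟩
    simp only [loopCurrentMap, if_neg hn.ne, LinearMap.smul_apply, map_smul, hx, zero_smul,
      add_zero]
  | beta i =>
    obtain ⟨r, hr⟩ := hxs i n hn.ne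
    refine ⟨-(n : ℂ) * r, fun v => ?_⟩
    simp only [loopCurrentMap, if_neg hn.ne, LinearMap.add_apply, map_add,
      commute_loopTwist hW hx, commutingModes_loop.commute_quadMode hx, LinearMap.smul_apply,
      map_smul, hr]
    module

/-- Modes `x_m` of every degree are included because all of them occur in the quadratic part of `β`.
On functions, `x_m` with `m < 0` is a multiple of a mode of `α`, and the other modes act on
functions. -/
theorem loopTilde_mem_bosonStates_of_comm {O : ExpansionOps (Hs U) (Smooth U)} {y : LGen}
    (hy : (∃ j, y = .W j) ∨ ∃ j m, y = .x j m) {v : Hs U}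
    (hv : v ∈ bosonStates (loopCurrent U) O) :
    loopTilde U y v ∈ bosonStates (loopCurrent U) O := by
  refine map_mem_fieldStates ?_ (exists_commutator_loopCurrent ?_ ?_ ?_) hv
  · rintro _ A ⟨f, rfl, -⟩
    rcases lt_or_ge (loopB.deg y) 0 with h | h
    · rcases hy with ⟨j, rfl⟩ | ⟨j, m, rfl⟩
      · exact absurd h (lt_irrefl _)
      · have hm : m < 0 := by simp only [loopB] at h; omega
        have hc := cur_mem_fieldStates (.alpha j) hm
          (vac_mem_bosonStates (cur := loopCurrent U) (O := O) f)
        rw [loopCurrent_eq] at hc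
        simp only [loopCurrentMap, if_neg hm.ne, LinearMap.smul_apply] at hc
        exact (Submodule.smul_mem_iff _ (neg_ne_zero.2 (Int.cast_ne_zero.2 hm.ne))).1 hc
    · rw [loopTilde_vac h]
      exact vac_mem_bosonStates _
  · intro j v
    rcases hy with ⟨i, rfl⟩ | ⟨i, m, rfl⟩ <;> exact loopTilde_comm rfl v
  · intro j n v
    rcases hy with ⟨i, rfl⟩ | ⟨i, m, rfl⟩ <;> exact loopTilde_comm rfl v
  · intro i n hn
    rcases hy with ⟨j, rfl⟩ | ⟨j, m, rfl⟩
    · refine ⟨0, fun v => ?_⟩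
      rw [loopTilde_comm (show loopB.bracket (.W j) (.xs i n) = 0 from if_neg fun h => hn h.2),
        zero_smul, add_zero]
    · exact loopTilde_x_xs j i m n

/-- The mode `β_n` is `-n x^*_n` plus terms in `W` and `x`, which preserve the states with a field.
For `n < 0` the equation is solved for `x^*_n`. -/
theorem loopTilde_mem_bosonStates {O : ExpansionOps (Hs U) (Smooth U)} (y : LGen)
    (hy : loopB.deg y < 0) (v : Hs U) (hv : v ∈ bosonStates (loopCurrent U) O) :
    loopTilde U y v ∈ bosonStates (loopCurrent U) O := by
  rcases y with i | i | ⟨i, n⟩ | ⟨i, n⟩ | _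
  · exact absurd hy (lt_irrefl _)
  · exact absurd hy (lt_irrefl _)
  · exact loopTilde_mem_bosonStates_of_comm (.inr ⟨i, n, rfl⟩) hv
  · have hn : n < 0 := by simp only [loopB] at hy; omega
    have hW : ∀ j {v}, v ∈ bosonStates (loopCurrent U) O →
        loopTilde U (.W j) v ∈ bosonStates (loopCurrent U) O := fun j _ =>
      loopTilde_mem_bosonStates_of_comm (.inl ⟨j, rfl⟩)
    have hx : ∀ j m {v}, v ∈ bosonStates (loopCurrent U) O →
        loopTilde U (.x j m) v ∈ bosonStates (loopCurrent U) O := fun j m _ =>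
      loopTilde_mem_bosonStates_of_comm (.inr ⟨j, m, rfl⟩)
    have hc := cur_mem_fieldStates (.beta i) hn hv
    rw [loopCurrent_eq] at hc
    simp only [loopCurrentMap, if_neg hn.ne, LinearMap.add_apply, LinearMap.smul_apply] at hc
    rw [Submodule.add_mem_iff_left _ (commutingModes_loop.quadMode_mem i n _ fun _ _ _ =>
      hx _ _ (hx _ _ hv)), Submodule.add_mem_iff_left _ (loopTwist_mem i n _ fun _ _ =>
      hW _ (hx _ _ hv))] at hc
    exact (Submodule.smul_mem_iff _ (neg_ne_zero.2 (Int.cast_ne_zero.2 hn.ne))).1 hc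
  · exact absurd hy (lt_irrefl _)

theorem bosonicField_iff {Φ : (Hb U ⊗[ℂ] Fock) ≃ₗ[ℂ] Hs U}
    (hΦ : IsFactorization loopB .hbar loopMix (loopAction U) (loopShift U) Φ)
    (M : Smooth U →ₗ[ℂ] (Hs U →ₗ[ℂ] Hs U)) (v : Hs U) :
    (∃ A, BosonicField U M v A) ↔ ∃ h, v = Φ (h ⊗ₜ fockVac) := by
  refine isDecoupling_loop.bosonState_iff rfl loopShift_eq hΦ (fun x n _ v hv => ?_)
    loopTilde_mem_bosonStates v
  rw [loopCurrent_eq]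
  exact loopCurrentMap_mem _ (fun y v hv =>
    isDecoupling_loop.tilde_mem_bosonFactor rfl loopShift_eq hΦ y hv) x n hv

end LoopFields

/-! ### The affine currents -/

section Affine

/-- The factor of the correction of an even mode. -/
def affineFactor : AGen → ℂ
  | .beta _ _ => 1 / 2
  | _ => 0

/-- The index of an even mode. -/
def affineDir : AGen → Fin 3
  | .beta i _ => i
  | _ => 0

/-- The degree of the correction of an even mode. -/
def affineDeg : AGen → ℤ
  | .beta _ n => n
  | _ => 0

theorem affineB_bracket_mem (a b : AGen) : affineB.bracket a b ∈
    Finsupp.supported ℂ ℂ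
      {c | affineB.deg c = affineB.deg a + affineB.deg b ∧ affineFactor c = 0} := by
  have hs : ∀ (S : Set AGen) (c : AGen) (r : ℂ), c ∈ S →
      Finsupp.single c r ∈ Finsupp.supported ℂ ℂ S := fun S c r h => Finsupp.single_mem_supported ℂ r h
  rcases a with ⟨i, m⟩ | ⟨i, m⟩ | _ <;> rcases b with ⟨j, n⟩ | ⟨j, n⟩ | _ <;>
    simp only [affineB] <;> try exact Submodule.zero_mem _
  · split_ifs with h
    · exact Submodule.neg_mem _ (hs _ _ _ ⟨by simp; omega, rfl⟩)
    · exact Submodule.zero_mem _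
  · split_ifs with h
    · exact hs _ _ _ ⟨by simp; omega, rfl⟩
    · exact Submodule.zero_mem _
  · exact Submodule.sum_mem _ fun k _ => hs _ _ _ ⟨by simp; ring, rfl⟩

theorem isDecoupling_affine :
    IsDecoupling affineB .one affineMix affineFactor affineDir affineDeg where
  even _ := rfl
  homogeneous a b _ hc := ((Finsupp.mem_supported ℂ _).1 (affineB_bracket_mem a b) hc).1
  deg_z := rfl
  s_z := rfl
  bracket_z _ := rfl
  mix_psi y i n := by cases y <;> rfl
  mix_psis y j n := by
    rcases y with ⟨i, m⟩ | ⟨i, m⟩ | _ <;>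
      simp only [affineMix, affineFactor, affineDir, affineDeg, mul_zero, zero_mul,
        Finsupp.single_zero, Finset.sum_const_zero]
    refine Finset.sum_congr rfl fun k _ => ?_
    congr 1
    ring
  deg_eq y hy := by
    rcases y with ⟨i, m⟩ | ⟨i, m⟩ | _
    · exact absurd rfl hy
    · rfl
    · exact absurd rfl hy
  s_bracket a b _ hc := ((Finsupp.mem_supported ℂ _).1 (affineB_bracket_mem a b) hc).2

theorem affineShift_eq (y : AGen) (v : HsX) : affineShift y v =
    affineFactor y • quad affineB .one affineMix affineAction (affineDir y) (affineDeg y) v := by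
  rcases y with ⟨i, m⟩ | ⟨i, m⟩ | _ <;>
    simp only [affineShift, affineFactor, affineDir, affineDeg, zero_smul]

/-- Even modes on the super space over `X`. -/
abbrev ab (y : AGen) : HsX →ₗ[ℂ] HsX := bAct affineB .one affineMix affineAction y

/-- Odd modes on the super space over `X`. -/
abbrev af (f : FGen) : HsX →ₗ[ℂ] HsX := fAct affineB .one affineMix affineAction f

theorem ab_ab (a b : AGen) (v : HsX) : ab a (ab b v) = ab b (ab a v) +
    Finsupp.linearCombination ℂ ab (affineB.bracket a b) v :=
  isDecoupling_affine.bAct_bAct a b v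

theorem ab_comm {a b : AGen} (h : affineB.bracket a b = 0) (v : HsX) :
    ab a (ab b v) = ab b (ab a v) := by
  rw [ab_ab, h, map_zero, LinearMap.zero_apply, add_zero]

theorem ab_one (v : HsX) : ab .one v = v :=
  LinearMap.congr_fun (isDecoupling_affine.bAct_central (ρ := affineAction) rfl) v

theorem ab_beta_alpha (i j : Fin 3) (m n : ℤ) (v : HsX) :
    ab (.beta i m) (ab (.alpha j n) v) = ab (.alpha j n) (ab (.beta i m) v) +
      (if i = j ∧ m + n = 0 then (m : ℂ) else 0) • v := by
  rw [ab_ab]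
  congr 1
  simp only [affineB]
  split_ifs
  · rw [Finsupp.linearCombination_single, LinearMap.smul_apply, ab_one]
  · rw [map_zero, LinearMap.zero_apply, zero_smul]

theorem ab_alpha_af (i : Fin 3) (n : ℤ) (f : FGen) (v : HsX) :
    ab (.alpha i n) (af f v) = af f (ab (.alpha i n) v) := by
  rw [isDecoupling_affine.bAct_fAct, show affineMix (.alpha i n) f = 0 by cases f <;> rfl, map_zero,
    LinearMap.zero_apply, add_zero]

/-- The derivation by which a zero mode acts on functions. -/
def affineDer : AGen → SmoothX →ₗ[ℂ] SmoothX
  | .alpha i n => if n = 0 then dualX i else 0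
  | .beta i n => if n = 0 then twistedX i else 0
  | .one => 0

/-- The operators in the commutators of the modes with multiplication operators. -/
def affineMulX : AGen → Fin 3 → HsX →ₗ[ℂ] HsX
  | .beta i n => fun j => ∑ k, (-(eps i j k : ℂ) / (2 * n)) • ab (.alpha k n)
  | _ => 0

theorem affineMulX_beta (i : Fin 3) (n : ℤ) (j : Fin 3) (v : HsX) : affineMulX (.beta i n) j v =
    ∑ k, (-(eps i j k : ℂ) / (2 * n)) • ab (.alpha k n) v := by
  simp only [affineMulX, LinearMap.sum_apply, LinearMap.smul_apply]

theorem affineMulX_comm_of {T : HsX →ₗ[ℂ] HsX}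
    (h : ∀ k n v, T (ab (.alpha k n) v) = ab (.alpha k n) (T v)) (y : AGen) (j : Fin 3)
    (v : HsX) : T (affineMulX y j v) = affineMulX y j (T v) := by
  rcases y with ⟨i, m⟩ | ⟨i, m⟩ | _ <;>
    try exact map_zero T
  simp only [affineMulX_beta, map_sum, map_smul, h]

theorem ab_beta_affineMulX (i i' : Fin 3) (m n : ℤ) (j : Fin 3) (v : HsX) :
    ab (.beta i m) (affineMulX (.beta i' n) j v) = affineMulX (.beta i' n) j (ab (.beta i m) v) +
      (if m + n = 0 ∧ n ≠ 0 then (eps i' j i : ℂ) / 2 else 0) • v := by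
  rw [affineMulX_beta, affineMulX_beta, map_sum]
  simp only [map_smul, ab_beta_alpha, smul_add, Finset.sum_add_distrib, smul_smul]
  congr 1
  rw [← Finset.sum_smul]
  congr 1
  by_cases hn : n = 0
  · simp [hn]
  by_cases h : m + n = 0
  · simp only [h, hn, ne_eq, not_false_eq_true, and_self, and_true, if_true, mul_ite, mul_zero,
      Finset.sum_ite_eq, Finset.mem_univ]
    have hn' : (n : ℂ) ≠ 0 := by exact_mod_cast hn
    rw [show m = -n by omega]
    push_cast
    field_simp
  · rw [if_neg fun h' => h h'.1]
    refine Finset.sum_eq_zero fun k _ => ?_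
    rw [if_neg fun h' => h h'.2, mul_zero]

theorem mulBracket_affine_alpha (k : Fin 3) (n : ℤ) (F : SmoothX →ₗ[ℂ] HsX) (g : SmoothX) :
    mulBracket affineDer dualX affineMulX (.alpha k n) F g =
      if n = 0 then F (dualX k g) else 0 := by
  rw [mulBracket_apply]
  simp only [affineDer, affineMulX, Pi.zero_apply, LinearMap.zero_apply, Finset.sum_const_zero,
    add_zero]
  split_ifs
  · rfl
  · exact map_zero F

theorem mulBracket_affine_one : mulBracket affineDer dualX affineMulX .one = 0 :=
  LinearMap.ext fun F => LinearMap.ext fun g => by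
    rw [mulBracket_apply]; simp [affineDer, affineMulX]

/-- Only `α_0` in the bracket acts nontrivially, by `∂/∂x^*`. For `m = n = 0` this is the Lie
bracket of left invariant fields; for `m = -n ≠ 0` it is the sum of two central terms `ε/2`;
otherwise both sides vanish. -/
theorem affine_bracket_beta (i i' : Fin 3) (m n : ℤ) (F : SmoothX →ₗ[ℂ] HsX) (g : SmoothX) :
    Finsupp.linearCombination ℂ (mulBracket affineDer dualX affineMulX)
        (affineB.bracket (.beta i m) (.beta i' n)) F g =
      F (affineDer (.beta i m) (affineDer (.beta i' n) g)) -
        F (affineDer (.beta i' n) (affineDer (.beta i m) g)) +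
      ∑ j, ((ab (.beta i m) (affineMulX (.beta i' n) j (F (dualX j g))) -
          affineMulX (.beta i' n) j (ab (.beta i m) (F (dualX j g)))) -
        (ab (.beta i' n) (affineMulX (.beta i m) j (F (dualX j g))) -
          affineMulX (.beta i m) j (ab (.beta i' n) (F (dualX j g))))) := by
  simp only [ab_beta_affineMulX, add_sub_cancel_left, affineB, map_sum, LinearMap.sum_apply,
    Finsupp.linearCombination_single, LinearMap.smul_apply, mulBracket_affine_alpha]
  by_cases hm : m = 0
  · by_cases hn : n = 0
    · subst hm hn
      simp only [affineDer, if_true, ne_eq, not_true_eq_false, and_false, if_false, sub_self,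
        add_zero, zero_smul, Finset.sum_const_zero]
      rw [← map_sub, twistedX_comm, map_sum]
      simp only [map_smul]
    · subst hm
      simp [affineDer, hn]
  · by_cases h : m + n = 0
    · have hn : n ≠ 0 := by omega
      have h' : n + m = 0 := by omega
      simp only [affineDer, h, h', hm, hn, if_true, if_false, LinearMap.zero_apply, map_zero,
        sub_self, zero_add, ne_eq, not_false_eq_true, and_self]
      refine Finset.sum_congr rfl fun k _ => ?_
      rw [← sub_smul]
      have e1 : eps i k i' = -eps i i' k := eps_swap_right _ _ _
      have e2 : eps i' k i = eps i i' k := by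
        rw [eps_swap_right i' i k, eps_swap_left i i' k, neg_neg]
      rw [e1, e2]
      congr 1
      push_cast
      ring
    · have h' : ¬ n + m = 0 := by omega
      simp [affineDer, h, h', hm]

theorem affine_bracket (a b : AGen) (F : SmoothX →ₗ[ℂ] HsX) (g : SmoothX) :
    Finsupp.linearCombination ℂ (mulBracket affineDer dualX affineMulX) (affineB.bracket a b) F g =
    F (affineDer a (affineDer b g)) - F (affineDer b (affineDer a g)) +
      ∑ j, ((ab a (affineMulX b j (F (dualX j g))) - affineMulX b j (ab a (F (dualX j g)))) -
        (ab b (affineMulX a j (F (dualX j g))) - affineMulX a j (ab b (F (dualX j g))))) := by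
  have hone : ∀ (P : Prop) [Decidable P] (r : ℂ), Finsupp.linearCombination ℂ
      (mulBracket affineDer dualX affineMulX)
      (if P then Finsupp.single AGen.one r else 0) = 0 := by
    intro P _ r
    split_ifs
    · rw [Finsupp.linearCombination_single, mulBracket_affine_one, smul_zero]
    · exact map_zero _
  have hda : ∀ i j m n, affineDer (.alpha i m) (affineDer (.beta j n) g) =
      affineDer (.beta j n) (affineDer (.alpha i m) g) := by
    intro i j m n
    simp only [affineDer]
    split_ifs <;> simp only [LinearMap.zero_apply, map_zero, dualX_twistedX]
  have hc : ∀ (y : AGen), (∀ k n, affineB.bracket y (.alpha k n) = 0) → ∀ y' j v,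
      ab y (affineMulX y' j v) - affineMulX y' j (ab y v) = 0 := fun y hy y' j v =>
    sub_eq_zero.2 (affineMulX_comm_of (T := ab y) (fun k n v => ab_comm (hy k n) v) y' j v)
  have hca : ∀ i m y' j v, ab (.alpha i m) (affineMulX y' j v) -
      affineMulX y' j (ab (.alpha i m) v) = 0 := fun i m => hc (.alpha i m) fun _ _ => rfl
  have hc1 : ∀ y' j v, ab .one (affineMulX y' j v) - affineMulX y' j (ab .one v) = 0 :=
    hc .one fun _ _ => rfl
  have hXa : ∀ i m j v, affineMulX (.alpha i m) j v = 0 := fun _ _ _ _ => rfl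
  have hX1 : ∀ j v, affineMulX .one j v = 0 := fun _ _ => rfl
  rcases a with ⟨i, m⟩ | ⟨i, m⟩ | _ <;> rcases b with ⟨i', n⟩ | ⟨i', n⟩ | _
  · simp only [hca, sub_self, Finset.sum_const_zero, add_zero, affineDer]
    split_ifs <;> simp only [LinearMap.zero_apply, map_zero, sub_self, dualX_comm i i'] <;> rfl
  · simp only [hca, hXa, hda, map_zero, sub_self, Finset.sum_const_zero, add_zero]
    rw [show affineB.bracket (.alpha i m) (.beta i' n) =
      if i' = i ∧ n + m = 0 then Finsupp.single .one (-(n : ℂ)) else 0 by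
        rw [Finsupp.single_neg]; rfl, hone]
    rfl
  · simp only [hca, hc1, sub_self, Finset.sum_const_zero, add_zero, affineDer,
      LinearMap.zero_apply, map_zero]
    rfl
  · simp only [hca, hXa, hda, map_zero, sub_self, Finset.sum_const_zero, add_zero]
    exact LinearMap.congr_fun (LinearMap.congr_fun (hone _ _) F) g
  · exact affine_bracket_beta i i' m n F g
  · simp only [hc1, hX1, sub_self, Finset.sum_const_zero, add_zero, affineDer,
      LinearMap.zero_apply, map_zero]
    rfl
  all_goals
    simp only [hc1, hX1, sub_self, Finset.sum_const_zero, add_zero, affineDer,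
      LinearMap.zero_apply, map_zero]
    rfl

theorem mulData_affine : MulData affineB .one affineMix affineAction mulSmoothX affineDer
    dualX affineMulX where
  X_fAct y j f v :=
    (affineMulX_comm_of (T := af f) (fun k n v => (ab_alpha_af k n f v).symm) y j v).symm
  X_comm a b j l v := by
    rcases a with ⟨i, m⟩ | ⟨i, m⟩ | _ <;>
      try exact (map_zero (affineMulX b l)).symm
    exact affineMulX_comm_of (T := affineMulX (.beta i m) j) (fun k n v => (affineMulX_comm_of
      (T := ab (.alpha k n)) (fun _ _ _ => ab_comm rfl _) (.beta i m) j v).symm) b l v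
  pd_comm := dualX_comm
  pd_δ j y g := by
    rcases y with ⟨i, m⟩ | ⟨i, m⟩ | _ <;> simp only [affineDer, LinearMap.zero_apply, map_zero]
    · split_ifs
      · exact dualX_comm _ _ _
      · exact map_zero _
    · split_ifs
      · exact dualX_twistedX _ _ _
      · exact map_zero _
  bracket := affine_bracket
  X_vac y j c hy := by
    rcases y with ⟨i, m⟩ | ⟨i, m⟩ | _ <;> try rfl
    rw [affineMulX_beta]
    refine Finset.sum_eq_zero fun k _ => ?_
    rcases (show 0 ≤ m by simpa [affineB] using hy).eq_or_lt with rfl | hm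
    · simp
    · rw [bAct_vac (y := AGen.alpha k m) hy, extendedAction, if_neg (by simp [affineB]; omega),
        LinearMap.zero_apply, map_zero, smul_zero]
  leibniz y g c _ := by
    rcases y with ⟨i, m⟩ | ⟨i, m⟩ | _
    · simp only [extendedAction, affineB, affineDer, mul_eq_zero, OfNat.ofNat_ne_zero, false_or]
      split_ifs
      · exact derivX_mul g c
      · simp
    · simp only [extendedAction, affineB, affineDer, mul_eq_zero, OfNat.ofNat_ne_zero, false_or]
      split_ifs
      · exact derivX_mul g c
      · simp
    · rw [extendedAction, if_pos (show affineB.deg .one = 0 from rfl)]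
      simp [affineAction, affineDer]

theorem existsUnique_isMultiplicationX : ∃! M, IsMultiplicationX M := by
  have hX : ∀ (M : SmoothX →ₗ[ℂ] HsX →ₗ[ℂ] HsX) g i n v,
      ∑ j, affineMulX (.beta i n) j (M (dualX j g) v) = ∑ j, ∑ k, (-(eps i j k : ℂ) / (2 * n)) •
        ab (.alpha k n)
          (M (derivX (dualField j) (contDiff_dualField j) (dualField_inv j) g) v) :=
    fun M g i n v => Finset.sum_congr rfl fun j _ => affineMulX_beta _ _ _ _
  obtain ⟨M, h1, h2, h3⟩ := mulData_affine.exists_mul isDecoupling_affine rfl rfl rfl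
  have hM : IsMultiplicationX M := by
    refine ⟨h1, fun g i n v hn => ?_, h2, fun g i n v hn => ?_⟩
    · refine (sub_eq_zero.1 ((h3 (.alpha i n) g v).trans ?_)).symm
      simp [affineDer, affineMulX, hn]
    · rw [h3, hX]
      simp [affineDer, hn]
  refine ⟨M, hM, fun M' hM' => ?_⟩
  have hb : ∀ M, IsMultiplicationX M → ∀ y, affineB.deg y < 0 → ∀ g v,
      ab y (M g v) - M g (ab y v) = ∑ j, affineMulX y j (M (dualX j g) v) := by
    intro M hM y hy g v
    rcases y with ⟨i, m⟩ | ⟨i, m⟩ | _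
    · rw [hM.2.1 g i m v (by rintro rfl; exact absurd hy (lt_irrefl _)), sub_self]
      exact (Finset.sum_eq_zero fun _ _ => rfl).symm
    · rw [hX]
      exact hM.2.2.2 g i m v (by rintro rfl; exact absurd hy (lt_irrefl _))
    · exact absurd hy (lt_irrefl _)
  exact isDecoupling_affine.mul_unique (fun g c => (hM'.1 g c).trans (hM.1 g c).symm) hM'.2.2.1
    hM.2.2.1 (hb M' hM') (hb M hM)

end Affine

/-! ### Fields over `X` -/

section AffineFields

/-- The decoupled even modes, as linear maps. -/
def affineTildeMap (y : AGen) : HsX →ₗ[ℂ] HsX :=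
  isDecoupling_affine.tilde (ρ := affineAction) rfl y

theorem affineTilde_eq (y : AGen) : affineTilde y = affineTildeMap y := funext fun v => by
  rw [affineTilde, affineShift_eq]; exact (isDecoupling_affine.tilde_apply rfl y v).symm

theorem affineCurrent_alpha (i : Fin 3) (n : ℤ) :
    affineCurrent (.alpha i) n = affineTildeMap (.alpha i n) := affineTilde_eq _

theorem affineCurrent_beta (i : Fin 3) (n : ℤ) :
    affineCurrent (.beta i) n = affineTildeMap (.beta i n) := affineTilde_eq _

theorem exists_affineCurrent_eq (x : Cur) (n : ℤ) :
    ∃ y, affineB.deg y = 2 * n ∧ affineCurrent x n = affineTildeMap y := by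
  cases x with
  | alpha i => exact ⟨.alpha i n, rfl, affineCurrent_alpha i n⟩
  | beta i => exact ⟨.beta i n, rfl, affineCurrent_beta i n⟩

theorem affineTildeMap_af (y : AGen) (f : FGen) (v : HsX) :
    af f (affineTildeMap y v) = affineTildeMap y (af f v) :=
  (isDecoupling_affine.tilde_fAct rfl y f v).symm

/-- The degree filtration. -/
abbrev affineFilt (e : ℤ) : Submodule ℂ HsX := sFilt affineB .one affineMix affineAction e

theorem affineTildeMap_mem_filt (y : AGen) {e : ℤ} {v : HsX} (hv : v ∈ affineFilt e) :
    affineTildeMap y v ∈ affineFilt (e + affineB.deg y) :=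
  isDecoupling_affine.tilde_mem_filt rfl y hv

/-- The modes `x^i_n`, as linear maps. -/
def affineXMap (i : Fin 3) (n : ℤ) : HsX →ₗ[ℂ] HsX :=
  (-(1 / (n : ℂ))) • affineTildeMap (.alpha i n)

theorem affineX_eq (i : Fin 3) (n : ℤ) : affineX i n = affineXMap i n := funext fun v => by
  rw [affineX, affineTilde_eq]; rfl

theorem affineXMap_zero (i : Fin 3) (v : HsX) : affineXMap i 0 v = 0 := by
  simp [affineXMap]

theorem commutingModes_affine : CommutingModes affineXMap affineFilt where
  pos _ he _ hv := IsDecoupling.sFilt_pos he hv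
  exhaustive := isDecoupling_affine.exists_mem_sFilt
  comm i j m n v := by
    simp only [affineXMap, LinearMap.smul_apply, map_smul]
    rw [smul_comm, show affineTildeMap (.alpha i m) (affineTildeMap (.alpha j n) v) =
      affineTildeMap (.alpha j n) (affineTildeMap (.alpha i m) v) from
        isDecoupling_affine.tilde_comm rfl rfl v]
  mem i n _ _ hv := Submodule.smul_mem _ _ (affineTildeMap_mem_filt (.alpha i n) hv)

theorem commute_affineXMap {T : HsX →ₗ[ℂ] HsX}
    (h : ∀ y v, T (affineTildeMap y v) = affineTildeMap y (T v)) (i : Fin 3) (n : ℤ) (v : HsX) :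
    T (affineXMap i n v) = affineXMap i n (T v) := by
  simp only [affineXMap, LinearMap.smul_apply, map_smul, h]

/-- The modes `y_{i,n}`, as linear maps. -/
def affineYMap (i : Fin 3) (n : ℤ) : HsX →ₗ[ℂ] HsX :=
  (1 / (n : ℂ)) • (-affineTildeMap (.beta i n)
    + (∑ j, ∑ k, (eps i j k : ℂ) • (affineTildeMap (.alpha j 0) ∘ₗ affineXMap k n))
    + commutingModes_affine.quadMode i n)

theorem affineYMap_apply (i : Fin 3) (n : ℤ) (v : HsX) : affineYMap i n v =
    (1 / (n : ℂ)) • (-affineTildeMap (.beta i n) v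
      + (∑ j, ∑ k, (eps i j k : ℂ) • affineTildeMap (.alpha j 0) (affineXMap k n v))
      + commutingModes_affine.quadMode i n v) := by
  simp only [affineYMap, LinearMap.smul_apply, LinearMap.add_apply, LinearMap.neg_apply,
    LinearMap.sum_apply, LinearMap.comp_apply]

/-- The omitted indices contribute nothing: the factor `m` vanishes at `m = 0`, and at `m = n` the
mode `x_0 = -(1/0) α_0` is zero by convention. So the restricted sums are instances of `quadMode`.
-/
theorem finsum_affineXMap (p : ℤ → Prop) (j k : Fin 3) (n : ℤ) (hp : ∀ m, ¬ p m → m = 0 ∨ m = n)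
    (v : HsX) : ∑ᶠ m : Subtype p, (m.1 : ℂ) • affineXMap j (n - m.1) (affineXMap k m.1 v) =
      ∑ᶠ m : ℤ, (m : ℂ) • affineXMap j (n - m) (affineXMap k m v) := by
  rw [finsum_subtype_eq_finsum_cond
    (f := fun m : ℤ => (m : ℂ) • affineXMap j (n - m) (affineXMap k m v)) p]
  classical
  refine finsum_congr fun m => ?_
  by_cases h : p m
  · exact finsum_eq_if.trans (if_pos h)
  · refine finsum_eq_if.trans ((if_neg h).trans ?_)
    rcases hp m h with rfl | rfl
    · rw [Int.cast_zero, zero_smul]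
    · rw [sub_self, affineXMap_zero, smul_zero]

theorem affineOps_y (M : SmoothX →ₗ[ℂ] (HsX →ₗ[ℂ] HsX)) (i : Fin 3) (n : ℤ) :
    (affineOps M).y i n = affineYMap i n := by
  funext v
  rw [affineYMap_apply, CommutingModes.quadMode_apply]
  simp only [affineOps, affineX_eq, affineTilde_eq]
  congr 2
  refine Finset.sum_congr rfl fun j _ => Finset.sum_congr rfl fun k _ => ?_
  congr 1
  exact finsum_affineXMap (fun m => m ≠ 0 ∧ m ≠ n) j k n (fun m h => by tauto) v

theorem affineOps_d (M : SmoothX →ₗ[ℂ] (HsX →ₗ[ℂ] HsX)) (i : Fin 3) :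
    (affineOps M).d i =
      (affineTildeMap (.beta i 0) - commutingModes_affine.quadMode i 0 : HsX →ₗ[ℂ] HsX) := by
  funext v
  rw [LinearMap.sub_apply, CommutingModes.quadMode_apply]
  simp only [affineOps, affineX_eq, affineTilde_eq]
  congr 1
  refine Finset.sum_congr rfl fun j _ => Finset.sum_congr rfl fun k _ => ?_
  congr 1
  simp only [← zero_sub]
  exact finsum_affineXMap (fun m => m ≠ 0) j k 0 (fun m h => by tauto) v

theorem affineYMap_mem_filt (i : Fin 3) (n : ℤ) {e : ℤ} {v : HsX} (hv : v ∈ affineFilt e) :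
    affineYMap i n v ∈ affineFilt (e + 2 * n) := by
  rw [affineYMap_apply]
  refine Submodule.smul_mem _ _ (Submodule.add_mem _ (Submodule.add_mem _ (Submodule.neg_mem _
    (affineTildeMap_mem_filt (.beta i n) hv)) ?_)
    (commutingModes_affine.quadMode_mem_filt i n hv))
  refine Submodule.sum_mem _ fun j _ => Submodule.sum_mem _ fun k _ => Submodule.smul_mem _ _ ?_
  have h := affineTildeMap_mem_filt (.alpha j 0) (commutingModes_affine.mem k n e v hv)
  rwa [show affineB.deg (.alpha j 0) = 0 from rfl, add_zero] at h

theorem affineD_mem_filt (i : Fin 3) {e : ℤ} {v : HsX} (hv : v ∈ affineFilt e) :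
    (affineTildeMap (.beta i 0) - commutingModes_affine.quadMode i 0) v ∈ affineFilt e := by
  have h1 := affineTildeMap_mem_filt (.beta i 0) hv
  have h2 := commutingModes_affine.quadMode_mem_filt i 0 hv
  rw [show affineB.deg (.beta i 0) = 0 from rfl, add_zero] at h1
  rw [mul_zero, add_zero] at h2
  exact Submodule.sub_mem _ h1 h2

theorem isModes_affineCurrent (x : Cur) : IsModes (affineCurrent x) where
  linear n := by
    obtain ⟨y, -, h⟩ := exists_affineCurrent_eq x n
    rw [h]; exact (affineTildeMap y).isLinear
  bounded v := by
    obtain ⟨e, he⟩ := commutingModes_affine.exhaustive v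
    refine ⟨|e| + 1, fun n hn => ?_⟩
    obtain ⟨y, hy, h⟩ := exists_affineCurrent_eq x n
    rw [h]
    refine commutingModes_affine.pos _ ?_ _ (affineTildeMap_mem_filt y he)
    have := neg_abs_le e
    have := abs_nonneg e
    omega

theorem affineVacuum_mem_filt : affineVacuum ∈ affineFilt 0 := vac_mem_filt _ _ _

theorem affineCurrent_vacuum (x : Cur) (n : ℤ) (hn : 0 ≤ n) :
    affineCurrent x n affineVacuum = 0 := by
  rcases hn.eq_or_lt with rfl | hn
  · cases x with
    | alpha i =>
      rw [affineCurrent_alpha]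
      refine (isDecoupling_affine.tilde_vac rfl (y := .alpha i 0) le_rfl _).trans ?_
      rw [extendedAction, if_pos (show affineB.deg (.alpha i 0) = 0 from rfl), affineAction,
        derivX_one, map_zero]
    | beta i =>
      rw [affineCurrent_beta]
      refine (isDecoupling_affine.tilde_vac rfl (y := .beta i 0) le_rfl _).trans ?_
      rw [extendedAction, if_pos (show affineB.deg (.beta i 0) = 0 from rfl), affineAction,
        derivX_one, map_zero]
  · obtain ⟨y, hy, h⟩ := exists_affineCurrent_eq x n
    rw [h]
    exact commutingModes_affine.pos _ (by omega) _
      (affineTildeMap_mem_filt y affineVacuum_mem_filt)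

theorem isGraded_affineOps (M : SmoothX →ₗ[ℂ] (HsX →ₗ[ℂ] HsX)) :
    (affineOps M).IsGraded affineFilt := by
  refine ExpansionOps.isGraded commutingModes_affine.pos commutingModes_affine.exhaustive
    (fun i n _ => ?_) (fun i => ?_) (fun i n _ => ?_) (fun i => ?_)
    (fun g => (M g).isLinear) (fun i n _ e v hv => ?_) (fun i e v hv => ?_)
    (fun i n _ e v hv => ?_) (fun i e v hv => ?_)
  · simp only [affineOps, affineX_eq]; exact (affineXMap i n).isLinear
  · simp only [affineOps, affineTilde_eq]; exact (affineTildeMap (.alpha i 0)).isLinear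
  · rw [affineOps_y]; exact (affineYMap i n).isLinear
  · rw [affineOps_d]; exact LinearMap.isLinear _
  · simp only [affineOps, affineX_eq]; exact commutingModes_affine.mem i n e v hv
  · simp only [affineOps, affineTilde_eq]
    have h := affineTildeMap_mem_filt (.alpha i 0) hv
    rwa [show affineB.deg (.alpha i 0) = 0 from rfl, add_zero] at h
  · rw [affineOps_y]; exact affineYMap_mem_filt i n hv
  · rw [affineOps_d]; exact affineD_mem_filt i hv

theorem affineBosonicField_creates {M : SmoothX →ₗ[ℂ] (HsX →ₗ[ℂ] HsX)}
    (hM : IsMultiplicationX M) {v : HsX} {A : LogField HsX} (h : AffineBosonicField M v A) :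
    Creates affineVacuum v A := by
  have hx : ∀ i n, 0 < n → affineXMap i n affineVacuum = 0 := fun i n hn =>
    commutingModes_affine.pos _ (by omega) _
      (commutingModes_affine.mem i n 0 _ affineVacuum_mem_filt)
  refine bosonState_creates isModes_affineCurrent (isGraded_affineOps M) affineCurrent_vacuum
    (Term.right_vacuum (fun i n hn => ?_) (fun i => affineCurrent_vacuum (.alpha i) 0 le_rfl)
      (fun i => ?_) (fun i n hn => ?_) (fun i => ?_)) (fun f => ?_) h
  · simp only [affineOps, affineX_eq]; exact hx i n hn
  · simp only [affineOps, affineTilde_eq, map_zero]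
  · rw [affineOps_y]
    exact commutingModes_affine.pos _ (by omega) _ (affineYMap_mem_filt i n affineVacuum_mem_filt)
  · rw [affineOps_d]
    have h := affineCurrent_vacuum (.beta i) 0 le_rfl
    rw [affineCurrent_beta] at h
    exact (congrArg₂ (· - ·) h (commutingModes_affine.quadMode_vacuum i hx)).trans (sub_zero 0)
  · exact (hM.1 f _).trans (by rw [SmoothX.mul_one])

theorem affineBosonicField_trivialOPE {M : SmoothX →ₗ[ℂ] (HsX →ₗ[ℂ] HsX)}
    (hM : IsMultiplicationX M) {v w : HsX} {A A' : LogField HsX} {p : Bool}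
    (h : AffineBosonicField M v A) (h' : AffineFermionicField p w A') : TrivialOPE A A' := by
  have hX : ∀ f i n v, af f (affineXMap i n v) = affineXMap i n (af f v) := fun f =>
    commute_affineXMap (T := af f) fun y v => affineTildeMap_af y f v
  have hq : ∀ f i n v, af f (commutingModes_affine.quadMode i n v) =
      commutingModes_affine.quadMode i n (af f v) := fun f =>
    commutingModes_affine.commute_quadMode (hX f)
  refine isDecoupling_affine.bosonState_trivialOPE isModes_affineCurrent (isGraded_affineOps M)
    (fun f x n v => ?_) (fun f i n v => ?_) (fun f i v => ?_)
    (fun f i n v => ?_) (fun f i v => ?_) (fun f g v => (hM.2.2.1 g f v).symm) h h'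
  · obtain ⟨y, -, h⟩ := exists_affineCurrent_eq x n
    rw [h]; exact affineTildeMap_af y f v
  · simp only [affineOps, affineX_eq]; exact hX f i n v
  · simp only [affineOps, affineTilde_eq]; exact affineTildeMap_af _ f v
  · rw [affineOps_y]
    simp only [affineYMap_apply, map_smul, map_add, map_neg, map_sum, affineTildeMap_af, hX, hq]
  · rw [affineOps_d]
    simp only [LinearMap.sub_apply, map_sub, affineTildeMap_af, hq]

/-- Over `X` the currents are the decoupled modes themselves, so stability under creation modes is
immediate. -/
theorem affineBosonicField_iff {Φ : (HbX ⊗[ℂ] Fock) ≃ₗ[ℂ] HsX}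
    (hΦ : IsFactorization affineB .one affineMix affineAction affineShift Φ)
    (M : SmoothX →ₗ[ℂ] (HsX →ₗ[ℂ] HsX)) (v : HsX) :
    (∃ A, AffineBosonicField M v A) ↔ ∃ h, v = Φ (h ⊗ₜ fockVac) := by
  refine isDecoupling_affine.bosonState_iff rfl affineShift_eq hΦ (fun x n _ v hv => ?_)
    (fun y hy v hv => ?_) v
  · obtain ⟨y, -, h⟩ := exists_affineCurrent_eq x n
    rw [h]
    exact isDecoupling_affine.tilde_mem_bosonFactor rfl affineShift_eq hΦ y hv
  · rcases y with ⟨i, n⟩ | ⟨i, n⟩ | _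
    · have h := cur_mem_fieldStates (.alpha i) (show n < 0 by simp only [affineB] at hy; omega) hv
      rwa [affineCurrent_alpha] at h
    · have h := cur_mem_fieldStates (.beta i) (show n < 0 by simp only [affineB] at hy; omega) hv
      rwa [affineCurrent_beta] at h
    · exact absurd hy (lt_irrefl _)

end AffineFields

end SuperLoop

end

/-! ### Assembly of the theorem -/

theorem mainTheorem1 :
    -- the free fermion system: `ψ^*_i(z) ψ^j(w) ∼ δ_i^j / (z - w)`, the other OPEs are trivial
    (∀ i j : Fin 3,
        HasOPE (-1) (fun n => act fermions fermionsAction (.inr (.psis i n)))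
          (fun n => act fermions fermionsAction (.inr (.psi j n)))
          1 (fun _ => constField (if i = j then 1 else 0)) ∧
        HasOPE (-1) (fun n => act fermions fermionsAction (.inr (.psi i n)))
          (fun n => act fermions fermionsAction (.inr (.psi j n))) 0 (fun _ => constField 0) ∧
        HasOPE (-1) (fun n => act fermions fermionsAction (.inr (.psis i n)))
          (fun n => act fermions fermionsAction (.inr (.psis j n))) 0 (fun _ => constField 0)) ∧
    -- the factorization over every coordinate domain
    (∀ U : TopologicalSpace.Opens E,
      ∃ Φ : (Hb U ⊗[ℂ] Fock) ≃ₗ[ℂ] Hs U,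
        IsFactorization loopB .hbar loopMix (loopAction U) (loopShift U) Φ ∧
        (∀ Φ', IsFactorization loopB .hbar loopMix (loopAction U) (loopShift U) Φ' → Φ' = Φ) ∧
        PreservesGradings loopB .hbar loopMix (loopAction U) Φ ∧
        CompletesToHilbertTensor Φ ∧
        (∃! M, IsMultiplication U M) ∧
        ∀ M, IsMultiplication U M →
          -- every vector of `ℋ^b ⊗ |0⟩`, and no other, has a bosonic field
          (∀ v, (∃ A, BosonicField U M v A) ↔ ∃ h, v = Φ (h ⊗ₜ fockVac)) ∧
          -- every vector of `|0⟩ ⊗ ℋ^f`, and no other, has a fermionic field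
          (∀ p v, (∃ A, FermionicField U p v A) ↔
            ∃ b ∈ parityPart fermions fermionsAction p,
              v = Φ (vac loopB (loopAction U) (Smooth.one U) ⊗ₜ b)) ∧
          (∀ v A, BosonicField U M v A → Creates (loopVacuum U) v A) ∧
          (∀ p v A, FermionicField U p v A → Creates (loopVacuum U) v A) ∧
          (∀ v A p w B, BosonicField U M v A → FermionicField U p w B → TrivialOPE A B)) ∧
    -- the global factorization over `X`
    (∃ Φ : (HbX ⊗[ℂ] Fock) ≃ₗ[ℂ] HsX,
      IsFactorization affineB .one affineMix affineAction affineShift Φ ∧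
      (∀ Φ', IsFactorization affineB .one affineMix affineAction affineShift Φ' → Φ' = Φ) ∧
      PreservesGradings affineB .one affineMix affineAction Φ ∧
      CompletesToHilbertTensor Φ ∧
      (∀ hb hf, ContravariantB hb → ContravariantF hf →
        ∃ h, ContravariantS h ∧ (∀ h', ContravariantS h' → h' = h) ∧
          ∀ a a' b b', h (Φ (a ⊗ₜ b)) (Φ (a' ⊗ₜ b')) = hb a a' * hf b b') ∧
      (∃! M, IsMultiplicationX M) ∧
      ∀ M, IsMultiplicationX M →
        (∀ v, (∃ A, AffineBosonicField M v A) ↔ ∃ h, v = Φ (h ⊗ₜ fockVac)) ∧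
        (∀ p v, (∃ A, AffineFermionicField p v A) ↔
          ∃ b ∈ parityPart fermions fermionsAction p,
            v = Φ (vac affineB affineAction SmoothX.one ⊗ₜ b)) ∧
        (∀ v A, AffineBosonicField M v A → Creates affineVacuum v A) ∧
        (∀ p v A, AffineFermionicField p v A → Creates affineVacuum v A) ∧
        (∀ v A p w B, AffineBosonicField M v A → AffineFermionicField p w B →
          TrivialOPE A B)) := by
  have hF := isDecoupling_fermions.fAct_psis_psi (ρ := fun _ => (LinearMap.id : ℂ →ₗ[ℂ] ℂ)) rfl
  refine ⟨fun i j => ⟨fun m n v => ?_, fun m n v => ?_, fun m n v => ?_⟩, fun U => ?_, ?_⟩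
  · simp only [Finset.range_one, Finset.sum_singleton, Nat.cast_zero, sub_zero, Ring.choose_zero_right,
      Int.cast_one, one_smul, constField]
    rw [hF i j m n v]
    by_cases h1 : i = j <;> by_cases h2 : m + n = -1 <;> simp [h1, h2]
  · rw [Finset.range_zero, Finset.sum_empty, neg_smul, one_smul, sub_neg_eq_add]
    exact add_eq_zero_iff_eq_neg.2 (fAct_psi_psi i j m n v)
  · rw [Finset.range_zero, Finset.sum_empty, neg_smul, one_smul, sub_neg_eq_add]
    exact add_eq_zero_iff_eq_neg.2 (fAct_psis_psis i j m n v)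
  · obtain ⟨Φ, hΦ⟩ := isDecoupling_loop.exists_factorization (ρ := loopAction U) rfl loopShift_eq
    refine ⟨Φ, hΦ, fun Φ' h' => h'.unique hΦ,
      isDecoupling_loop.preservesGradings rfl loopShift_eq hΦ, completesToHilbertTensor Φ,
      existsUnique_isMultiplication U, fun M hM => ⟨bosonicField_iff hΦ M,
      isDecoupling_loop.fermionState_iff rfl hΦ (Smooth.one U),
      fun v A h => bosonicField_creates hM h,
      fun p v A h => isDecoupling_loop.fermionState_creates (Smooth.one U) h,
      fun v A p w B h h' => bosonicField_trivialOPE hM h h'⟩⟩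
  · obtain ⟨Φ, hΦ⟩ := isDecoupling_affine.exists_factorization (ρ := affineAction) rfl
      affineShift_eq
    refine ⟨Φ, hΦ, fun Φ' h' => h'.unique hΦ,
      isDecoupling_affine.preservesGradings rfl affineShift_eq hΦ, completesToHilbertTensor Φ,
      fun hb hf Hb Hf => ?_, existsUnique_isMultiplicationX, fun M hM => ⟨affineBosonicField_iff hΦ M,
      isDecoupling_affine.fermionState_iff rfl hΦ SmoothX.one,
      fun v A h => affineBosonicField_creates hM h,
      fun p v A h => isDecoupling_affine.fermionState_creates SmoothX.one h,
      fun v A p w B h h' => affineBosonicField_trivialOPE hM h h'⟩⟩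
    -- The decisive condition is that on `s`: for `β` the sign is `-1` and the factor `1/2` is real,
    -- so it reads `1/2 = -(-1 · 1/2)`.
    refine isDecoupling_affine.contravariant rfl affineShift_eq hΦ (fun y => ?_) (fun y => ?_)
      (fun y => ?_) (fun y => ?_) (fun y => ?_) (fun y => ?_) Hb Hf <;>
      rcases y with ⟨i, n⟩ | ⟨i, n⟩ | _ <;>
      simp [affineDag, affineB, affineSign, affineDir, affineDeg, affineFactor, map_ofNat]
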